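/- A Clifford+T circuit computation on $n$ qubits initializes all qubits in $|0\rangle$, applies a finite list $C$ of gates $H$, $S=\mathrm{diag}(1,i)$, $T=\mathrm{diag}(1,e^{i\pi/4})$ and CNOT, measures every qubit in the $0,1$ basis, and applies a classical post-processing to $(n,C)$ and the measured bits, which takes time polynomial in $n$ and the number $|C|$ of gates and returns the outcome (for example a single bit $b_{out}$, or all the measured bits). A Pauli-based computation (PBC) on $m$ qubits starts in the state $|H\rangle^{\otimes m}$, $|H\rangle=\cos(\pi/8)|0\rangle+\sin(\pi/8)|1\rangle$. At each step $t=1,\dots,m$ one performs a non-destructive eigenvalue measurement of an operator $P_t=\pm\,\sigma_1\otimes\cdots\otimes\sigma_m$ with $\sigma_j\in\{I,X,Y,Z\}$, which may depend on the eigenvalues measured before. The outcome is a classical function of the $m$ measured eigenvalues. **Theorem.** Any quantum computation in the circuit-based model with $n$ qubits and $\mathrm{poly}(n)$ gates drawn from the Clifford+T set can be simulated by a PBC on $m$ qubits, where $m$ is the number of $T$ gates, and $\mathrm{poly}(n)$ randomized classical processing. The Pauli operators measured in the PBC can be taken pairwise commuting for all measurement outcomes. Precisely: for every post-processing as above there are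 two classical algorithms and polynomials $\ell,q$ such that, for all $n$ and all Clifford+T circuits $C$ on $n$ qubits with $m$ $T$ gates, the following holds. For every string $r$ of $\ell(n+|C|)$ coin flips there is a PBC $Q_{C,r}$ on $m$ qubits, hence with at most $m$ non-trivial measurements, whose operators $P_1,\dots,P_m$ commute pairwise for all measurement outcomes. The first algorithm computes $P_t$ from $n$, $C$, $r$ and the previously measured eigenvalues, and the second computes the outcome of $Q_{C,r}$ from $n$, $C$, $r$ and all measured eigenvalues, each in time at most $q(n+|C|)$. For uniformly random $r$, the probability that $Q_{C,r}$ has outcome $a$ equals the probability that the circuit computation has outcome $a$, for every $a$. -/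

import Mathlib

open scoped Matrix

namespace PauliBased

/-! ## Classical processing: a programming language with a step count -/

/-- The data of the classical computer: finite binary trees. -/
inductive Data : Type
  | nil : Data
  | cons (a b : Data) : Data

/-- The number of memory cells occupied by a tree. -/
def Data.size : Data → ℕ
  | .nil => 1
  | .cons a b => a.size + b.size + 1

/-- The left subtree (of `nil`: `nil`). -/
def Data.fst : Data → Data
  | .nil => .nil
  | .cons a _ => a

/-- The right subtree (of `nil`: `nil`). -/
def Data.snd : Data → Data
  | .nil => .nil
  | .cons _ b => b

/-- Programs of a small while-language on binary trees. -/
inductive Prog : Type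
  /-- return the input -/
  | id : Prog
  /-- return `nil` -/
  | nil : Prog
  /-- return the left subtree of the input -/
  | fst : Prog
  /-- return the right subtree of the input -/
  | snd : Prog
  /-- run both programs on the input and join the two results -/
  | pair (p q : Prog) : Prog
  /-- run `p`, then run `q` on the result -/
  | seq (p q : Prog) : Prog
  /-- if the result of `c` is not `nil` then run `p` else run `q` -/
  | ite (c p q : Prog) : Prog
  /-- while the result of `c` on the current tree is not `nil`, replace the tree by the
  result of `p` on it -/
  | loop (c p : Prog) : Prog

/-- `Eval p x y t`: on input `x` the program `p` halts with output `y` after time `t`. Every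
execution of a construct costs one unit plus the size of the tree it is applied to, so copying
a tree is charged with its size, and the output is never larger than the time spent. Up to a
polynomial this is the running time of a Turing machine. -/
inductive Eval : Prog → Data → Data → ℕ → Prop
  | id (x : Data) : Eval .id x x (1 + x.size)
  | nil (x : Data) : Eval .nil x .nil (1 + x.size)
  | fst (x : Data) : Eval .fst x x.fst (1 + x.size)
  | snd (x : Data) : Eval .snd x x.snd (1 + x.size)
  | pair {p q : Prog} {x y z : Data} {s t : ℕ} (hp : Eval p x y s) (hq : Eval q x z t) :
      Eval (.pair p q) x (.cons y z) (s + t + (1 + x.size))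
  | seq {p q : Prog} {x y z : Data} {s t : ℕ} (hp : Eval p x y s) (hq : Eval q y z t) :
      Eval (.seq p q) x z (s + t + (1 + x.size))
  | ite_true {c p q : Prog} {x a b y : Data} {s t : ℕ} (hc : Eval c x (.cons a b) s)
      (hp : Eval p x y t) : Eval (.ite c p q) x y (s + t + (1 + x.size))
  | ite_false {c p q : Prog} {x y : Data} {s t : ℕ} (hc : Eval c x .nil s)
      (hq : Eval q x y t) : Eval (.ite c p q) x y (s + t + (1 + x.size))
  | loop_stop {c p : Prog} {x : Data} {s : ℕ} (hc : Eval c x .nil s) :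
      Eval (.loop c p) x x (s + (1 + x.size))
  | loop_step {c p : Prog} {x a b y z : Data} {s t u : ℕ} (hc : Eval c x (.cons a b) s)
      (hp : Eval p x y t) (hl : Eval (.loop c p) y z u) :
      Eval (.loop c p) x z (s + t + u + (1 + x.size))

/-- On input `x` the program `p` halts with output `y` within time `T`. -/
def Prog.RunsIn (p : Prog) (x y : Data) (T : ℕ) : Prop :=
  ∃ t ≤ T, Eval p x y t

/-! ## Encoding of finite objects as trees -/

/-- An injective encoding of the elements of a type as trees. -/
class Encoded (α : Type*) where
  /-- the code of an element -/
  enc : α → Data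
  enc_injective : Function.Injective enc

/-- The code of a natural number is unary. -/
def natCode : ℕ → Data
  | 0 => .nil
  | k + 1 => .cons .nil (natCode k)

theorem natCode_injective : Function.Injective natCode := by
  intro a
  induction a with
  | zero => intro b h; cases b with
    | zero => rfl
    | succ b => simp [natCode] at h
  | succ a ih => intro b h; cases b with
    | zero => simp [natCode] at h
    | succ b =>
      simp only [natCode, Data.cons.injEq, true_and] at h
      rw [ih h]

instance : Encoded ℕ := ⟨natCode, natCode_injective⟩

instance : Encoded Bool where
  enc b := natCode b.toNat
  enc_injective a b h := by
    have := natCode_injective h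
    revert this; cases a <;> cases b <;> simp

instance (n : ℕ) : Encoded (Fin n) where
  enc i := natCode i.val
  enc_injective _ _ h := Fin.ext (natCode_injective h)

instance {α β : Type*} [Encoded α] [Encoded β] : Encoded (α × β) where
  enc x := .cons (Encoded.enc x.1) (Encoded.enc x.2)
  enc_injective x y h := by
    simp only [Data.cons.injEq] at h
    exact Prod.ext (Encoded.enc_injective h.1) (Encoded.enc_injective h.2)

/-- The code of a list is the nested pair of the codes of its entries. -/
def listCode {α : Type*} [Encoded α] : List α → Data
  | [] => .nil
  | a :: l => .cons (Encoded.enc a) (listCode l)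

theorem listCode_injective {α : Type*} [Encoded α] :
    Function.Injective (listCode (α := α)) := by
  intro a
  induction a with
  | nil => intro b h; cases b with
    | nil => rfl
    | cons y b => simp [listCode] at h
  | cons x a ih => intro b h; cases b with
    | nil => simp [listCode] at h
    | cons y b =>
      simp only [listCode, Data.cons.injEq] at h
      rw [ih h.2, Encoded.enc_injective h.1]

instance {α : Type*} [Encoded α] : Encoded (List α) := ⟨listCode, listCode_injective⟩

/-- A tuple is encoded as the list of its entries. -/
instance {α : Type*} [Encoded α] (n : ℕ) : Encoded (Fin n → α) where
  enc f := listCode (List.ofFn f)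
  enc_injective _ _ h := List.ofFn_injective (listCode_injective h)

/-- A sign is encoded by one bit. -/
instance : Encoded ℤˣ where
  enc s := Encoded.enc (decide (s = -1))
  enc_injective a b h := by
    have := Encoded.enc_injective h
    revert this
    rcases Int.units_eq_one_or a with rfl | rfl <;>
      rcases Int.units_eq_one_or b with rfl | rfl <;> decide

/-! ## Qubits and Pauli operators -/

/-- Vectors in the state space of `n` qubits: coordinates in the computational basis. -/
abbrev QVec (n : ℕ) : Type := (Fin n → Fin 2) → ℂ

/-- Linear operators on the state space of `n` qubits. -/
abbrev QOp (n : ℕ) : Type := Matrix (Fin n → Fin 2) (Fin n → Fin 2) ℂ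

/-- The single-qubit Pauli labels. -/
inductive Pauli : Type
  | I : Pauli
  | X : Pauli
  | Y : Pauli
  | Z : Pauli

/-- The single-qubit Pauli matrices. -/
def Pauli.matrix : Pauli → Matrix (Fin 2) (Fin 2) ℂ
  | .I => !![1, 0; 0, 1]
  | .X => !![0, 1; 1, 0]
  | .Y => !![0, -Complex.I; Complex.I, 0]
  | .Z => !![1, 0; 0, -1]

/-- The code of a Pauli label: its `X`-part and its `Z`-part. -/
def Pauli.bits : Pauli → Bool × Bool
  | .I => (false, false)
  | .X => (true, false)
  | .Y => (true, true)
  | .Z => (false, true)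

instance : Encoded Pauli where
  enc p := Encoded.enc p.bits
  enc_injective p q h := by
    have := Encoded.enc_injective h
    revert this
    cases p <;> cases q <;> simp [Pauli.bits]

/-- Hermitian `n`-qubit Pauli operators: a sign and one Pauli label for every qubit. -/
abbrev PauliOp (n : ℕ) : Type := ℤˣ × (Fin n → Pauli)

/-- The operator: the sign times the tensor product of the single-qubit Pauli matrices. -/
noncomputable def PauliOp.matrix {n : ℕ} (P : PauliOp n) : QOp n :=
  fun x y => ((P.1 : ℤ) : ℂ) * ∏ j, (P.2 j).matrix (x j) (y j)

/-! ## Clifford+T circuits -/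

/-- The Clifford+T gates on `n` qubits. -/
inductive Gate (n : ℕ) : Type
  | H (q : Fin n) : Gate n
  | S (q : Fin n) : Gate n
  | T (q : Fin n) : Gate n
  | CNOT (control target : Fin n) (h : control ≠ target) : Gate n

/-- The single-qubit operator `U` applied to qubit `q`. -/
def onQubit {n : ℕ} (q : Fin n) (U : Matrix (Fin 2) (Fin 2) ℂ) : QOp n :=
  fun x y => if ∀ j, j ≠ q → x j = y j then U (x q) (y q) else 0

/-- The unitary operator of a gate. -/
noncomputable def Gate.matrix {n : ℕ} : Gate n → QOp n
  | .H q => onQubit q ((1 / (Real.sqrt 2 : ℂ)) • !![1, 1; 1, -1])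
  | .S q => onQubit q !![1, 0; 0, Complex.I]
  | .T q => onQubit q !![1, 0; 0, Complex.exp (Complex.I * (Real.pi : ℂ) / 4)]
  | .CNOT c t _ => fun x y => if x = Function.update y t (y t + y c) then 1 else 0

/-- Whether a gate is a T gate. -/
def Gate.isT {n : ℕ} : Gate n → Bool
  | .T _ => true
  | _ => false

/-- The code of a gate: its kind and the list of qubits it acts on. -/
def Gate.code {n : ℕ} : Gate n → ℕ × List (Fin n)
  | .H q => (0, [q])
  | .S q => (1, [q])
  | .T q => (2, [q])
  | .CNOT c t _ => (3, [c, t])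

instance (n : ℕ) : Encoded (Gate n) where
  enc g := Encoded.enc g.code
  enc_injective a b h := by
    have := Encoded.enc_injective h
    revert this
    cases a <;> cases b <;> simp [Gate.code]

/-- A Clifford+T circuit on `n` qubits: a list of gates, the first one acting first. -/
abbrev Circuit (n : ℕ) : Type := List (Gate n)

/-- The number of T gates. -/
def Circuit.tCount {n : ℕ} (C : Circuit n) : ℕ := C.countP Gate.isT

/-- The basis state in which every qubit is `0`. -/
def ketZero (n : ℕ) : QVec n := fun x => if x = 0 then 1 else 0

/-- The state that the circuit produces from the all-zero state. -/
noncomputable def Circuit.finalState {n : ℕ} (C : Circuit n) : QVec n :=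
  C.foldl (fun ψ g => g.matrix *ᵥ ψ) (ketZero n)

/-- The probability that measuring every qubit in the computational basis at the end of the
circuit yields the bits `x`. -/
noncomputable def Circuit.prob {n : ℕ} (C : Circuit n) (x : Fin n → Fin 2) : ℝ :=
  ‖C.finalState x‖ ^ 2

open Classical in
/-- The probability that the circuit computation with the classical post-processing `f` of the
measured bits has the outcome `a`. -/
noncomputable def Circuit.outcomeProb {n : ℕ} {α : Type*} (C : Circuit n)
    (f : (Fin n → Fin 2) → α) (a : α) : ℝ :=
  ∑ x : Fin n → Fin 2, if f x = a then C.prob x else 0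

/-! ## Pauli-based computation -/

/-- The tensor product of `m` copies of the magic state `cos (π/8) |0⟩ + sin (π/8) |1⟩`. -/
noncomputable def magicState (m : ℕ) : QVec m :=
  fun x => ∏ j, ![(Real.cos (Real.pi / 8) : ℂ), (Real.sin (Real.pi / 8) : ℂ)] (x j)

/-- The unnormalized state after measuring the eigenvalue of `P` with outcome `s`, that is,
`(1 + s P) / 2` applied to the state before the measurement. -/
noncomputable def measured {m : ℕ} (P : PauliOp m) (s : ℤˣ) (φ : QVec m) : QVec m :=
  ((1 / 2 : ℂ) • ((1 : QOp m) + ((s : ℤ) : ℂ) • P.matrix)) *ᵥ φ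

/-- A Pauli-based computation on `m` qubits: `m` adaptive eigenvalue measurements of Pauli
operators, followed by a classical processing of the measured eigenvalues. The outcome has an
arbitrary type; for a computation with a single output bit it is `Bool`. -/
structure PBC (m : ℕ) (α : Type*) where
  /-- the operator measured at step `t`, given all eigenvalues measured before -/
  pauli : (t : Fin m) → (Fin t → ℤˣ) → PauliOp m
  /-- the outcome, given all measured eigenvalues -/
  output : (Fin m → ℤˣ) → α

/-- The unnormalized state after the first `t` measurements gave the eigenvalues `σ`. -/
noncomputable def PBC.state {m : ℕ} {α : Type*} (Q : PBC m α) :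
    (t : ℕ) → t ≤ m → (Fin t → ℤˣ) → QVec m
  | 0, _, _ => magicState m
  | t + 1, ht, σ =>
      measured (Q.pauli ⟨t, ht⟩ (Fin.init σ)) (σ (Fin.last t))
        (Q.state t (Nat.le_of_succ_le ht) (Fin.init σ))

/-- The probability that the measured eigenvalues are `σ`. -/
noncomputable def PBC.prob {m : ℕ} {α : Type*} (Q : PBC m α) (σ : Fin m → ℤˣ) : ℝ :=
  ∑ x, ‖Q.state m le_rfl σ x‖ ^ 2

open Classical in
/-- The probability of the outcome `a`. -/
noncomputable def PBC.outcomeProb {m : ℕ} {α : Type*} (Q : PBC m α) (a : α) : ℝ :=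
  ∑ σ : Fin m → ℤˣ, if Q.output σ = a then Q.prob σ else 0

/-- The operator that is measured at step `t` if the measured eigenvalues are `σ`. -/
def PBC.pauliAt {m : ℕ} {α : Type*} (Q : PBC m α) (σ : Fin m → ℤˣ) (t : Fin m) : PauliOp m :=
  Q.pauli t fun i => σ (i.castLE t.isLt.le)

/-- For all measurement outcomes, the measured operators commute pairwise. -/
def PBC.PairwiseCommuting {m : ℕ} {α : Type*} (Q : PBC m α) : Prop :=
  ∀ (σ : Fin m → ℤˣ) (s t : Fin m), Commute (Q.pauliAt σ s).matrix (Q.pauliAt σ t).matrix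

/-- The probability of the outcome `a` if one of the computations `Q r` is chosen by `k` flips
`r` of a fair coin and then executed. -/
noncomputable def randomizedOutcomeProb {m k : ℕ} {α : Type*} (Q : (Fin k → Bool) → PBC m α)
    (a : α) : ℝ :=
  (1 / 2 : ℝ) ^ k * ∑ r, (Q r).outcomeProb a

end PauliBased

open PauliBased PauliBased.Encoded

open scoped Matrix

namespace PauliBased

open Encoded

/-! The circuit is rewritten in terms of Pauli operators on n + m qubits: n computational qubits in
|0⟩ and m magic ancillas. Up to global phases, H, S and CNOT are products of rotations exp(-iπR/4)
with Pauli operators R (`rot_H`, `rot_S`, `rot_CNOT`). A T gate consumes one ancilla: measuring Z⊗Y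
on the qubit and the ancilla with outcome s, then rotating about s Z⊗X, resets the ancilla to |0⟩
and applies exp(-iπsZ/8) to the qubit, with one more Z rotation as correction if s = -1
(`gadget_mulVec`, `rot_T`, `rot_T_neg`). Together with the final Z measurements this is an adaptive
program (`compile`) with the outcome distribution of the circuit (`expect_compile`).

The n computational qubits are then eliminated. Up to normalization the current state has the form
U(|0⟩⊗φ), where U is the product of a list of pending rotations and φ is the state of the m physical
qubits. A second list holds commuting Pauli operators, the rows, that stabilize |0⟩⊗φ; all Z_q on
the first n qubits are among them. A rotation only lengthens U. A measurement of M amounts to one of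
the Pauli operator M' = U†MU on |0⟩⊗φ. If M' anticommutes with a row g, the outcome s is a fair coin
and the projected state is proportional to |0⟩⊗φ rotated about s·iM'g (`rot_mulVec_of_anti`), so a
coin flip and a longer U replace the measurement. Otherwise M' is multiplied by rows until their
pivots are cleared. This does not change its action on the stabilized state, and because of the rows
Z_q the result is the identity on the first n qubits (`Config.Valid.reduce`). If only a sign
remains, the outcome is determined; otherwise the m physical qubits are measured and the operator,
signed by the outcome, becomes a new row. `expect_simMeas` proves this correct for one measurement
and `AProg.expect_sim` for programs.

The rows are in echelon form and commute, so they give independent vectors spanning an isotropic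
subspace over the field with two elements, and there are at most n + m of them
(`length_le_of_echelon`). As n are present at the start, at most m measurements reach the quantum
computer (`AProg.fits_sim`); up to sign the measured operators become rows, so they commute pairwise
(`AProg.path_sim_comm`). Branches that stop early are padded with identity measurements and ignored
coins (`DTree.sum_path`).

The classical algorithms never build the measurement tree; they follow the one branch selected by
the coins and eigenvalues (`AProg.run`, `simulate`). `Comp` expresses that a single program works in
polynomial time on a whole indexed family. It is closed under composition, case distinction and
folds, the rounds of a fold being again such a family, and the growth of the simulated data is
controlled by `RunState.weight`. -/

/-! ## Polynomially bounded families and polynomial-time computations -/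

/-- The family `s` is bounded by a polynomial in the parameter `N`. -/
def PolyBdd {ι : Type*} (N s : ι → ℕ) : Prop :=
  ∃ q : Polynomial ℕ, ∀ i, s i ≤ q.eval (N i)

namespace PolyBdd

variable {ι : Type*} {N s t : ι → ℕ}

theorem mono (h : PolyBdd N t) (hs : ∀ i, s i ≤ t i) : PolyBdd N s :=
  let ⟨q, hq⟩ := h
  ⟨q, fun i => (hs i).trans (hq i)⟩

theorem const (c : ℕ) : PolyBdd N (fun _ => c) := ⟨Polynomial.C c, fun i => by simp⟩

theorem param : PolyBdd N N := ⟨Polynomial.X, fun i => by simp⟩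

theorem add (hs : PolyBdd N s) (ht : PolyBdd N t) : PolyBdd N (fun i => s i + t i) := by
  obtain ⟨p, hp⟩ := hs
  obtain ⟨q, hq⟩ := ht
  exact ⟨p + q, fun i => by simpa using Nat.add_le_add (hp i) (hq i)⟩

theorem mul (hs : PolyBdd N s) (ht : PolyBdd N t) : PolyBdd N (fun i => s i * t i) := by
  obtain ⟨p, hp⟩ := hs
  obtain ⟨q, hq⟩ := ht
  exact ⟨p * q, fun i => by simpa using Nat.mul_le_mul (hp i) (hq i)⟩

theorem comap {κ : Type*} (h : PolyBdd N s) (f : κ → ι) :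
    PolyBdd (fun k => N (f k)) (fun k => s (f k)) :=
  let ⟨q, hq⟩ := h
  ⟨q, fun k => hq (f k)⟩

end PolyBdd

/-! ### Polynomial-time maps between indexed families of trees -/

theorem Data.one_le_size (x : Data) : 1 ≤ x.size := by
  cases x <;> simp [Data.size]

theorem Data.size_fst_le (x : Data) : x.fst.size ≤ x.size := by
  cases x <;> simp [Data.size, Data.fst]; omega

theorem Data.size_snd_le (x : Data) : x.snd.size ≤ x.size := by
  cases x <;> simp [Data.size, Data.snd]; omega

/-- Every construct is charged for the tree it reads, so a time bound bounds both sizes as well. A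
polynomial time bound for one step thus supplies the size bound on the input of the next. -/
theorem Eval.size_le {p : Prog} {x y : Data} {t : ℕ} (h : Eval p x y t) :
    x.size ≤ t ∧ y.size ≤ t := by
  induction h with
  | id x => omega
  | nil x => have := x.one_le_size; simp only [Data.size]; omega
  | fst x => have := x.size_fst_le; omega
  | snd x => have := x.size_snd_le; omega
  | pair => simp only [Data.size]; omega
  | seq => omega
  | ite_true => omega
  | ite_false => omega
  | loop_stop => omega
  | loop_step => omega

/-- One program maps every `a i` to `b i` in time polynomial in `N i`. -/
def Comp {ι : Type*} (N : ι → ℕ) (a b : ι → Data) : Prop :=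
  ∃ p : Prog, ∃ T : ι → ℕ, PolyBdd N T ∧ ∀ i, p.RunsIn (a i) (b i) (T i)

/-- The tree `x` if `c` is not `nil`, and `y` otherwise. -/
def Data.cond (c x y : Data) : Data :=
  match c with
  | .nil => y
  | .cons _ _ => x

/-- A round costs at most `T` for the test, `T` for the body, and one unit plus the size of the
current tree. That size is at most `T` too, because the test reads the tree; hence `3 * T + 1`. -/
theorem eval_loop {c p : Prog} {T : ℕ} (K : ℕ) (x : ℕ → Data)
    (hc : ∀ k < K, ∃ u v, ∃ t ≤ T, Eval c (x k) (.cons u v) t)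
    (hhalt : ∃ t ≤ T, Eval c (x K) .nil t)
    (hp : ∀ k < K, ∃ t ≤ T, Eval p (x k) (x (k + 1)) t) :
    ∃ t ≤ (K + 1) * (3 * T + 1), Eval (.loop c p) (x 0) (x K) t := by
  induction K generalizing x with
  | zero =>
    obtain ⟨t, ht, h⟩ := hhalt
    have hl : Eval (.loop c p) (x 0) (x 0) (t + (1 + (x 0).size)) := by
      constructor
      exact h
    exact ⟨_, by have := h.size_le; omega, hl⟩
  | succ K ih =>
    obtain ⟨u, v, t, ht, h⟩ := hc 0 (by omega)
    obtain ⟨t', ht', h'⟩ := hp 0 (by omega)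
    obtain ⟨t'', ht'', h''⟩ := ih (fun k => x (k + 1)) (fun k hk => hc (k + 1) (by omega)) hhalt
      (fun k hk => hp (k + 1) (by omega))
    refine ⟨_, ?_, .loop_step h h' h''⟩
    have := h.size_le
    have e : (K + 1 + 1) * (3 * T + 1) = (K + 1) * (3 * T + 1) + (3 * T + 1) := by ring
    omega

namespace Comp

variable {ι : Type*} {N : ι → ℕ} {a b c d : ι → Data}

theorem size_left (h : Comp N a b) : PolyBdd N (fun i => (a i).size) := by
  obtain ⟨p, T, hT, h⟩ := h
  refine hT.mono fun i => ?_
  obtain ⟨t, ht, h⟩ := h i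
  exact h.size_le.1.trans ht

theorem size_right (h : Comp N a b) : PolyBdd N (fun i => (b i).size) := by
  obtain ⟨p, T, hT, h⟩ := h
  refine hT.mono fun i => ?_
  obtain ⟨t, ht, h⟩ := h i
  exact h.size_le.2.trans ht

theorem refl (h : PolyBdd N (fun i => (a i).size)) : Comp N a a :=
  ⟨.id, _, (PolyBdd.const 1).add h, fun _ => ⟨_, le_rfl, .id _⟩⟩

theorem trans (h : Comp N a b) (h' : Comp N b c) : Comp N a c := by
  have hs := h.size_left
  obtain ⟨p, T, hT, h⟩ := h
  obtain ⟨p', T', hT', h'⟩ := h'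
  refine ⟨.seq p p', _, (hT.add hT').add ((PolyBdd.const 1).add hs), fun i => ?_⟩
  obtain ⟨t, ht, h⟩ := h i
  obtain ⟨t', ht', h'⟩ := h' i
  exact ⟨_, by omega, .seq h h'⟩

theorem cons (h : Comp N a b) (h' : Comp N a c) : Comp N a (fun i => .cons (b i) (c i)) := by
  have hs := h.size_left
  obtain ⟨p, T, hT, h⟩ := h
  obtain ⟨p', T', hT', h'⟩ := h'
  refine ⟨.pair p p', _, (hT.add hT').add ((PolyBdd.const 1).add hs), fun i => ?_⟩
  obtain ⟨t, ht, h⟩ := h i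
  obtain ⟨t', ht', h'⟩ := h' i
  exact ⟨_, by omega, .pair h h'⟩

theorem fst (h : Comp N a b) : Comp N a (fun i => (b i).fst) :=
  h.trans ⟨.fst, _, (PolyBdd.const 1).add h.size_right, fun _ => ⟨_, le_rfl, .fst _⟩⟩

theorem snd (h : Comp N a b) : Comp N a (fun i => (b i).snd) :=
  h.trans ⟨.snd, _, (PolyBdd.const 1).add h.size_right, fun _ => ⟨_, le_rfl, .snd _⟩⟩

theorem nil (h : PolyBdd N (fun i => (a i).size)) : Comp N a (fun _ => .nil) :=
  ⟨.nil, _, (PolyBdd.const 1).add h, fun _ => ⟨_, le_rfl, .nil _⟩⟩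

theorem const (h : PolyBdd N (fun i => (a i).size)) (x : Data) : Comp N a (fun _ => x) := by
  induction x with
  | nil => exact nil h
  | cons x y hx hy => exact hx.cons hy

theorem cond (hb : Comp N a b) (hc : Comp N a c) (hd : Comp N a d) :
    Comp N a (fun i => (b i).cond (c i) (d i)) := by
  have hs := hb.size_left
  obtain ⟨p, T, hT, h⟩ := hb
  obtain ⟨p', T', hT', h'⟩ := hc
  obtain ⟨p'', T'', hT'', h''⟩ := hd
  refine ⟨.ite p p' p'', _, ((hT.add hT').add hT'').add ((PolyBdd.const 1).add hs), fun i => ?_⟩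
  obtain ⟨t, ht, h⟩ := h i
  obtain ⟨t', ht', h'⟩ := h' i
  obtain ⟨t'', ht'', h''⟩ := h'' i
  change ∃ _ ≤ _, Eval _ _ (Data.cond (b i) (c i) (d i)) _
  cases hbi : b i with
  | nil => exact ⟨t + t'' + (1 + (a i).size), by omega, .ite_false (hbi ▸ h) h''⟩
  | cons u v => exact ⟨t + t' + (1 + (a i).size), by omega, .ite_true (hbi ▸ h) h'⟩

/-- The program is chosen before the index, so reindexing keeps it. Taking the pairs of an input and
a round number as indices makes a bound uniform over all rounds of a loop. -/
theorem comap {κ : Type*} (h : Comp N a b) (f : κ → ι) :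
    Comp (fun k => N (f k)) (fun k => a (f k)) (fun k => b (f k)) :=
  let ⟨p, _, hT, h⟩ := h
  ⟨p, _, hT.comap f, fun k => h (f k)⟩

/-- A loop along the spine `L i` of length `K i`, updating the state `s i`. -/
theorem loop {K : ι → ℕ} {L s : ι → ℕ → Data}
    (hL : ∀ i, ∀ k < K i, ∃ u, L i k = .cons u (L i (k + 1))) (hLK : ∀ i, L i (K i) = .nil)
    (hL0 : Comp N a (fun i => L i 0)) (hs0 : Comp N a (fun i => s i 0))
    (hstep : Comp (fun p : {p : ι × ℕ // p.2 < K p.1} => N p.1.1)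
      (fun p => .cons (a p.1.1) (.cons (L p.1.1 p.1.2) (s p.1.1 p.1.2)))
      (fun p => s p.1.1 (p.1.2 + 1))) :
    Comp N a (fun i => s i (K i)) := by
  let x : ι → ℕ → Data := fun i k => .cons (a i) (.cons (L i k) (s i k))
  have hid := refl hstep.size_left
  have hbody : Comp (fun p : {p : ι × ℕ // p.2 < K p.1} => N p.1.1) (fun p => x p.1.1 p.1.2)
      (fun p => x p.1.1 (p.1.2 + 1)) := by
    refine (hid.fst).cons (Comp.cons ?_ hstep)
    have := hid.snd.fst.snd
    refine cast ?_ this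
    congr 1
    funext p
    obtain ⟨u, hu⟩ := hL p.1.1 p.1.2 p.2
    simp [Data.fst, Data.snd, hu]
  have hinit : Comp N a (fun i => x i 0) := (refl hs0.size_left).cons (hL0.cons hs0)
  -- Each round removes one cell of the spine, so the number of rounds is at most the size of the
  -- initial spine, which is polynomial.
  have hKB : ∀ i k, k ≤ K i → K i - k ≤ (L i k).size := by
    intro i k hk
    induction h : K i - k generalizing k with
    | zero => omega
    | succ j ih =>
      obtain ⟨u, hu⟩ := hL i k (by omega)
      have := ih (k + 1) (by omega) (by omega)
      rw [hu, Data.size]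
      omega
  suffices Comp N (fun i => x i 0) (fun i => x i (K i)) from
    (hinit.trans this).snd.snd
  obtain ⟨p, T, ⟨q, hq⟩, hp⟩ := hbody
  obtain ⟨q0, hq0⟩ := hinit.size_right
  obtain ⟨qL, hqL⟩ := hL0.size_right
  let B : ι → ℕ := fun i => 3 + 3 * (q.eval (N i) + q0.eval (N i))
  have hB : PolyBdd N B := (PolyBdd.const 3).add ((PolyBdd.const 3).mul
    (PolyBdd.add ⟨q, fun i => le_rfl⟩ ⟨q0, fun i => le_rfl⟩))
  have hKP : PolyBdd N K := ⟨qL, fun i => (hKB i 0 (Nat.zero_le _)).trans (hqL i)⟩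
  have hp' : ∀ i k, k < K i → ∃ t ≤ q.eval (N i), Eval p (x i k) (x i (k + 1)) t := by
    intro i k hk
    obtain ⟨t, ht, h⟩ := hp ⟨(i, k), hk⟩
    exact ⟨t, ht.trans (hq ⟨(i, k), hk⟩), h⟩
  -- The loop states need no separate size hypothesis: the initial one is the output of `hinit`, and
  -- each later one is the output of a round, whose time has a bound common to all rounds.
  have hsz : ∀ i k, k ≤ K i → (x i k).size ≤ q.eval (N i) + q0.eval (N i) := by
    intro i k hk
    cases k with
    | zero => exact (hq0 i).trans (Nat.le_add_left _ _)
    | succ k =>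
      obtain ⟨t, ht, h⟩ := hp' i k (by omega)
      have := h.size_le
      omega
  have hcond : ∀ i k, k ≤ K i → ∃ t ≤ B i, Eval (.seq .snd .fst) (x i k) (L i k) t := by
    intro i k hk
    refine ⟨_, ?_, Eval.seq (.snd _) (.fst _)⟩
    have h1 := hsz i k hk
    have h2 := (x i k).size_snd_le
    simp only [B]
    omega
  refine ⟨.loop (.seq .snd .fst) p, _, (hKP.add (.const 1)).mul
    (((PolyBdd.const 3).mul hB).add (.const 1)), fun i => ?_⟩
  refine eval_loop (K i) (x i) (fun k hk => ?_) ?_ (fun k hk => ?_)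
  · obtain ⟨u, hu⟩ := hL i k hk
    exact ⟨u, _, hu ▸ hcond i k hk.le⟩
  · exact hLK i ▸ hcond i (K i) le_rfl
  · obtain ⟨t, ht, h⟩ := hp' i k hk
    exact ⟨t, by simp only [B]; omega, h⟩

end Comp

/-! ### Computations with lists, finite types and unary numbers -/

theorem size_natCode (k : ℕ) : (natCode k).size = 2 * k + 1 := by
  induction k with
  | zero => rfl
  | succ k ih => simp only [natCode, Data.size, ih]; ring

section Lists

variable {γ : Type*} [Encoded γ]

theorem size_listCode_le {l : List γ} {B : ℕ} (h : ∀ g ∈ l, (enc g).size ≤ B) :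
    (listCode l).size ≤ l.length * (B + 1) + 1 := by
  induction l with
  | nil => simp [listCode, Data.size]
  | cons g l ih =>
    have h1 := h g (by simp)
    have h2 := ih fun g hg => h g (by simp [hg])
    simp only [listCode, Data.size, List.length_cons]
    have : (l.length + 1) * (B + 1) = l.length * (B + 1) + (B + 1) := by ring
    omega

theorem length_le_size_listCode (l : List γ) : l.length ≤ (listCode l).size := by
  induction l with
  | nil => simp
  | cons g l ih => simp only [listCode, Data.size, List.length_cons]; omega

theorem size_enc_le_of_mem {l : List γ} {g : γ} (h : g ∈ l) :
    (enc g).size ≤ (listCode l).size := by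
  induction l with
  | nil => simp at h
  | cons g' l ih =>
    simp only [listCode, Data.size]
    rcases List.mem_cons.1 h with rfl | h
    · omega
    · have := ih h; omega

end Lists

theorem PolyBdd.listCode {ι : Type*} {N : ι → ℕ} {γ : ι → Type*} [∀ i, Encoded (γ i)]
    {l : ∀ i, List (γ i)} {K B : ι → ℕ} (hK : PolyBdd N K) (hB : PolyBdd N B)
    (hl : ∀ i, (l i).length ≤ K i) (hg : ∀ i, ∀ g ∈ l i, (enc g).size ≤ B i) :
    PolyBdd N (fun i => (PauliBased.listCode (l i)).size) :=
  ((hK.mul (hB.add (.const 1))).add (.const 1)).mono fun i =>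
    (size_listCode_le (hg i)).trans (by gcongr; exact hl i)

namespace Comp

variable {ι : Type*} {N : ι → ℕ} {a b c d : ι → Data}

theorem of_eq (h : Comp N a b) (e : ∀ i, b i = c i) : Comp N a c := (funext e : b = c) ▸ h

/-- A computation that uses only the first component of its input. -/
theorem lift {κ : Type*} {e : κ → Data} (h : Comp N a b) (f : κ → ι)
    (he : PolyBdd (fun k => N (f k)) (fun k => (e k).size)) :
    Comp (fun k => N (f k)) (fun k => .cons (a (f k)) (e k)) (fun k => b (f k)) := by
  refine Comp.trans (b := fun k => a (f k)) ?_ (h.comap f)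
  exact (refl (a := fun k => Data.cons (a (f k)) (e k))
    (((h.size_left.comap f).add he).add (.const 1))).fst

-- Induction on the fixed tree `d` unfolds the comparison into nested tests of subtrees for `nil`;
-- the resulting program depends on `d` but not on the input.
open Classical in
theorem caseConst (d : Data) (hb : Comp N a b) {c c' : ι → Data} (hc : Comp N a c)
    (hc' : Comp N a c') : Comp N a (fun i => if b i = d then c i else c' i) := by
  induction d generalizing b c c' with
  | nil => exact (hb.cond hc' hc).of_eq fun i => by cases b i <;> simp [Data.cond]
  | cons d₁ d₂ h₁ h₂ =>
    refine (hb.cond (h₁ hb.fst (h₂ hb.snd hc hc') hc') hc').of_eq fun i => ?_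
    cases b i with
    | nil => simp [Data.cond]
    | cons u v => by_cases hu : u = d₁ <;> by_cases hv : v = d₂ <;>
        simp [Data.cond, Data.fst, Data.snd, hu, hv]

/-- The code is compared in turn with those of the finitely many elements of `F`. The type does not
depend on the index, so this table is part of one fixed program. -/
theorem finCases {F : Type*} [Encoded F] [Finite F] {x : ι → F} {g : F → ι → Data}
    (hx : Comp N a (fun i => enc (x i))) (hg : ∀ v, Comp N a (g v)) :
    Comp N a (fun i => g (x i) i) := by
  classical
  have := Fintype.ofFinite F
  have key : ∀ l : List F, Comp N a (fun i => if x i ∈ l then g (x i) i else .nil) := by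
    intro l
    induction l with
    | nil => simpa using nil hx.size_left
    | cons v l ih =>
      refine (caseConst (enc v) hx (hg v) ih).of_eq fun i => ?_
      by_cases h : x i = v
      · simp [h]
      · simp [h, enc_injective.eq_iff]
  simpa using key Finset.univ.toList

/-- Every function on a finite type can be computed. -/
theorem ofFinite {F G : Type*} [Encoded F] [Finite F] [Encoded G] {x : ι → F} (h : F → G)
    (hx : Comp N a (fun i => enc (x i))) : Comp N a (fun i => enc (h (x i))) :=
  finCases (g := fun v _ => enc (h v)) hx fun _ => const hx.size_left _

theorem prodMk {β γ : ι → Type*} [∀ i, Encoded (β i)] [∀ i, Encoded (γ i)] {x : ∀ i, β i}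
    {y : ∀ i, γ i} (hx : Comp N a (fun i => enc (x i))) (hy : Comp N a (fun i => enc (y i))) :
    Comp N a (fun i => enc (x i, y i)) := hx.cons hy

theorem prodFst {β γ : ι → Type*} [∀ i, Encoded (β i)] [∀ i, Encoded (γ i)] {x : ∀ i, β i × γ i}
    (hx : Comp N a (fun i => enc (x i))) : Comp N a (fun i => enc (x i).1) := hx.fst

theorem prodSnd {β γ : ι → Type*} [∀ i, Encoded (β i)] [∀ i, Encoded (γ i)] {x : ∀ i, β i × γ i}
    (hx : Comp N a (fun i => enc (x i))) : Comp N a (fun i => enc (x i).2) := hx.snd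

theorem ofFinite₂ {F F' G : Type*} [Encoded F] [Finite F] [Encoded F'] [Finite F'] [Encoded G]
    {x : ι → F} {y : ι → F'} (h : F → F' → G)
    (hx : Comp N a (fun i => enc (x i))) (hy : Comp N a (fun i => enc (y i))) :
    Comp N a (fun i => enc (h (x i) (y i))) :=
  ofFinite (x := fun i => (x i, y i)) (fun z => h z.1 z.2) (hx.prodMk hy)

theorem ite {P : ι → Prop} [DecidablePred P] (hP : Comp N a (fun i => enc (decide (P i))))
    (hc : Comp N a c) (hd : Comp N a d) : Comp N a (fun i => if P i then c i else d i) :=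
  (finCases (g := fun v i => if v then c i else d i) hP
    (by rintro (_ | _) <;> simpa)).of_eq fun i => by simp

theorem iteEnc {β : ι → Type*} [∀ i, Encoded (β i)] {x y : ∀ i, β i} {P : ι → Prop}
    [DecidablePred P] (hP : Comp N a (fun i => enc (decide (P i))))
    (hc : Comp N a (fun i => enc (x i))) (hd : Comp N a (fun i => enc (y i))) :
    Comp N a (fun i => enc (if P i then x i else y i)) :=
  (ite hP hc hd).of_eq fun i => by split_ifs <;> rfl

section Fold

variable {γ β : ι → Type*} [∀ i, Encoded (γ i)] [∀ i, Encoded (β i)] {l : ∀ i, List (γ i)}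
  {x : ∀ i, β i} {f : ∀ i, γ i → β i → β i}

/-- `Inv` cuts the index set of `hstep` down to reachable states. Without it a step on an
accumulator that grows would have to handle states of arbitrary size in time polynomial in `N`. -/
theorem listFoldl (Inv : ∀ i, ℕ → β i → Prop) (h0 : ∀ i, Inv i 0 (x i))
    (hs : ∀ i k g s, k < (l i).length → g ∈ l i → Inv i k s → Inv i (k + 1) (f i g s))
    (hl : Comp N a (fun i => enc (l i))) (hx : Comp N a (fun i => enc (x i)))
    (hstep : Comp (fun p : {p : Σ i, ℕ × γ i × β i //
        p.2.1 < (l p.1).length ∧ p.2.2.1 ∈ l p.1 ∧ Inv p.1 p.2.1 p.2.2.2} => N p.1.1)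
      (fun p => .cons (a p.1.1) (.cons (enc p.1.2.2.1) (enc p.1.2.2.2)))
      (fun p => enc (f p.1.1 p.1.2.2.1 p.1.2.2.2))) :
    Comp N a (fun i => enc ((l i).foldl (fun s g => f i g s) (x i))) := by
  let st : ∀ i, ℕ → β i := fun i k => ((l i).take k).foldl (fun s g => f i g s) (x i)
  have hst : ∀ i k (hk : k < (l i).length), st i (k + 1) = f i (l i)[k] (st i k) := by
    intro i k hk
    simp only [st, List.take_succ_eq_append_getElem hk, List.foldl_append, List.foldl_cons,
      List.foldl_nil]
  have hinv : ∀ i k, k ≤ (l i).length → Inv i k (st i k) := by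
    intro i k
    induction k with
    | zero => intro _; simpa [st] using h0 i
    | succ k ih =>
      intro hk
      rw [hst i k hk]
      exact hs i k _ _ hk (List.getElem_mem _) (ih (by omega))
  have hcode : ∀ i k (hk : k < (l i).length),
      listCode ((l i).drop k) = .cons (enc (l i)[k]) (listCode ((l i).drop (k + 1))) := by
    intro i k hk
    rw [List.drop_eq_getElem_cons hk]
    rfl
  have h := loop (N := N) (a := a) (K := fun i => (l i).length)
    (L := fun i k => listCode ((l i).drop k)) (s := fun i k => enc (st i k))
    (fun i k hk => ⟨_, hcode i k hk⟩) (fun i => by simp [listCode])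
    (hl.of_eq fun i => rfl) (hx.of_eq fun i => rfl) ?_
  · exact h.of_eq fun i => by simp [st]
  · have h' := hstep.comap (fun p : {p : ι × ℕ // p.2 < (l p.1).length} =>
      ⟨⟨p.1.1, p.1.2, (l p.1.1)[p.1.2]'p.2, st p.1.1 p.1.2⟩, p.2, List.getElem_mem _,
        hinv _ _ p.2.le⟩)
    have hsz := h'.size_left
    have hL : PolyBdd (fun p : {p : ι × ℕ // p.2 < (l p.1).length} => N p.1.1)
        (fun p => (listCode ((l p.1.1).drop p.1.2)).size) := by
      have hl' := hl.size_right
      refine ((hl'.mul (hl'.add (.const 1))).add (.const 1)).comap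
        (fun p : {p : ι × ℕ // p.2 < (l p.1).length} => p.1.1) |>.mono fun p => ?_
      refine (size_listCode_le (B := (listCode (l p.1.1)).size) fun g hg =>
        size_enc_le_of_mem (List.mem_of_mem_drop hg)).trans ?_
      change _ ≤ (listCode _).size * ((listCode _).size + 1) + 1
      gcongr
      exact (by simp : _ ≤ (l p.1.1).length).trans (length_le_size_listCode _)
    refine Comp.trans (refl ?_) (Comp.trans ?_ (h'.of_eq fun p => ?_))
    · refine ((hsz.add hL).add (.const 2)).mono fun p => ?_
      simp only [Data.size]
      omega
    · have hr : Comp (fun p : {p : ι × ℕ // p.2 < (l p.1).length} => N p.1.1)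
        (fun p => .cons (a p.1.1) (.cons (listCode ((l p.1.1).drop p.1.2))
          (enc (st p.1.1 p.1.2)))) _ := refl
            (((hsz.add hL).add (.const 2)).mono fun p => by simp only [Data.size]; omega)
      refine (hr.fst.cons (hr.snd.fst.fst.cons hr.snd.snd)).of_eq fun p => ?_
      simp [Data.fst, Data.snd, hcode _ _ p.2]
    · rw [hst _ _ p.2]

theorem reverse (hl : Comp N a (fun i => enc (l i))) :
    Comp N a (fun i => enc (l i).reverse) := by
  have h := listFoldl (N := N) (a := a) (l := l) (β := fun i => List (γ i)) (x := fun _ => [])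
    (f := fun _ g s => g :: s) (fun i k s => s.length = k ∧ ∀ g ∈ s, g ∈ l i)
    (fun i => by simp) (fun i k g s _ hg hs => by simpa [hs.1, hg] using hs.2) hl
    (nil hl.size_left) ?_
  · exact h.of_eq fun i => by simp
  · refine (refl ?_).snd
    have hl' := hl.size_right
    refine (((hl.size_left.add hl').add ((hl'.mul (hl'.add (.const 1))).add
      (.const 1))).add (.const 2)).comap Sigma.fst |>.comap Subtype.val |>.mono fun p => ?_
    obtain ⟨⟨i, k, g, s⟩, hk, hg, hks, hs⟩ := p
    dsimp only at hk hg hks hs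
    have h1 : (enc g).size ≤ (enc (l i)).size := size_enc_le_of_mem hg
    have h2 : (enc s).size ≤ s.length * ((enc (l i)).size + 1) + 1 :=
      size_listCode_le fun g hg => size_enc_le_of_mem (hs g hg)
    have h3 : s.length * ((enc (l i)).size + 1) ≤ (enc (l i)).size * ((enc (l i)).size + 1) := by
      gcongr
      exact (hks.trans_le hk.le).trans (length_le_size_listCode _)
    simp only [Data.size] at *
    omega

theorem listFoldr (Inv : ∀ i, ℕ → β i → Prop) (h0 : ∀ i, Inv i 0 (x i))
    (hs : ∀ i k g s, k < (l i).length → g ∈ l i → Inv i k s → Inv i (k + 1) (f i g s))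
    (hl : Comp N a (fun i => enc (l i))) (hx : Comp N a (fun i => enc (x i)))
    (hstep : Comp (fun p : {p : Σ i, ℕ × γ i × β i //
        p.2.1 < (l p.1).length ∧ p.2.2.1 ∈ l p.1 ∧ Inv p.1 p.2.1 p.2.2.2} => N p.1.1)
      (fun p => .cons (a p.1.1) (.cons (enc p.1.2.2.1) (enc p.1.2.2.2)))
      (fun p => enc (f p.1.1 p.1.2.2.1 p.1.2.2.2))) :
    Comp N a (fun i => enc ((l i).foldr (f i) (x i))) :=
  (listFoldl (f := f) Inv h0 (fun i k g s hk hg => hs i k g s (by simpa using hk) (by simpa using hg))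
    hl.reverse hx (hstep.comap (fun p : {p : Σ i, ℕ × γ i × β i //
        p.2.1 < (l p.1).reverse.length ∧ p.2.2.1 ∈ (l p.1).reverse ∧ Inv p.1 p.2.1 p.2.2.2} =>
      ⟨p.1, by simpa using p.2⟩))).of_eq fun i => by simp

theorem listFoldl' (hl : Comp N a (fun i => enc (l i))) (hx : Comp N a (fun i => enc (x i)))
    (hstep : Comp (fun p : Σ i, γ i × β i => N p.1)
      (fun p => .cons (a p.1) (.cons (enc p.2.1) (enc p.2.2)))
      (fun p => enc (f p.1 p.2.1 p.2.2))) :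
    Comp N a (fun i => enc ((l i).foldl (fun s g => f i g s) (x i))) :=
  listFoldl (fun _ _ _ => True) (fun _ => trivial) (fun _ _ _ _ _ _ _ => trivial) hl hx
    (hstep.comap fun p : {p : Σ i, ℕ × γ i × β i //
      p.2.1 < (l p.1).length ∧ p.2.2.1 ∈ l p.1 ∧ True} => ⟨p.1.1, p.1.2.2⟩)

theorem listFoldr' (hl : Comp N a (fun i => enc (l i))) (hx : Comp N a (fun i => enc (x i)))
    (hstep : Comp (fun p : Σ i, γ i × β i => N p.1)
      (fun p => .cons (a p.1) (.cons (enc p.2.1) (enc p.2.2)))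
      (fun p => enc (f p.1 p.2.1 p.2.2))) :
    Comp N a (fun i => enc ((l i).foldr (f i) (x i))) :=
  listFoldr (fun _ _ _ => True) (fun _ => trivial) (fun _ _ _ _ _ _ _ => trivial) hl hx
    (hstep.comap fun p : {p : Σ i, ℕ × γ i × β i //
      p.2.1 < (l p.1).length ∧ p.2.2.1 ∈ l p.1 ∧ True} => ⟨p.1.1, p.1.2.2⟩)

/-- The accumulator is polynomially small since its length is the number of rounds done and each
entry is a value of `h`, whose code is bounded by the output size of `hstep`. -/
theorem listMap {h : ∀ i, γ i → β i} (hl : Comp N a (fun i => enc (l i)))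
    (hstep : Comp (fun p : Σ i, γ i => N p.1) (fun p => .cons (a p.1) (enc p.2))
      (fun p => enc (h p.1 p.2))) :
    Comp N a (fun i => enc ((l i).map (h i))) := by
  obtain ⟨q, hq⟩ := hstep.size_right
  have hB : PolyBdd N (fun i => q.eval (N i)) := ⟨q, fun _ => le_rfl⟩
  have hK : PolyBdd N (fun i => (l i).length) :=
    hl.size_right.mono fun i => length_le_size_listCode _
  have h := listFoldr (N := N) (a := a) (l := l) (β := fun i => List (β i)) (x := fun _ => [])
    (f := fun i g s => h i g :: s)
    (fun i k s => s.length = k ∧ ∀ b ∈ s, ∃ g, b = h i g)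
    (fun i => by simp) (fun i k g s _ hg hs => by simpa [hs.1] using hs.2)
    hl (nil hl.size_left) ?_
  · exact h.of_eq fun i => by simp [List.foldr_cons_eq_append]
  · let S := {p : Σ i, ℕ × γ i × List (β i) // p.2.1 < (l p.1).length ∧ p.2.2.1 ∈ l p.1 ∧
      p.2.2.2.length = p.2.1 ∧ ∀ b ∈ p.2.2.2, ∃ g, b = h p.1 g}
    have h1 := hstep.comap (fun p : S => (⟨p.1.1, p.1.2.2.1⟩ : Σ i, γ i))
    have h2 : PolyBdd (fun p : S => N p.1.1) (fun p => (enc p.1.2.2.2).size) := by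
      refine PolyBdd.listCode (ι := S) (γ := fun p => β p.1.1) (l := fun p => p.1.2.2.2)
        (hK.comap fun p : S => p.1.1) (hB.comap fun p : S => p.1.1)
        (fun p => ?_) (fun p g hg => ?_)
      · exact p.2.2.2.1.trans_le p.2.1.le
      · obtain ⟨g', rfl⟩ := p.2.2.2.2 g hg
        exact hq ⟨_, g'⟩
    have h3 := refl (ι := S) (N := fun p => N p.1.1)
      (a := fun p => .cons (a p.1.1) (.cons (enc p.1.2.2.1) (enc p.1.2.2.2)))
      (((h1.size_left.add h2).add (.const 1)).mono fun p => by
        simp only [Data.size]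
        omega)
    exact ((h3.fst.cons h3.snd.fst).trans h1).cons h3.snd.snd

theorem length (hl : Comp N a (fun i => enc (l i))) :
    Comp N a (fun i => natCode (l i).length) := by
  have hK : PolyBdd N (fun i => (l i).length) :=
    hl.size_right.mono fun i => length_le_size_listCode _
  have h := listFoldr (N := N) (a := a) (l := l) (β := fun _ => ℕ) (x := fun _ => 0)
    (f := fun _ _ s => s + 1) (fun i k s => s = k) (fun i => rfl) (fun i k g s _ _ hs => by rw [hs])
    hl (nil hl.size_left) ?_
  · refine h.of_eq fun i => ?_
    have : ∀ l : List (γ i), l.foldr (fun _ s => s + 1) 0 = l.length := by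
      intro l; induction l <;> simp_all
    rw [this]
    rfl
  · have h3 := refl (((((hl.size_left.add hl.size_right).add
      (((PolyBdd.const 2).mul hK).add (.const 1))).add (.const 2)).comap Sigma.fst).comap
      (Subtype.val : {p : Σ i, ℕ × γ i × ℕ // p.2.1 < (l p.1).length ∧ p.2.2.1 ∈ l p.1 ∧
          p.2.2.2 = p.2.1} → _) |>.mono fun p => by
      have h1 : (enc p.1.2.2.1).size ≤ (enc (l p.1.1)).size := size_enc_le_of_mem p.2.2.1
      have h2 := p.2.1
      have h4 := p.2.2.2
      change (Data.cons (a p.1.1) (.cons (enc p.1.2.2.1) (natCode p.1.2.2.2))).size ≤ _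
      simp only [Data.size, size_natCode]
      omega)
    exact (const h3.size_left .nil).cons h3.snd.snd

theorem append {l' : ∀ i, List (γ i)} (hl : Comp N a (fun i => enc (l i)))
    (hl' : Comp N a (fun i => enc (l' i))) :
    Comp N a (fun i => enc (l i ++ l' i)) := by
  have h := listFoldr (N := N) (a := a) (l := l) (β := fun i => List (γ i)) (x := l')
    (f := fun i g s => g :: s)
    (fun i k s => s.length = k + (l' i).length ∧ ∀ g ∈ s, g ∈ l i ∨ g ∈ l' i)
    (fun i => by simp +contextual) (fun i k g s _ hg hs => by
      refine ⟨by simp [hs.1]; omega, ?_⟩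
      simpa [hg] using hs.2)
    hl hl' ?_
  · exact h.of_eq fun i => by simp
  · refine (refl ?_).snd
    have hB := hl.size_right.add hl'.size_right
    refine (((hl.size_left.add hl.size_right).add ((hB.mul (hB.add (.const 1))).add
      (.const 1))).add (.const 2)).comap Sigma.fst |>.comap Subtype.val |>.mono fun p => ?_
    obtain ⟨⟨i, k, g, s⟩, hk, hg, hs, hs'⟩ := p
    have h1 : (enc g).size ≤ (enc (l i)).size := size_enc_le_of_mem hg
    have h2 : (enc s).size ≤ s.length * ((enc (l i)).size + (enc (l' i)).size + 1) + 1 :=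
      size_listCode_le fun g hg => by
        rcases hs' g hg with h | h
        · exact (size_enc_le_of_mem h).trans (Nat.le_add_right _ _)
        · exact (size_enc_le_of_mem h).trans (Nat.le_add_left _ _)
    have h3 : s.length * ((enc (l i)).size + (enc (l' i)).size + 1) ≤
        ((enc (l i)).size + (enc (l' i)).size) * ((enc (l i)).size + (enc (l' i)).size + 1) := by
      have e1 : (l i).length ≤ (enc (l i)).size := length_le_size_listCode _
      have e2 : (l' i).length ≤ (enc (l' i)).size := length_le_size_listCode _
      gcongr
      dsimp only at hs hk
      omega
    simp only [Data.size] at *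
    omega

end Fold

/-! ### Natural numbers -/

/-- The unary code of `k` is itself the spine that counts the rounds; each round passes to the tail.
-/
theorem listDrop {γ : ι → Type*} [∀ i, Encoded (γ i)] {l : ∀ i, List (γ i)} {k : ι → ℕ}
    (hl : Comp N a (fun i => enc (l i))) (hk : Comp N a (fun i => natCode (k i))) :
    Comp N a (fun i => enc ((l i).drop (k i))) := by
  refine loop (K := k) (L := fun i j => natCode (k i - j)) (s := fun i j => enc ((l i).drop j))
    (fun i j hj => ⟨.nil, ?_⟩) (fun i => by simp [natCode]) (hk.of_eq fun i => by simp)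
    (hl.of_eq fun i => by simp) ?_
  · obtain ⟨d, hd⟩ : ∃ d, k i - j = d + 1 := ⟨k i - j - 1, by omega⟩
    rw [hd, show k i - (j + 1) = d by omega]
    rfl
  · have hl' := hl.size_right
    have hr := refl (N := fun p : {p : ι × ℕ // p.2 < k p.1} => N p.1.1)
      (a := fun p => .cons (a p.1.1) (.cons (natCode (k p.1.1 - p.1.2))
        (enc ((l p.1.1).drop p.1.2)))) ?_
    · refine hr.snd.snd.snd.of_eq fun p => ?_
      rw [← List.tail_drop]
      change (enc ((l p.1.1).drop p.1.2)).snd = _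
      cases (l p.1.1).drop p.1.2 <;> rfl
    · refine (((hl.size_left.add hk.size_right).add ((hl'.mul (hl'.add (.const 1))).add
        (.const 1))).add (.const 2)).comap Prod.fst |>.comap Subtype.val |>.mono fun p => ?_
      obtain ⟨⟨i, j⟩, hj⟩ := p
      have h2 : (enc ((l i).drop j)).size ≤ ((l i).drop j).length * ((enc (l i)).size + 1) + 1 :=
        size_listCode_le fun g hg => size_enc_le_of_mem (List.mem_of_mem_drop hg)
      have h3 : ((l i).drop j).length * ((enc (l i)).size + 1) ≤
          (enc (l i)).size * ((enc (l i)).size + 1) := by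
        gcongr
        exact (by simp : _ ≤ (l i).length).trans (length_le_size_listCode _)
      simp only [Data.size, size_natCode] at *
      omega

theorem head_drop {γ : ι → Type*} [∀ i, Encoded (γ i)] {l : ∀ i, List (γ i)} {k : ι → ℕ}
    (hk' : ∀ i, k i < (l i).length) (hl : Comp N a (fun i => enc (l i)))
    (hk : Comp N a (fun i => natCode (k i))) :
    Comp N a (fun i => enc ((l i)[k i]'(hk' i))) :=
  (listDrop hl hk).fst.of_eq fun i => by
    rw [List.drop_eq_getElem_cons (hk' i)]; rfl

theorem tuple_apply {γ : ι → Type*} [∀ i, Encoded (γ i)] {K : ι → ℕ} {f : ∀ i, Fin (K i) → γ i}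
    {k : ∀ i, Fin (K i)} (hf : Comp N a (fun i => enc (f i)))
    (hk : Comp N a (fun i => enc (k i))) : Comp N a (fun i => enc (f i (k i))) :=
  (head_drop (l := fun i => List.ofFn (f i)) (fun i => by simp) hf hk).of_eq fun i => by simp

theorem headD {γ : ι → Type*} [∀ i, Encoded (γ i)] {l : ∀ i, List (γ i)} {x : ∀ i, γ i}
    (hl : Comp N a (fun i => enc (l i))) (hx : Comp N a (fun i => enc (x i))) :
    Comp N a (fun i => enc ((l i).headD (x i))) :=
  (hl.cond hl.fst hx).of_eq fun i => by cases l i <;> rfl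

theorem listTail {γ : ι → Type*} [∀ i, Encoded (γ i)] {l : ∀ i, List (γ i)}
    (hl : Comp N a (fun i => enc (l i))) : Comp N a (fun i => enc (l i).tail) :=
  hl.snd.of_eq fun i => by cases l i <;> rfl

theorem listCons {γ : ι → Type*} [∀ i, Encoded (γ i)] {l : ∀ i, List (γ i)} {x : ∀ i, γ i}
    (hx : Comp N a (fun i => enc (x i))) (hl : Comp N a (fun i => enc (l i))) :
    Comp N a (fun i => enc (x i :: l i)) := hx.cons hl

/-- This turns truncated subtraction into `listDrop`, and comparison of numbers into a test for
`nil`. -/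
theorem natCode_eq_listCode (k : ℕ) : natCode k = listCode (List.replicate k false) := by
  induction k with
  | zero => rfl
  | succ k ih => simp only [natCode, List.replicate_succ, listCode, ih]; rfl

theorem sub {x y : ι → ℕ} (hx : Comp N a (fun i => natCode (x i)))
    (hy : Comp N a (fun i => natCode (y i))) : Comp N a (fun i => natCode (x i - y i)) :=
  (listDrop (l := fun i => List.replicate (x i) false)
    (hx.of_eq fun i => natCode_eq_listCode _) hy).of_eq fun i => by
      rw [List.drop_replicate, natCode_eq_listCode]; rfl

theorem natLe {x y : ι → ℕ} (hx : Comp N a (fun i => natCode (x i)))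
    (hy : Comp N a (fun i => natCode (y i))) : Comp N a (fun i => enc (decide (x i ≤ y i))) :=
  ((sub hx hy).cond (const hx.size_left (enc false)) (const hx.size_left (enc true))).of_eq
    fun i => by
      by_cases h : x i ≤ y i
      · simp [h, Nat.sub_eq_zero_of_le h, natCode, Data.cond]
      · obtain ⟨d, hd⟩ : ∃ d, x i - y i = d + 1 := ⟨x i - y i - 1, by omega⟩
        simp [h, hd, natCode, Data.cond]

theorem natEq {x y : ι → ℕ} (hx : Comp N a (fun i => natCode (x i)))
    (hy : Comp N a (fun i => natCode (y i))) : Comp N a (fun i => enc (decide (x i = y i))) :=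
  (ofFinite₂ (fun b c => b && c) (natLe hx hy) (natLe hy hx)).of_eq fun i => by
    congr 1
    rw [← Bool.decide_and]
    congr 1
    simp [le_antisymm_iff]

/-- The list is built from its end. With `K - j` left on the counter, the tail of the counter is the
code of `K - j - 1`, which is exactly the entry to be prepended. -/
theorem finRange {K : ι → ℕ} (hK : Comp N a (fun i => natCode (K i))) :
    Comp N a (fun i => enc (List.finRange (K i))) := by
  have hKP : PolyBdd N K := hK.size_right.mono fun i => by rw [size_natCode]; omega
  have h := loop (N := N) (a := a) (K := K) (L := fun i j => natCode (K i - j))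
    (s := fun i j => enc ((List.range (K i)).drop (K i - j)))
    (fun i j hj => ⟨.nil, ?_⟩) (fun i => by simp [natCode]) (hK.of_eq fun i => by simp)
    ((nil hK.size_left).of_eq fun i => ?_) ?_
  · refine h.of_eq fun i => ?_
    have : ∀ l : List (Fin (K i)), listCode l = listCode (l.map Fin.val) := by
      intro l
      induction l with
      | nil => rfl
      | cons x l ih => simp only [listCode, List.map_cons, ih]; rfl
    change listCode _ = listCode _
    rw [this]
    simp
  · obtain ⟨d, hd⟩ : ∃ d, K i - j = d + 1 := ⟨K i - j - 1, by omega⟩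
    rw [hd, show K i - (j + 1) = d by omega]
    rfl
  · simp only [tsub_zero]
    rw [List.drop_of_length_le (by simp)]
    rfl
  · have hr := refl (N := fun p : {p : ι × ℕ // p.2 < K p.1} => N p.1.1)
      (a := fun p => .cons (a p.1.1) (.cons (natCode (K p.1.1 - p.1.2))
        (enc ((List.range (K p.1.1)).drop (K p.1.1 - p.1.2))))) ?_
    · refine (hr.snd.fst.snd.cons hr.snd.snd).of_eq fun p => ?_
      obtain ⟨⟨i, j⟩, hj⟩ := p
      dsimp only at hj
      obtain ⟨d, hd⟩ : ∃ d, K i - j = d + 1 := ⟨K i - j - 1, by omega⟩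
      dsimp only [Data.fst, Data.snd]
      rw [show K i - (j + 1) = d by omega, hd,
        List.drop_eq_getElem_cons (i := d) (by simp; omega), List.getElem_range]
      rfl
    · have hrange : PolyBdd (fun p : {p : ι × ℕ // p.2 < K p.1} => N p.1.1)
          (fun p => (enc ((List.range (K p.1.1)).drop (K p.1.1 - p.1.2))).size) := by
        refine PolyBdd.listCode (γ := fun _ => ℕ) (hKP.comap (Prod.fst ∘ Subtype.val))
          ((((PolyBdd.const 2).mul hKP).add (.const 1)).comap (Prod.fst ∘ Subtype.val)) (fun p => ?_)
          (fun p g hg => ?_)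
        · simp
        · have := List.mem_range.1 (List.mem_of_mem_drop hg)
          change (natCode g).size ≤ 2 * K p.1.1 + 1
          rw [size_natCode]
          omega
      refine (((hK.size_left.add hK.size_right).comap (Prod.fst ∘ Subtype.val)).add
        (hrange.add (.const 2))).mono fun p => ?_
      simp only [Data.size, size_natCode, Function.comp]
      omega

/-- A tuple is computed entry by entry. -/
theorem tuple {K : ι → ℕ} {γ : ι → Type*} [∀ i, Encoded (γ i)] {f : ∀ i, Fin (K i) → γ i}
    (hK : Comp N a (fun i => natCode (K i)))
    (hf : Comp (fun p : Σ i, Fin (K i) => N p.1) (fun p => .cons (a p.1) (enc p.2))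
      (fun p => enc (f p.1 p.2))) :
    Comp N a (fun i => enc (f i)) :=
  (listMap (h := f) (finRange hK) hf).of_eq fun i => by
    rw [← List.ofFn_eq_map]
    rfl

/-- The list of all values of a function on `Fin (K i)`. -/
theorem listOfFn {K : ι → ℕ} {γ : ι → Type*} [∀ i, Encoded (γ i)] {f : ∀ i, Fin (K i) → γ i}
    (hK : Comp N a (fun i => natCode (K i)))
    (hf : Comp (fun p : Σ i, Fin (K i) => N p.1) (fun p => .cons (a p.1) (enc p.2))
      (fun p => enc (f p.1 p.2))) :
    Comp N a (fun i => enc (List.ofFn (f i))) := tuple hK hf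

end Comp

/-! ## The Pauli group -/

theorem Pauli.bits_injective : Function.Injective Pauli.bits := by
  intro a b
  cases a <;> cases b <;> simp [Pauli.bits]

instance : DecidableEq Pauli := fun _ _ => decidable_of_iff _ Pauli.bits_injective.eq_iff

instance : Fintype Pauli where
  elems := {Pauli.I, Pauli.X, Pauli.Y, Pauli.Z}
  complete p := by cases p <;> decide

/-- The product of two Pauli labels, without the phase. -/
def Pauli.mul : Pauli → Pauli → Pauli
  | .I, b => b
  | a, .I => a
  | .X, .X => .I
  | .X, .Y => .Z
  | .X, .Z => .Y
  | .Y, .X => .Z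
  | .Y, .Y => .I
  | .Y, .Z => .X
  | .Z, .X => .Y
  | .Z, .Y => .X
  | .Z, .Z => .I

/-- The exponent of `i` in the product of two Pauli matrices. -/
def Pauli.phase : Pauli → Pauli → ZMod 4
  | .X, .Y => 1
  | .Y, .Z => 1
  | .Z, .X => 1
  | .Y, .X => 3
  | .Z, .Y => 3
  | .X, .Z => 3
  | _, _ => 0

/-- The `X`-part and the `Z`-part of a Pauli label. -/
def Pauli.vec (a : Pauli) : ZMod 2 × ZMod 2 := (a.bits.1.toNat, a.bits.2.toNat)

theorem Pauli.vec_mul : ∀ a b : Pauli, (a.mul b).vec = a.vec + b.vec := by decide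

theorem Pauli.mul_comm : ∀ a b : Pauli, a.mul b = b.mul a := by decide

theorem Pauli.phase_comm : ∀ a b : Pauli, b.phase a = -a.phase b := by decide

/-- Modulo two the phase exponent is the symplectic form of the bit vectors. This makes
anticommutation bilinear and allows linear algebra over the field with two elements. -/
theorem Pauli.cast_phase : ∀ a b : Pauli, ZMod.castHom (by decide : 2 ∣ 4) (ZMod 2) (a.phase b) =
    a.vec.1 * b.vec.2 + a.vec.2 * b.vec.1 := by decide

/-- The power of the imaginary unit with an exponent modulo four. -/
noncomputable def ipow (k : ZMod 4) : ℂ := Complex.I ^ k.val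

theorem ipow_add (k l : ZMod 4) : ipow (k + l) = ipow k * ipow l := by
  rw [ipow, ZMod.val_add, ← Complex.I_pow_eq_pow_mod, pow_add, ipow, ipow]

theorem ipow_sum {ι : Type*} (s : Finset ι) (k : ι → ZMod 4) :
    ipow (∑ j ∈ s, k j) = ∏ j ∈ s, ipow (k j) := by
  classical
  induction s using Finset.induction_on with
  | empty => simp [ipow]
  | insert a s ha ih => rw [Finset.sum_insert ha, Finset.prod_insert ha, ipow_add, ih]

theorem Pauli.matrix_mul (a b : Pauli) :
    a.matrix * b.matrix = ipow (a.phase b) • (a.mul b).matrix := by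
  have h3 : ZMod.val (3 : ZMod 4) = 3 := rfl
  have h1 : ZMod.val (1 : ZMod 4) = 1 := rfl
  cases a <;> cases b <;>
    simp [Pauli.matrix, Pauli.mul, Pauli.phase, ipow, h1, h3, Complex.I_pow_three]

theorem Pauli.matrix_conjTranspose (a : Pauli) : a.matrixᴴ = a.matrix := by
  cases a <;> ext i j <;> fin_cases i <;> fin_cases j <;> simp [Pauli.matrix]

theorem Pauli.matrix_I : Pauli.I.matrix = 1 := by
  simp [Pauli.matrix, Matrix.one_fin_two]

/-- The sign in the product of two Hermitian Pauli operators whose phases add up to `k`. -/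
def phaseSign (k : ZMod 4) : ℤˣ := if k = 0 ∨ k = 3 then 1 else -1

/-- Whether a phase exponent is odd. -/
def oddPhase (k : ZMod 4) : Bool := decide (k = 1 ∨ k = 3)

theorem oddPhase_iff : ∀ k : ZMod 4,
    oddPhase k = decide (ZMod.castHom (by decide : 2 ∣ 4) (ZMod 2) k = 1) := by decide

/-- For odd exponents a factor `-I` is split off, matching the convention that the Hermitian product
of anticommuting `P` and `Q` is `i P Q`; what remains is the sign stored by `hmul`. -/
theorem ipow_eq (k : ZMod 4) :
    ipow k = (if oddPhase k then -Complex.I else 1) * ((phaseSign k : ℤ) : ℂ) := by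
  have h3 : ZMod.val (3 : ZMod 4) = 3 := rfl
  have h2 : ZMod.val (2 : ZMod 4) = 2 := rfl
  have h1 : ZMod.val (1 : ZMod 4) = 1 := rfl
  have : k = 0 ∨ k = 1 ∨ k = 2 ∨ k = 3 := by revert k; decide
  have e1 : oddPhase 1 = true := by decide
  have e2 : oddPhase 2 = false := by decide
  have e3 : oddPhase 3 = true := by decide
  have e0 : oddPhase 0 = false := by decide
  have f1 : phaseSign 1 = -1 := by decide
  have f2 : phaseSign 2 = -1 := by decide
  have f3 : phaseSign 3 = 1 := by decide
  have f0 : phaseSign 0 = 1 := by decide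
  rcases this with rfl | rfl | rfl | rfl <;>
    simp [ipow, h1, h2, h3, e0, e1, e2, e3, f0, f1, f2, f3, Complex.I_pow_three]

theorem ipow_neg (k : ZMod 4) : ipow (-k) = (if oddPhase k then -1 else 1) * ipow k := by
  have e : ∀ k : ZMod 4, oddPhase (-k) = oddPhase k := by decide
  have f : ∀ k : ZMod 4, phaseSign (-k) = (if oddPhase k then -1 else 1) * phaseSign k := by
    decide
  rw [ipow_eq, ipow_eq k, e, f]
  split_ifs <;> simp

/-! ### Tensor products of single-qubit operators -/

section Tensor

variable {ι : Type*} [Fintype ι]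

/-- The tensor product of single-qubit operators. -/
def tensor (A : ι → Matrix (Fin 2) (Fin 2) ℂ) : Matrix (ι → Fin 2) (ι → Fin 2) ℂ :=
  fun x y => ∏ j, A j (x j) (y j)

theorem tensor_mul [DecidableEq ι] (A B : ι → Matrix (Fin 2) (Fin 2) ℂ) :
    tensor A * tensor B = tensor (fun j => A j * B j) := by
  ext x z
  simp only [tensor, Matrix.mul_apply, ← Finset.prod_mul_distrib]
  rw [Finset.prod_univ_sum, Fintype.piFinset_univ]

theorem tensor_one [DecidableEq ι] :
    tensor (fun _ : ι => (1 : Matrix (Fin 2) (Fin 2) ℂ)) = 1 := by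
  ext x z
  by_cases h : x = z
  · subst h
    simp [tensor, Matrix.one_apply_eq]
  · obtain ⟨j, hj⟩ := Function.ne_iff.1 h
    rw [Matrix.one_apply_ne h, tensor]
    exact Finset.prod_eq_zero (Finset.mem_univ j) (Matrix.one_apply_ne hj)

theorem tensor_smul (c : ι → ℂ) (A : ι → Matrix (Fin 2) (Fin 2) ℂ) :
    tensor (fun j => c j • A j) = (∏ j, c j) • tensor A := by
  ext x z
  simp [tensor, Finset.prod_mul_distrib]

theorem tensor_conjTranspose (A : ι → Matrix (Fin 2) (Fin 2) ℂ) :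
    (tensor A)ᴴ = tensor (fun j => (A j)ᴴ) := by
  ext x z
  simp [tensor, Matrix.conjTranspose_apply]

end Tensor

/-- Hermitian Pauli operators on qubits indexed by `ι`. -/
abbrev SignedPauli (ι : Type*) : Type _ := ℤˣ × (ι → Pauli)

/-! ### Signed Pauli operators, their products and rotations -/

section SignedPauli

variable {ι : Type*} [Fintype ι]

/-- The exponent of `i` in the product of two Pauli strings. -/
def strPhase (f g : ι → Pauli) : ZMod 4 := ∑ j, (f j).phase (g j)

/-- Whether two Pauli strings anticommute. -/
def anti (f g : ι → Pauli) : Bool := oddPhase (strPhase f g)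

theorem strPhase_comm (f g : ι → Pauli) : strPhase g f = -strPhase f g := by
  simp [strPhase, ← Finset.sum_neg_distrib, Pauli.phase_comm (f _)]

theorem anti_eq (f g : ι → Pauli) : anti f g =
    decide (∑ j, ((f j).vec.1 * (g j).vec.2 + (f j).vec.2 * (g j).vec.1) = 1) := by
  simp only [anti, oddPhase_iff, strPhase, map_sum, Pauli.cast_phase]

theorem anti_comm (f g : ι → Pauli) : anti f g = anti g f := by
  have e : ∀ k : ZMod 4, oddPhase (-k) = oddPhase k := by decide
  rw [anti, anti, strPhase_comm g f, e]

theorem anti_self (f : ι → Pauli) : anti f f = false := by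
  have e : ∀ a : Pauli, a.phase a = 0 := by decide
  simp [anti, strPhase, e, oddPhase]
  decide

/-- The product of two Pauli strings, without the phase. -/
def strMul (f g : ι → Pauli) : ι → Pauli := fun j => (f j).mul (g j)

omit [Fintype ι] in
theorem strMul_comm (f g : ι → Pauli) : strMul f g = strMul g f :=
  funext fun _ => Pauli.mul_comm _ _

theorem anti_strMul_right (f g h : ι → Pauli) :
    anti f (strMul g h) = xor (anti f g) (anti f h) := by
  have e : ∀ a b : ZMod 2, decide (a + b = 1) = xor (decide (a = 1)) (decide (b = 1)) := by decide
  rw [anti_eq, anti_eq, anti_eq, ← e, ← Finset.sum_add_distrib]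
  congr 3
  funext j
  simp only [strMul, Pauli.vec_mul, Prod.fst_add, Prod.snd_add]
  ring

namespace SignedPauli

/-- The operator on the state space. -/
noncomputable def mat (P : SignedPauli ι) : Matrix (ι → Fin 2) (ι → Fin 2) ℂ :=
  ((P.1 : ℤ) : ℂ) • tensor fun j => (P.2 j).matrix

/-- The Hermitian product: `P Q` if these commute, and `i P Q` if they anticommute. -/
def hmul (P Q : SignedPauli ι) : SignedPauli ι :=
  (P.1 * Q.1 * phaseSign (strPhase P.2 Q.2), strMul P.2 Q.2)

/-- The operator with its sign multiplied by `s`. -/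
def scale (s : ℤˣ) (P : SignedPauli ι) : SignedPauli ι := (s * P.1, P.2)

theorem mat_scale (s : ℤˣ) (P : SignedPauli ι) : (scale s P).mat = ((s : ℤ) : ℂ) • P.mat := by
  simp [mat, scale, smul_smul]

variable [DecidableEq ι]

theorem mat_mul_eq (P Q : SignedPauli ι) : P.mat * Q.mat =
    ((((P.1 * Q.1 : ℤˣ) : ℤ) : ℂ) * ipow (strPhase P.2 Q.2)) •
      tensor fun j => (strMul P.2 Q.2 j).matrix := by
  simp only [mat, Matrix.smul_mul, Matrix.mul_smul, tensor_mul, Pauli.matrix_mul, tensor_smul,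
    strPhase, ipow_sum, smul_smul, strMul]
  push_cast
  ring_nf

theorem mat_mul (P Q : SignedPauli ι) : P.mat * Q.mat =
    (if anti P.2 Q.2 then -Complex.I else 1 : ℂ) • (hmul P Q).mat := by
  rw [mat_mul_eq, ipow_eq, mat, hmul, smul_smul, anti]
  push_cast
  ring_nf

theorem mat_mul_comm (P Q : SignedPauli ι) : Q.mat * P.mat =
    (if anti P.2 Q.2 then -1 else 1 : ℂ) • (P.mat * Q.mat) := by
  rw [mat_mul_eq, mat_mul_eq, strPhase_comm, ipow_neg, smul_smul, strMul_comm, anti, mul_comm Q.1]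
  ring_nf

theorem commute_of_anti_eq_false {P Q : SignedPauli ι} (h : anti P.2 Q.2 = false) :
    P.mat * Q.mat = Q.mat * P.mat := by
  simp [mat_mul_comm P Q, h]

theorem mat_mul_self (P : SignedPauli ι) : P.mat * P.mat = 1 := by
  have e : ∀ a : Pauli, a.phase a = 0 := by decide
  have e' : ∀ a : Pauli, a.mul a = .I := by decide
  rw [mat_mul_eq]
  simp [strPhase, strMul, e, e', ipow, Pauli.matrix_I, tensor_one]

omit [DecidableEq ι] in
theorem mat_conjTranspose (P : SignedPauli ι) : P.matᴴ = P.mat := by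
  simp [mat, tensor_conjTranspose, Pauli.matrix_conjTranspose]

/-- The rotation `exp (-i π R / 4)`. -/
noncomputable def rot (R : SignedPauli ι) : Matrix (ι → Fin 2) (ι → Fin 2) ℂ :=
  (1 / (Real.sqrt 2 : ℂ)) • (1 - Complex.I • R.mat)

/-- The operator `M` conjugated by the rotation about `R`. -/
def pull (R M : SignedPauli ι) : SignedPauli ι := if anti M.2 R.2 then hmul R M else M

/-- If M and R anticommute, then M(1 - iR) = (1 + iR)M = (1 - iR)(iRM) because R² = 1, and iRM is
the Hermitian product of R and M. -/
theorem mat_mul_rot (M R : SignedPauli ι) : M.mat * R.rot = R.rot * (pull R M).mat := by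
  simp only [rot, Matrix.mul_smul, Matrix.smul_mul, pull]
  congr 1
  split_ifs with h
  · have h1 : R.mat * M.mat = -Complex.I • (hmul R M).mat := by
      rw [mat_mul, anti_comm, h]; rfl
    have h2 : M.mat * R.mat = -(R.mat * M.mat) := by
      rw [mat_mul_comm R M, anti_comm, h]; simp
    have h3 : (hmul R M).mat = Complex.I • (R.mat * M.mat) := by
      rw [h1, smul_smul]; simp
    rw [mul_sub, Matrix.mul_smul, h2, h3, sub_mul, Matrix.smul_mul, Matrix.mul_smul,
      Matrix.mul_smul, ← mul_assoc R.mat, mat_mul_self, smul_smul]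
    simp
    abel
  · rw [mul_sub, sub_mul, Matrix.mul_smul, Matrix.smul_mul,
      commute_of_anti_eq_false (by simpa using h)]
    simp

theorem sqrt_two_sq : (Real.sqrt 2 : ℂ) * (Real.sqrt 2 : ℂ) = 2 := by
  rw [← Complex.ofReal_mul, Real.mul_self_sqrt (by norm_num)]; norm_num

theorem sqrt_two_ne : (Real.sqrt 2 : ℂ) ≠ 0 := by
  intro h
  have := sqrt_two_sq
  simp [h] at this

theorem rot_conjTranspose_mul (R : SignedPauli ι) : R.rotᴴ * R.rot = 1 := by
  have h : (1 / (Real.sqrt 2 : ℂ)) * (1 / (Real.sqrt 2 : ℂ)) = 1 / 2 := by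
    rw [one_div_mul_one_div, sqrt_two_sq]
  simp only [rot, Matrix.conjTranspose_smul, Matrix.conjTranspose_sub, Matrix.conjTranspose_one,
    mat_conjTranspose, Matrix.smul_mul, Matrix.mul_smul, smul_smul]
  have e : star (1 / (Real.sqrt 2 : ℂ)) = 1 / (Real.sqrt 2 : ℂ) := by simp
  rw [e, h, sub_mul, mul_sub, mul_sub, Matrix.smul_mul, Matrix.mul_smul, Matrix.smul_mul,
    Matrix.mul_smul, mat_mul_self, smul_smul]
  simp only [RCLike.star_def, Complex.conj_I, neg_mul, Complex.I_mul_I, mul_one, one_mul, neg_neg,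
    one_smul, neg_smul]
  module

end SignedPauli

/-- The squared norm of a vector. -/
noncomputable def normSq {κ : Type*} [Fintype κ] (ψ : κ → ℂ) : ℝ := ∑ z, ‖ψ z‖ ^ 2

theorem normSq_smul {κ : Type*} [Fintype κ] (c : ℂ) (ψ : κ → ℂ) :
    normSq (c • ψ) = ‖c‖ ^ 2 * normSq ψ := by
  simp [normSq, mul_pow, Finset.mul_sum]

theorem normSq_mulVec {κ : Type*} [Fintype κ] [DecidableEq κ] {U : Matrix κ κ ℂ} (h : Uᴴ * U = 1)
    (ψ : κ → ℂ) : normSq (U *ᵥ ψ) = normSq ψ := by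
  have e : ∀ φ : κ → ℂ, (normSq φ : ℂ) = star φ ⬝ᵥ φ := by
    intro φ
    simp only [normSq, dotProduct, Pi.star_apply, RCLike.star_def, RCLike.conj_mul]
    push_cast
    rfl
  have : (normSq (U *ᵥ ψ) : ℂ) = normSq ψ := by
    rw [e, e, Matrix.star_mulVec, Matrix.dotProduct_mulVec, Matrix.vecMul_vecMul, h,
      Matrix.vecMul_one]
  exact_mod_cast this

end SignedPauli

/-! ## Elimination over the field with two elements -/

section Dimension

open Module

/-- A list of vectors, each of them detected by a functional that vanishes on the vectors
preceding it in the list, is linearly independent. -/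
theorem exists_linearIndependent_of_pivots {K V : Type*} [Field K] [AddCommGroup V] [Module K V]
    (l : List (V × (V →ₗ[K] K))) (h1 : ∀ p ∈ l, p.2 p.1 ≠ 0)
    (h2 : l.Pairwise fun p q => q.2 p.1 = 0) :
    (∃ v : Fin l.length → V, LinearIndependent K v ∧ Set.range v = {x | x ∈ l.map Prod.fst}) ∧
      ∀ x ∈ Submodule.span K {x | x ∈ l.map Prod.fst}, (∀ p ∈ l, p.2 x = 0) → x = 0 := by
  induction l with
  | nil =>
    refine ⟨⟨(Fin.elim0 : Fin 0 → V), linearIndependent_empty_type (ι := Fin 0), ?_⟩, ?_⟩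
    · ext x; simp
    · intro x hx _
      simpa using hx
  | cons p l ih =>
    obtain ⟨⟨v, hv, hr⟩, hz⟩ := ih (fun q hq => h1 q (by simp [hq])) h2.of_cons
    have hp := (List.pairwise_cons.1 h2).1
    have hp0 : p.1 ≠ 0 := fun h => h1 p (by simp) (by simp [h])
    have hset : {x | x ∈ (p :: l).map Prod.fst} = insert p.1 {x | x ∈ l.map Prod.fst} := by
      ext x; simp
    refine ⟨⟨Fin.cons p.1 v, ?_, ?_⟩, ?_⟩
    · rw [linearIndependent_finCons, hr]
      -- All functionals of the tail vanish on `p.1`; if it lay in the span of the tail, it would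
      -- therefore be zero, contrary to its own functional.
      exact ⟨hv, fun h => hp0 (hz _ h hp)⟩
    · rw [hset, ← hr]
      exact Fin.range_cons _ _
    · intro x hx hx0
      rw [hset, Submodule.mem_span_insert] at hx
      obtain ⟨c, y, hy, rfl⟩ := hx
      have hy0 : y = 0 := hz y hy fun q hq => by
        have := hx0 q (by simp [hq])
        simpa [hp q hq] using this
      have := hx0 p (by simp)
      rw [hy0] at this ⊢
      simp only [add_zero, map_smul, smul_eq_mul, mul_eq_zero, h1 p (by simp), or_false] at this
      simp [this]

variable {ι : Type*} [Fintype ι]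

/-- The symplectic form on pairs of bit strings. -/
def sympForm (ι : Type*) [Fintype ι] : LinearMap.BilinForm (ZMod 2) (ι → ZMod 2 × ZMod 2) :=
  LinearMap.mk₂ (ZMod 2) (fun v w => ∑ j, ((v j).1 * (w j).2 + (v j).2 * (w j).1))
    (fun v v' w => by rw [← Finset.sum_add_distrib]; congr 1; funext j; simp; ring)
    (fun c v w => by simp only [smul_eq_mul, Finset.mul_sum]; congr 1; funext j; simp; ring)
    (fun v w w' => by rw [← Finset.sum_add_distrib]; congr 1; funext j; simp; ring)
    (fun c v w => by simp only [smul_eq_mul, Finset.mul_sum]; congr 1; funext j; simp; ring)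

theorem sympForm_apply (v w : ι → ZMod 2 × ZMod 2) :
    sympForm ι v w = ∑ j, ((v j).1 * (w j).2 + (v j).2 * (w j).1) := rfl

theorem sympForm_comm (v w : ι → ZMod 2 × ZMod 2) : sympForm ι v w = sympForm ι w v := by
  simp only [sympForm_apply]
  congr 1
  funext j
  ring

theorem sympForm_nondegenerate : (sympForm ι).Nondegenerate := by
  classical
  have key : (sympForm ι).SeparatingLeft := by
    intro v hv
    funext j
    have h1 := hv (Pi.single j (0, 1))
    have h2 := hv (Pi.single j (1, 0))
    rw [sympForm_apply, Finset.sum_eq_single j (by intro b _ hb; simp [Pi.single_eq_of_ne hb])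
      (by simp)] at h1 h2
    exact Prod.ext (by simpa using h1) (by simpa using h2)
  exact ⟨key, fun v hv => key v fun w => by rw [sympForm_comm]; exact hv w⟩

/-- The pivots make the vectors independent, so their span W has dimension `l.length`. As W lies in
its own orthogonal complement and the form is nondegenerate, dim W ≤ 2 · card ι - dim W. -/
theorem length_le_of_isotropic (l : List ((ι → ZMod 2 × ZMod 2) ×
      ((ι → ZMod 2 × ZMod 2) →ₗ[ZMod 2] ZMod 2))) (h1 : ∀ p ∈ l, p.2 p.1 ≠ 0)
    (h2 : l.Pairwise fun p q => q.2 p.1 = 0)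
    (h3 : ∀ p ∈ l, ∀ q ∈ l, sympForm ι p.1 q.1 = 0) : l.length ≤ Fintype.card ι := by
  obtain ⟨⟨v, hv, hr⟩, -⟩ := exists_linearIndependent_of_pivots l h1 h2
  set W := Submodule.span (ZMod 2) (Set.range v) with hW
  have hfin : finrank (ZMod 2) W = l.length := by
    rw [finrank_span_eq_card hv, Fintype.card_fin]
  have hiso : W ≤ (sympForm ι).orthogonal W := by
    have hmem : ∀ i, ∃ p ∈ l, p.1 = v i := fun i => by
      have : v i ∈ {x | x ∈ l.map Prod.fst} := hr ▸ Set.mem_range_self i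
      simpa using this
    rw [hW, Submodule.span_le]
    rintro _ ⟨i, rfl⟩ w hw
    change sympForm ι w (v i) = 0
    induction hw using Submodule.span_induction with
    | mem x hx =>
      obtain ⟨j, rfl⟩ := hx
      obtain ⟨p, hp, hpi⟩ := hmem i
      obtain ⟨q, hq, hqj⟩ := hmem j
      rw [← hpi, ← hqj]
      exact h3 q hq p hp
    | zero => simp
    | add x y _ _ hx hy => simp [hx, hy]
    | smul c x _ hx => simp [hx]
  have h := Submodule.finrank_mono hiso
  rw [LinearMap.BilinForm.finrank_orthogonal sympForm_nondegenerate, hfin] at h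
  have hV : finrank (ZMod 2) (ι → ZMod 2 × ZMod 2) = Fintype.card ι * 2 := by
    rw [finrank_pi_fintype]
    simp
  omega

end Dimension

/-! ## Pivots of Pauli strings -/

/-- Whether the Pauli label `b` has the `X`-part (if `a` has one) or else the `Z`-part. -/
def pivotTest (a b : Pauli) : Bool := if a.bits.1 then b.bits.1 else b.bits.2

/-- `pivotTest` at the first position where `g` is not the identity, and `r` if there is none. -/
def leadTest {K : ℕ} (g M : Fin K → Pauli) (r : Bool) : Bool :=
  (List.finRange K).foldr (fun j r => if g j = .I then r else pivotTest (g j) (M j)) r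

/-- Whether `M` has the pivot of the string `g`. -/
def hits {n m : ℕ} (g M : Fin n ⊕ Fin m → Pauli) : Bool :=
  leadTest (g ∘ .inl) (M ∘ .inl) (leadTest (g ∘ .inr) (M ∘ .inr) false)

/-- The pivot position depends on `g` alone, so testing `M` for it reads one fixed bit of `M`. Hence
`hits g` is additive in its second argument and comes from a linear functional. -/
theorem leadTest_spec {K : ℕ} (g : Fin K → Pauli) :
    ((∀ j, g j = .I) ∧ ∀ M r, leadTest g M r = r) ∨
      ∃ j, g j ≠ .I ∧ ∀ M r, leadTest g M r = pivotTest (g j) (M j) := by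
  have key : ∀ l : List (Fin K), ((∀ j ∈ l, g j = .I) ∧ ∀ (M : Fin K → Pauli) (r : Bool),
      l.foldr (fun j r => if g j = .I then r else pivotTest (g j) (M j)) r = r) ∨
      ∃ j, g j ≠ .I ∧ ∀ (M : Fin K → Pauli) (r : Bool),
        l.foldr (fun j r => if g j = .I then r else pivotTest (g j) (M j)) r =
          pivotTest (g j) (M j) := by
    intro l
    induction l with
    | nil => simp
    | cons i l ih =>
      by_cases h : g i = .I
      · simpa [h] using ih
      · exact .inr ⟨i, h, fun M r => by simp [h]⟩
  simpa [leadTest] using key (List.finRange K)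

theorem hits_spec {n m : ℕ} (g : Fin n ⊕ Fin m → Pauli) :
    ((∀ j, g j = .I) ∧ ∀ M, hits g M = false) ∨
      ∃ j, g j ≠ .I ∧ ∀ M, hits g M = pivotTest (g j) (M j) := by
  rcases leadTest_spec (g ∘ .inl) with ⟨h1, h2⟩ | ⟨j, h1, h2⟩
  · rcases leadTest_spec (g ∘ .inr) with ⟨h3, h4⟩ | ⟨j, h3, h4⟩
    · exact .inl ⟨by rintro (j | j) <;> [exact h1 j; exact h3 j], fun M => by simp [hits, h2, h4]⟩
    · exact .inr ⟨.inr j, h3, fun M => by simp [hits, h2, h4]⟩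
  · exact .inr ⟨.inl j, h1, fun M => by simp [hits, h2]⟩

theorem hits_strMul {n m : ℕ} (g M M' : Fin n ⊕ Fin m → Pauli) :
    hits g (strMul M M') = xor (hits g M) (hits g M') := by
  have e : ∀ a b c : Pauli, pivotTest a (b.mul c) = xor (pivotTest a b) (pivotTest a c) := by
    decide
  rcases hits_spec g with ⟨_, h⟩ | ⟨j, _, h⟩
  · simp [h]
  · simp [h, strMul, e]

theorem hits_self {n m : ℕ} {g : Fin n ⊕ Fin m → Pauli} (hg : g ≠ fun _ => .I) :
    hits g g = true := by
  have e : ∀ a : Pauli, a ≠ .I → pivotTest a a = true := by decide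
  rcases hits_spec g with ⟨h, _⟩ | ⟨j, hj, h⟩
  · exact absurd (funext h) hg
  · rw [h, e _ hj]

/-- The bit vector of a Pauli string. -/
def strVec {ι : Type*} (f : ι → Pauli) : ι → ZMod 2 × ZMod 2 := fun j => (f j).vec

theorem exists_hits_functional {n m : ℕ} (g : Fin n ⊕ Fin m → Pauli) :
    ∃ φ : (Fin n ⊕ Fin m → ZMod 2 × ZMod 2) →ₗ[ZMod 2] ZMod 2,
      ∀ M, φ (strVec M) = if hits g M then 1 else 0 := by
  have e : ∀ a b : Pauli, (if a.bits.1 then b.vec.1 else b.vec.2) =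
      if pivotTest a b then 1 else 0 := by decide
  rcases hits_spec g with ⟨_, h⟩ | ⟨j, _, h⟩
  · exact ⟨0, fun M => by simp [h]⟩
  · refine ⟨(if (g j).bits.1 then LinearMap.fst _ _ _ else LinearMap.snd _ _ _) ∘ₗ
      LinearMap.proj j, fun M => ?_⟩
    rw [h, ← e]
    split_ifs <;> rfl

/-- Pairwise commuting Pauli strings in echelon form are at most as many as there are qubits. -/
theorem length_le_of_echelon {n m : ℕ} (l : List (Fin n ⊕ Fin m → Pauli))
    (h1 : ∀ g ∈ l, hits g g = true) (h2 : l.Pairwise fun g h => hits h g = false)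
    (h3 : ∀ g ∈ l, ∀ h ∈ l, anti g h = false) : l.length ≤ n + m := by
  choose φ hφ using fun g : Fin n ⊕ Fin m → Pauli => exists_hits_functional g
  have := length_le_of_isotropic (l.map fun g => (strVec g, φ g)) ?_ ?_ ?_
  · simpa using this
  · simp only [List.mem_map, ne_eq, forall_exists_index, and_imp, forall_apply_eq_imp_iff₂]
    intro g hg
    simp [hφ, h1 g hg]
  · rw [List.pairwise_map]
    exact h2.imp fun {g h} hgh => by simp [hφ, hgh]
  · simp only [List.mem_map, forall_exists_index, and_imp, forall_apply_eq_imp_iff₂]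
    intro g hg h hh
    have e : ∀ a : ZMod 2, a ≠ 1 → a = 0 := by decide
    have := h3 g hg h hh
    rw [anti_eq, decide_eq_false_iff_not] at this
    exact e _ this

/-! ## Adaptive measurement trees -/

/-- A randomized adaptive computation: coin flips and Pauli measurements on `m` qubits. -/
inductive DTree (m : ℕ) (β : Type) : Type
  | leaf (b : β) : DTree m β
  | coin (f : Bool → DTree m β) : DTree m β
  | query (P : PauliOp m) (f : ℤˣ → DTree m β) : DTree m β

/-- The identity operator. -/
def PauliOp.id (m : ℕ) : PauliOp m := (1, fun _ => .I)

theorem PauliOp.matrix_eq_mat {m : ℕ} (P : PauliOp m) : P.matrix = SignedPauli.mat P := by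
  ext x y
  simp [PauliOp.matrix, SignedPauli.mat, tensor]

theorem PauliOp.matrix_id (m : ℕ) : (PauliOp.id m).matrix = 1 := by
  rw [PauliOp.matrix_eq_mat]
  simp [SignedPauli.mat, PauliOp.id, Pauli.matrix_I, tensor_one]

theorem normSq_zero {κ : Type*} [Fintype κ] : normSq (0 : κ → ℂ) = 0 := by simp [normSq]

theorem measured_id {m : ℕ} (s : ℤˣ) (φ : QVec m) :
    measured (PauliOp.id m) s φ = if s = 1 then φ else 0 := by
  rw [measured, PauliOp.matrix_id]
  rcases Int.units_eq_one_or s with rfl | rfl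
  · simp only [Units.val_one, Int.cast_one, one_smul, if_true, ← two_smul ℂ (1 : QOp m), smul_smul]
    norm_num
  · simp

/-- The unnormalized state after measurements with the eigenvalues in the list, where `p` gives
the operator measured after a list of eigenvalues. -/
noncomputable def stateFrom {m : ℕ} (p : List ℤˣ → PauliOp m) (φ : QVec m) : List ℤˣ → QVec m
  | [] => φ
  | s :: l => stateFrom (fun l => p (s :: l)) (measured (p []) s φ) l

theorem stateFrom_append {m : ℕ} (p : List ℤˣ → PauliOp m) (φ : QVec m) (l : List ℤˣ) (s : ℤˣ) :
    stateFrom p φ (l ++ [s]) = measured (p l) s (stateFrom p φ l) := by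
  induction l generalizing p φ with
  | nil => rfl
  | cons u l ih => exact ih _ _

/-- `PBC.state` splits off the last measurement, whereas induction on a measurement tree needs the
first one split off, as in `stateFrom`. -/
theorem PBC.state_eq_stateFrom {m : ℕ} {α : Type*} (Q : PBC m α) (p : List ℤˣ → PauliOp m)
    (hp : ∀ (t : Fin m) (σ : Fin t → ℤˣ), Q.pauli t σ = p (List.ofFn σ)) (t : ℕ) (ht : t ≤ m)
    (σ : Fin t → ℤˣ) : Q.state t ht σ = stateFrom p (magicState m) (List.ofFn σ) := by
  induction t with
  | zero => simp [PBC.state, stateFrom]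
  | succ t ih =>
    rw [PBC.state, hp, ih, List.ofFn_succ', List.concat_eq_append, stateFrom_append]
    rfl

theorem sum_cons {α M : Type*} [Fintype α] [AddCommMonoid M] {k : ℕ} (F : List α → M) :
    ∑ r : Fin (k + 1) → α, F (List.ofFn r) = ∑ b, ∑ r : Fin k → α, F (b :: List.ofFn r) := by
  rw [← Fintype.sum_prod_type', ← (Fin.consEquiv fun _ => α).sum_comp]
  congr 1
  funext x
  simp [List.ofFn_succ]

theorem sum_units {M : Type*} [AddCommMonoid M] (F : ℤˣ → M) : ∑ s, F s = F 1 + F (-1) := by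
  rw [show (Finset.univ : Finset ℤˣ) = {1, -1} by decide, Finset.sum_pair (by decide)]

namespace DTree

variable {m : ℕ} {β : Type}

/-- The expected value of the function `w` of the outcome, weighted by the squared norm. -/
noncomputable def expect (w : β → ℝ) : DTree m β → QVec m → ℝ
  | leaf b, φ => w b * normSq φ
  | coin f, φ => (1 / 2) * ∑ b, expect w (f b) φ
  | query P f, φ => ∑ s, expect w (f s) (measured P s φ)

/-- The measured operators and the outcome for given coin flips and eigenvalues. -/
def path : DTree m β → List Bool → List ℤˣ → List (PauliOp m) × β
  | leaf b, _, _ => ([], b)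
  | coin f, r, σ => path (f (r.headD false)) r.tail σ
  | query P f, r, σ =>
      (P :: (path (f (σ.headD 1)) r σ.tail).1, (path (f (σ.headD 1)) r σ.tail).2)

/-- At most `k` coins are flipped and at most `q` operators are measured. -/
def Fits : DTree m β → ℕ → ℕ → Prop
  | leaf _, _, _ => True
  | coin f, k, q => ∃ k', k = k' + 1 ∧ ∀ b, Fits (f b) k' q
  | query _ f, k, q => ∃ q', q = q' + 1 ∧ ∀ s, Fits (f s) k q'

/-- The operator measured after the given eigenvalues, and the identity if there is none. -/
def next (T : DTree m β) (r : List Bool) (σ : List ℤˣ) : PauliOp m :=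
  (T.path r σ).1.getD σ.length (PauliOp.id m)

/-- Measuring the identity gives 1 and keeps the state; the outcome -1 has weight zero. Padding a
branch with such measurements is therefore harmless. -/
theorem sum_stateFrom_id (q : ℕ) (φ : QVec m) :
    ∑ σ : Fin q → ℤˣ, normSq (stateFrom (fun _ => PauliOp.id m) φ (List.ofFn σ)) = normSq φ := by
  induction q generalizing φ with
  | zero => simp [stateFrom]
  | succ q ih =>
    rw [sum_cons (fun l => normSq (stateFrom (fun _ => PauliOp.id m) φ l)), sum_units]
    simp only [stateFrom, measured_id, ih]
    simp [normSq_zero]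

/-- A tree with branches of different lengths becomes a computation with exactly `k` coins and `q`
measurements: unused coins average out at the leaves, and missing measurements are identities. -/
theorem sum_path (w : β → ℝ) (T : DTree m β) (k q : ℕ) (h : T.Fits k q) (φ : QVec m) :
    (1 / 2 : ℝ) ^ k * ∑ r : Fin k → Bool, ∑ σ : Fin q → ℤˣ,
      w (T.path (List.ofFn r) (List.ofFn σ)).2 *
        normSq (stateFrom (T.next (List.ofFn r)) φ (List.ofFn σ)) = T.expect w φ := by
  induction T generalizing k q φ with
  | leaf b =>
    have hn : ∀ r, (leaf b : DTree m β).next r = fun _ => PauliOp.id m := fun r => by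
      funext σ; simp [next, path]
    simp only [hn, path, ← Finset.mul_sum, sum_stateFrom_id, expect]
    simp only [Finset.sum_const, Finset.card_univ, Fintype.card_fun, Fintype.card_bool,
      Fintype.card_fin, nsmul_eq_mul]
    push_cast
    have : (1 / 2 : ℝ) ^ k * 2 ^ k = 1 := by rw [← mul_pow]; norm_num
    linear_combination (w b * normSq φ) * this
  | coin f ih =>
    obtain ⟨k, rfl, hk⟩ := h
    rw [sum_cons (fun l => ∑ σ : Fin q → ℤˣ, w ((coin f).path l (List.ofFn σ)).2 *
        normSq (stateFrom ((coin f).next l) φ (List.ofFn σ))), expect, Finset.mul_sum,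
      Finset.mul_sum]
    congr 1
    funext b
    rw [← ih b k q (hk b) φ, pow_succ', mul_assoc]
    rfl
  | query P f ih =>
    obtain ⟨q, rfl, hq⟩ := h
    have h1 : ∀ r : List Bool, ∑ σ : Fin (q + 1) → ℤˣ, w ((query P f).path r (List.ofFn σ)).2 *
        normSq (stateFrom ((query P f).next r) φ (List.ofFn σ)) =
        ∑ s, ∑ σ : Fin q → ℤˣ, w ((f s).path r (List.ofFn σ)).2 *
          normSq (stateFrom ((f s).next r) (measured P s φ) (List.ofFn σ)) := fun r => by
      rw [sum_cons (fun l => w ((query P f).path r l).2 *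
        normSq (stateFrom ((query P f).next r) φ l))]
      rfl
    simp only [h1]
    rw [Finset.sum_comm, Finset.mul_sum, expect]
    congr 1
    funext s
    exact ih s k q (hq s) _

/-- The Pauli-based computation for fixed coin flips. -/
def toPBC {α : Type*} (T : DTree m β) (g : β → α) (r : List Bool) : PBC m α where
  pauli _ σ := T.next r (List.ofFn σ)
  output σ := g (T.path r (List.ofFn σ)).2

open Classical in
theorem randomizedOutcomeProb_toPBC {α : Type*} (T : DTree m β) (g : β → α) (k : ℕ)
    (h : T.Fits k m) (a : α) :
    randomizedOutcomeProb (fun r : Fin k → Bool => T.toPBC g (List.ofFn r)) a =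
      T.expect (fun b => if g b = a then 1 else 0) (magicState m) := by
  rw [← sum_path _ T k m h, randomizedOutcomeProb]
  congr 1
  refine Finset.sum_congr rfl fun r _ => ?_
  rw [PBC.outcomeProb]
  refine Finset.sum_congr rfl fun σ _ => ?_
  rw [PBC.prob, PBC.state_eq_stateFrom _ (T.next (List.ofFn r)) (fun _ _ => rfl)]
  by_cases h : g (T.path (List.ofFn r) (List.ofFn σ)).2 = a
  · have h' : (T.toPBC g (List.ofFn r)).output σ = a := h
    rw [if_pos h, if_pos h', one_mul]
    rfl
  · have h' : ¬ (T.toPBC g (List.ofFn r)).output σ = a := h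
    rw [if_neg h, if_neg h', zero_mul]

/-- The operator at position `t` depends only on the first `t` eigenvalues, so the default 1 that
`path` substitutes for eigenvalues not yet known does not affect it. -/
theorem path_take (T : DTree m β) (r : List Bool) (σ : List ℤˣ) (t : ℕ) (d : PauliOp m) :
    (T.path r (σ.take t)).1.getD t d = (T.path r σ).1.getD t d := by
  induction T generalizing r σ t with
  | leaf b => rfl
  | coin f ih => exact ih _ _ _ _
  | query P f ih =>
    cases t with
    | zero => rfl
    | succ t =>
      cases σ with
      | nil => rfl
      | cons s σ => exact ih s r σ t

theorem pairwiseCommuting_toPBC {α : Type*} (T : DTree m β) (g : β → α) (r : List Bool)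
    (h : ∀ σ, ∀ P ∈ (T.path r σ).1, ∀ Q ∈ (T.path r σ).1, Commute P.matrix Q.matrix) :
    (T.toPBC g r).PairwiseCommuting := by
  intro σ s t
  have key : ∀ t : Fin m, (T.toPBC g r).pauliAt σ t =
      (T.path r (List.ofFn σ)).1.getD t (PauliOp.id m) := fun t => by
    rw [← path_take]
    simp only [PBC.pauliAt, toPBC, next, List.length_ofFn]
    congr 3
    refine List.ext_getElem (by simp [t.isLt.le]) fun i h1 h2 => ?_
    simp [Fin.castLE]
  -- Beyond the end of the branch the measured operator is the padding identity, which commutes with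
  -- everything.
  have hd : ∀ (l : List (PauliOp m)) (t : ℕ), l.getD t (PauliOp.id m) ∈ l ∨
      l.getD t (PauliOp.id m) = PauliOp.id m := fun l t => by
    by_cases ht : t < l.length
    · exact .inl (by rw [List.getD_eq_getElem _ _ ht]; exact List.getElem_mem _)
    · exact .inr (List.getD_eq_default _ _ (by omega))
  rw [key, key]
  rcases hd (T.path r (List.ofFn σ)).1 s with h1 | h1
  · rcases hd (T.path r (List.ofFn σ)).1 t with h2 | h2
    · exact h _ _ h1 _ h2
    · rw [h2, PauliOp.matrix_id]; exact Commute.one_right _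
  · rw [h1, PauliOp.matrix_id]; exact Commute.one_left _

end DTree

/-! ## Adaptive programs with Pauli rotations and Pauli measurements -/

/-- Adaptive programs of rotations and measurements on `n + m` qubits with an outcome of `n`
bits. -/
inductive AProg (n m : ℕ) : Type
  | done (x : Fin n → Fin 2) : AProg n m
  | rot (R : SignedPauli (Fin n ⊕ Fin m)) (k : AProg n m) : AProg n m
  | meas (M : SignedPauli (Fin n ⊕ Fin m)) (k : ℤˣ → AProg n m) : AProg n m

/-- State vectors of `n + m` qubits. -/
abbrev SVec (n m : ℕ) : Type := (Fin n ⊕ Fin m → Fin 2) → ℂ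

/-- The projection onto the eigenspace of `M` for the eigenvalue `s`. -/
noncomputable def SignedPauli.proj {ι : Type*} [Fintype ι] [DecidableEq ι] (M : SignedPauli ι)
    (s : ℤˣ) : Matrix (ι → Fin 2) (ι → Fin 2) ℂ :=
  (1 / 2 : ℂ) • (1 + ((s : ℤ) : ℂ) • M.mat)

namespace AProg

variable {n m : ℕ}

/-- The expected value of the function `w` of the outcome. -/
noncomputable def expect (w : (Fin n → Fin 2) → ℝ) : AProg n m → SVec n m → ℝ
  | done x, Θ => w x * normSq Θ
  | rot R k, Θ => expect w k (R.rot *ᵥ Θ)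
  | meas M k, Θ => ∑ s, expect w (k s) (M.proj s *ᵥ Θ)

/-- Expectations use unnormalized states and are quadratic in them. Global phases therefore drop
out, and the factor √2 lost by a simulated random measurement can be accounted for. -/
theorem expect_smul (w : (Fin n → Fin 2) → ℝ) (A : AProg n m) (c : ℂ) (Θ : SVec n m) :
    A.expect w (c • Θ) = ‖c‖ ^ 2 * A.expect w Θ := by
  induction A generalizing Θ with
  | done x => rw [expect, expect, normSq_smul]; ring
  | rot R k ih => rw [expect, expect, Matrix.mulVec_smul, ih]
  | meas M k ih => simp only [expect, Matrix.mulVec_smul, ih, Finset.mul_sum]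

/-- At most `d` measurements are made. -/
def DepthLe : AProg n m → ℕ → Prop
  | done _, _ => True
  | rot _ k, d => DepthLe k d
  | meas _ k, d => ∃ d', d = d' + 1 ∧ ∀ s, DepthLe (k s) d'

end AProg

/-! ## Simulation by measurements of the magic states -/

/-- The data of the simulation: the stabilizers of the state found so far (the latest first) and
the pending rotations (the latest first). -/
abbrev Config (n m : ℕ) : Type :=
  List (SignedPauli (Fin n ⊕ Fin m)) × List (SignedPauli (Fin n ⊕ Fin m))

section Simulation

variable {n m : ℕ}

/-- The operator `M` moved past the pending rotations. -/
def pullBack (F : List (SignedPauli (Fin n ⊕ Fin m))) (M : SignedPauli (Fin n ⊕ Fin m)) :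
    SignedPauli (Fin n ⊕ Fin m) :=
  F.foldl (fun M R => SignedPauli.pull R M) M

/-- A row that anticommutes with `M`. -/
def antiRow (rows : List (SignedPauli (Fin n ⊕ Fin m))) (M : SignedPauli (Fin n ⊕ Fin m)) :
    Option (SignedPauli (Fin n ⊕ Fin m)) :=
  rows.foldr (fun g o => if anti g.2 M.2 then some g else o) none

/-- The operator `M` with the pivots of the rows eliminated. -/
def reduceBy (rows : List (SignedPauli (Fin n ⊕ Fin m))) (M : SignedPauli (Fin n ⊕ Fin m)) :
    SignedPauli (Fin n ⊕ Fin m) :=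
  rows.foldr (fun g M => if hits g.2 M.2 then SignedPauli.hmul g M else M) M

/-- The eigenvalue chosen by a coin flip. -/
def coinSign (b : Bool) : ℤˣ := if b then -1 else 1

/-- The simulation of a measurement, with the continuation `k`. -/
def simMeas {β : Type} (M : SignedPauli (Fin n ⊕ Fin m)) (k : ℤˣ → Config n m → DTree m β)
    (c : Config n m) : DTree m β :=
  match antiRow c.1 (pullBack c.2 M) with
  | some g => .coin fun b =>
      k (coinSign b) (c.1, c.2 ++ [.scale (coinSign b) (.hmul (pullBack c.2 M) g)])
  | none =>
      if (reduceBy c.1 (pullBack c.2 M)).2 = fun _ => .I then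
        k (reduceBy c.1 (pullBack c.2 M)).1 c
      else
        .query ((reduceBy c.1 (pullBack c.2 M)).1, (reduceBy c.1 (pullBack c.2 M)).2 ∘ .inr)
          fun u => k u (.scale u (reduceBy c.1 (pullBack c.2 M)) :: c.1, c.2)

/-- The simulation of an adaptive program. -/
def AProg.sim : AProg n m → Config n m → DTree m (Fin n → Fin 2)
  | .done x, _ => .leaf x
  | .rot R k, c => sim k (c.1, R :: c.2)
  | .meas M k, c => simMeas M (fun s c => sim (k s) c) c

/-- The operator `Z` on the qubit `q`. -/
def zRow (n m : ℕ) (q : Fin n) : SignedPauli (Fin n ⊕ Fin m) :=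
  (1, fun j => if j = .inl q then .Z else .I)

/-- The rows are commuting, in echelon form, and contain all `Z` operators on the first `n`
qubits. -/
structure Config.Valid (c : Config n m) : Prop where
  comm : ∀ g ∈ c.1, ∀ h ∈ c.1, anti g.2 h.2 = false
  echelon : c.1.Pairwise fun g h => hits h.2 g.2 = false
  ne : ∀ g ∈ c.1, g.2 ≠ fun _ => .I
  zmem : ∀ q, zRow n m q ∈ c.1

theorem Config.Valid.frame {c : Config n m} (h : c.Valid)
    (F : List (SignedPauli (Fin n ⊕ Fin m))) : Config.Valid (c.1, F) := ⟨h.1, h.2, h.3, h.4⟩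

theorem antiRow_some {rows : List (SignedPauli (Fin n ⊕ Fin m))}
    {M g : SignedPauli (Fin n ⊕ Fin m)} (h : antiRow rows M = some g) :
    g ∈ rows ∧ anti g.2 M.2 = true := by
  induction rows with
  | nil => simp [antiRow] at h
  | cons g' l ih =>
    rw [antiRow, List.foldr_cons] at h
    split_ifs at h with h'
    · cases h; exact ⟨by simp, h'⟩
    · have := ih h; exact ⟨by simp [this.1], this.2⟩

theorem antiRow_none {rows : List (SignedPauli (Fin n ⊕ Fin m))}
    {M : SignedPauli (Fin n ⊕ Fin m)} (h : antiRow rows M = none) :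
    ∀ g ∈ rows, anti g.2 M.2 = false := by
  induction rows with
  | nil => simp
  | cons g' l ih =>
    rw [antiRow, List.foldr_cons] at h
    split_ifs at h with h'
    intro g hg
    rcases List.mem_cons.1 hg with rfl | hg
    · simpa using h'
    · exact ih h g hg

/-- If g commutes with M and fixes v, then gMv = Mgv = Mv. -/
theorem mulVec_eq_of_anti {P : SignedPauli (Fin n ⊕ Fin m)} {g M : SignedPauli (Fin n ⊕ Fin m)}
    (hP : P = SignedPauli.hmul g M) (h : anti g.2 M.2 = false) {v : SVec n m}
    (hv : g.mat *ᵥ v = v) : P.mat *ᵥ v = M.mat *ᵥ v := by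
  have := SignedPauli.mat_mul g M
  rw [h] at this
  simp only [Bool.false_eq_true, if_false, one_smul] at this
  rw [hP, ← this, SignedPauli.commute_of_anti_eq_false h, ← Matrix.mulVec_mulVec, hv]

/-- The right fold clears the pivots of the oldest rows first. By the echelon condition a newer row
has no pivot of an older one, so cleared pivots stay cleared. Multiplication by rows preserves
commutation with anything that commutes with them, and the action on vectors they stabilize. -/
theorem reduceBy_spec {rows : List (SignedPauli (Fin n ⊕ Fin m))}
    (hc : ∀ g ∈ rows, ∀ h ∈ rows, anti g.2 h.2 = false)
    (he : rows.Pairwise fun g h => hits h.2 g.2 = false)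
    (hn : ∀ g ∈ rows, g.2 ≠ fun _ => .I) {M : SignedPauli (Fin n ⊕ Fin m)} :
    (∀ h : SignedPauli (Fin n ⊕ Fin m), anti h.2 M.2 = false →
      (∀ g ∈ rows, anti h.2 g.2 = false) → anti h.2 (reduceBy rows M).2 = false) ∧
    (∀ g ∈ rows, hits g.2 (reduceBy rows M).2 = false) ∧
    ((∀ g ∈ rows, anti g.2 M.2 = false) → ∀ v : SVec n m, (∀ g ∈ rows, g.mat *ᵥ v = v) →
      (reduceBy rows M).mat *ᵥ v = M.mat *ᵥ v) := by
  induction rows with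
  | nil => exact ⟨fun _ h _ => h, by simp, fun _ _ _ => rfl⟩
  | cons g l ih =>
    obtain ⟨h1, h2, h3⟩ := ih (fun a ha b hb => hc a (by simp [ha]) b (by simp [hb])) he.of_cons
      (fun a ha => hn a (by simp [ha]))
    have hg := (List.pairwise_cons.1 he).1
    have hred : reduceBy (g :: l) M = if hits g.2 (reduceBy l M).2 then
      SignedPauli.hmul g (reduceBy l M) else reduceBy l M := rfl
    refine ⟨fun h hM hl => ?_, fun g' hg' => ?_, fun hM v hv => ?_⟩
    · have := h1 h hM fun a ha => hl a (by simp [ha])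
      rw [hred]
      split_ifs
      · simp [SignedPauli.hmul, anti_strMul_right, this, hl g]
      · exact this
    · rw [hred]
      split_ifs with ht
      · rw [SignedPauli.hmul, hits_strMul]
        rcases List.mem_cons.1 hg' with rfl | hg'
        · simp [hits_self (hn g' (by simp)), ht]
        · simp [h2 g' hg', hg g' hg']
      · rcases List.mem_cons.1 hg' with rfl | hg'
        · simpa using ht
        · exact h2 g' hg'
    · have e := h3 (fun a ha => hM a (by simp [ha])) v fun a ha => hv a (by simp [ha])
      rw [hred]
      split_ifs
      · rw [← e]
        exact mulVec_eq_of_anti rfl (h1 g (hM g (by simp)) fun a ha => hc g (by simp) a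
          (by simp [ha])) (hv g (by simp))
      · exact e

theorem anti_zRow (q : Fin n) (f : Fin n ⊕ Fin m → Pauli) :
    anti (zRow n m q).2 f = (f (.inl q)).bits.1 := by
  have e : ∀ a : Pauli, decide (Pauli.Z.vec.1 * a.vec.2 + Pauli.Z.vec.2 * a.vec.1 = 1) =
      a.bits.1 := by decide
  rw [anti_eq, Finset.sum_eq_single (.inl q), ← e]
  · simp [zRow]
  · intro j _ hj
    have e' : ∀ a : Pauli, Pauli.I.vec.1 * a.vec.2 + Pauli.I.vec.2 * a.vec.1 = 0 := by decide
    simp [zRow, hj, e']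
  · simp

theorem hits_zRow (q : Fin n) (f : Fin n ⊕ Fin m → Pauli) :
    hits (zRow n m q).2 f = (f (.inl q)).bits.2 := by
  rcases hits_spec (zRow n m q).2 with ⟨h, _⟩ | ⟨j, hj, h⟩
  · simpa [zRow] using h (.inl q)
  · have : j = .inl q := by
      by_contra h'
      simp [zRow, h'] at hj
    rw [h, this]
    simp [zRow, pivotTest, Pauli.bits]

theorem Config.Valid.length_le {c : Config n m} (h : c.Valid) : c.1.length ≤ n + m := by
  have := length_le_of_echelon (c.1.map Prod.snd) ?_ ?_ ?_
  · simpa using this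
  · simp only [List.mem_map, forall_exists_index, and_imp, forall_apply_eq_imp_iff₂]
    exact fun g hg => hits_self (h.ne g hg)
  · rw [List.pairwise_map]
    exact h.echelon
  · simp only [List.mem_map, forall_exists_index, and_imp, forall_apply_eq_imp_iff₂]
    exact h.comm

/-- The data of a measurement that needs the quantum computer. -/
theorem Config.Valid.reduce {c : Config n m} (h : c.Valid) {M : SignedPauli (Fin n ⊕ Fin m)}
    (hM : antiRow c.1 M = none) :
    (∀ g ∈ c.1, anti g.2 (reduceBy c.1 M).2 = false) ∧
    (∀ q, (reduceBy c.1 M).2 (.inl q) = .I) ∧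
    ((reduceBy c.1 M).2 ≠ (fun _ => .I) → ∀ u,
      Config.Valid (.scale u (reduceBy c.1 M) :: c.1, c.2)) ∧
    (∀ v : SVec n m, (∀ g ∈ c.1, g.mat *ᵥ v = v) →
      (reduceBy c.1 M).mat *ᵥ v = M.mat *ᵥ v) := by
  obtain ⟨h1, h2, h3⟩ := reduceBy_spec h.comm h.echelon h.ne (M := M)
  have hM' := antiRow_none hM
  have h4 : ∀ g ∈ c.1, anti g.2 (reduceBy c.1 M).2 = false := fun g hg =>
    h1 g (hM' g hg) (h.comm g hg)
  refine ⟨h4, fun q => ?_, fun hne u => ⟨?_, ?_, ?_, ?_⟩, h3 hM'⟩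
  -- Commuting with Z on `q` excludes an X-part there, and the cleared pivot of that row excludes a
  -- Z-part; only the identity label is left.
  · have e1 := h4 _ (h.zmem q)
    have e2 := h2 _ (h.zmem q)
    rw [anti_zRow] at e1
    rw [hits_zRow] at e2
    exact Pauli.bits_injective (Prod.ext e1 e2)
  · intro g hg g' hg'
    rcases List.mem_cons.1 hg with rfl | hg <;> rcases List.mem_cons.1 hg' with rfl | hg'
    · exact anti_self _
    · rw [anti_comm]; exact h4 g' hg'
    · exact h4 g hg
    · exact h.comm g hg g' hg'
  · exact List.pairwise_cons.2 ⟨fun g hg => h2 g hg, h.echelon⟩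
  · intro g hg
    rcases List.mem_cons.1 hg with rfl | hg
    · exact hne
    · exact h.ne g hg
  · exact fun q => List.mem_cons_of_mem _ (h.zmem q)

/-- Each measurement of the program uses at most one coin, so the depth bounds the coins. Each query
adds a row, and the enlarged list is still valid, hence of length at most `n + m`; so `q` is
positive whenever a query occurs. -/
theorem AProg.fits_sim (A : AProg n m) (c : Config n m) (hc : c.Valid) (k q : ℕ)
    (hk : A.DepthLe k) (hq : c.1.length + q = n + m) : (A.sim c).Fits k q := by
  induction A generalizing c k q with
  | done x => trivial
  | rot R A ih => exact ih (c.1, R :: c.2) (hc.frame _) k q hk hq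
  | meas M A ih =>
    obtain ⟨k, rfl, hk⟩ := hk
    -- A determined outcome and a query both leave the coin reserved for this measurement unused.
    have mono : ∀ (T : DTree m (Fin n → Fin 2)) (k q : ℕ), T.Fits k q → T.Fits (k + 1) q := by
      intro T
      induction T with
      | leaf b => exact fun _ _ _ => trivial
      | coin f ih =>
        rintro _ q ⟨k, rfl, h⟩
        exact ⟨_, rfl, fun b => ih b _ _ (h b)⟩
      | query P f ih =>
        rintro k _ ⟨q, rfl, h⟩
        exact ⟨_, rfl, fun b => ih b _ _ (h b)⟩
    rw [sim, simMeas]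
    split
    · exact ⟨k, rfl, fun b => ih _ (c.1, _) (hc.frame _) k q (hk _) hq⟩
    · next hM =>
      obtain ⟨h1, h2, h3, h4⟩ := hc.reduce hM
      split_ifs with hI
      · exact mono _ _ _ (ih _ _ hc k q (hk _) hq)
      · have hlen := (h3 hI 1).length_le
        simp only [List.length_cons] at hlen
        obtain ⟨q, rfl⟩ : ∃ q', q = q' + 1 := ⟨q - 1, by omega⟩
        refine ⟨q, rfl, fun s => mono _ _ _ (ih _ _ (h3 hI s) k q (hk _) ?_)⟩
        simp only [List.length_cons]
        omega

/-- A Pauli operator on the last `m` qubits. -/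
def liftRight (P : PauliOp m) : SignedPauli (Fin n ⊕ Fin m) := (P.1, Sum.elim (fun _ => .I) P.2)

theorem anti_liftRight (P Q : PauliOp m) :
    anti (liftRight (n := n) P).2 (liftRight Q).2 = anti P.2 Q.2 := by
  have : Pauli.I.phase .I = 0 := by decide
  simp [anti, strPhase, liftRight, this]

theorem liftRight_reduce {f : SignedPauli (Fin n ⊕ Fin m)} (h : ∀ q, f.2 (.inl q) = .I) :
    liftRight (f.1, f.2 ∘ .inr) = f := by
  refine Prod.ext rfl (funext fun j => ?_)
  rcases j with j | j
  · exact (h j).symm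
  · rfl

/-- The first claim strengthens the induction: later queries commute with all current rows. A
queried operator becomes a row at once, so it commutes with every later query. -/
theorem AProg.path_sim_comm (A : AProg n m) (c : Config n m) (hc : c.Valid) (r : List Bool)
    (σ : List ℤˣ) :
    (∀ P ∈ ((A.sim c).path r σ).1, ∀ g ∈ c.1, anti g.2 (liftRight P).2 = false) ∧
      ∀ P ∈ ((A.sim c).path r σ).1, ∀ Q ∈ ((A.sim c).path r σ).1, anti P.2 Q.2 = false := by
  induction A generalizing c r σ with
  | done x => simp [sim, DTree.path]
  | rot R A ih => exact ih (c.1, R :: c.2) (hc.frame _) r σ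
  | meas M A ih =>
    rw [sim, simMeas]
    split
    · exact ih _ (c.1, _) (hc.frame _) _ _
    · next hM =>
      obtain ⟨h1, h2, h3, h4⟩ := hc.reduce hM
      split_ifs with hI
      · exact ih _ _ hc r σ
      · obtain ⟨i1, i2⟩ := ih (σ.headD 1) _ (h3 hI (σ.headD 1)) r σ.tail
        have hl := liftRight_reduce h2
        have i3 : ∀ Q ∈ ((sim (A (σ.headD 1)) (.scale (σ.headD 1)
            (reduceBy c.1 (pullBack c.2 M)) :: c.1, c.2)).path r σ.tail).1,
            anti ((reduceBy c.1 (pullBack c.2 M)).2 ∘ .inr) Q.2 = false := by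
          intro Q hQ
          have := i1 Q hQ _ List.mem_cons_self
          rw [show (SignedPauli.scale (σ.headD 1) (reduceBy c.1 (pullBack c.2 M))).2 =
            (reduceBy c.1 (pullBack c.2 M)).2 from rfl, ← hl, anti_liftRight] at this
          exact this
        simp only [DTree.path, List.mem_cons]
        refine ⟨?_, ?_⟩
        · rintro P (rfl | hP) g hg
          · rw [hl]; exact h1 g hg
          · exact i1 P hP g (by simp [hg])
        · rintro P (rfl | hP) Q (rfl | hQ)
          · exact anti_self _
          · exact i3 Q hQ
          · rw [anti_comm]; exact i3 P hP
          · exact i2 P hP Q hQ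

end Simulation

/-! ## Correctness of the simulation -/

section Correctness

variable {n m : ℕ}

/-- The product of a state of the first `n` qubits and a state of the last `m` qubits. -/
def prodVec (χ : QVec n) (φ : QVec m) : SVec n m := fun z => χ (z ∘ .inl) * φ (z ∘ .inr)

theorem tensor_mulVec_prodVec (A : Fin n ⊕ Fin m → Matrix (Fin 2) (Fin 2) ℂ) (χ : QVec n)
    (φ : QVec m) : tensor A *ᵥ prodVec χ φ =
      prodVec (tensor (A ∘ .inl) *ᵥ χ) (tensor (A ∘ .inr) *ᵥ φ) := by
  funext z
  simp only [Matrix.mulVec, dotProduct, prodVec, tensor, Fintype.prod_sum_type,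
    Fintype.sum_mul_sum, ← Fintype.sum_prod_type']
  rw [← (Equiv.sumArrowEquivProdArrow (Fin n) (Fin m) (Fin 2)).symm.sum_comp]
  refine Finset.sum_congr rfl fun p _ => ?_
  simp only [Equiv.sumArrowEquivProdArrow, Equiv.coe_fn_symm_mk, Sum.elim_inl, Sum.elim_inr,
    Sum.elim_comp_inl, Sum.elim_comp_inr, Function.comp]
  ring

theorem prodVec_smul_left (c : ℂ) (χ : QVec n) (φ : QVec m) :
    prodVec (c • χ) φ = c • prodVec χ φ := by
  funext z; simp [prodVec, mul_assoc]

theorem prodVec_smul_right (c : ℂ) (χ : QVec n) (φ : QVec m) :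
    prodVec χ (c • φ) = c • prodVec χ φ := by
  funext z; simp [prodVec, mul_left_comm]

theorem prodVec_add_right (χ : QVec n) (φ φ' : QVec m) :
    prodVec χ (φ + φ') = prodVec χ φ + prodVec χ φ' := by
  funext z; simp [prodVec, mul_add]

theorem tensor_I {ι : Type*} [Fintype ι] [DecidableEq ι] :
    tensor (fun _ : ι => Pauli.I.matrix) = 1 := by
  simp [Pauli.matrix_I, tensor_one]

theorem mat_liftRight (P : PauliOp m) (χ : QVec n) (φ : QVec m) :
    (liftRight (n := n) P).mat *ᵥ prodVec χ φ = prodVec χ (P.matrix *ᵥ φ) := by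
  have h : (fun j => ((liftRight (n := n) P).2 j).matrix) ∘ Sum.inl =
    fun _ => Pauli.I.matrix := rfl
  rw [PauliOp.matrix_eq_mat, SignedPauli.mat, SignedPauli.mat, Matrix.smul_mulVec,
    Matrix.smul_mulVec, tensor_mulVec_prodVec, prodVec_smul_right, h, tensor_I, Matrix.one_mulVec]
  rfl

theorem prodVec_measured (P : PauliOp m) (s : ℤˣ) (χ : QVec n) (φ : QVec m) :
    prodVec χ (measured P s φ) = (liftRight (n := n) P).proj s *ᵥ prodVec χ φ := by
  rw [measured, SignedPauli.proj, Matrix.smul_mulVec, Matrix.smul_mulVec, Matrix.add_mulVec,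
    Matrix.add_mulVec, Matrix.one_mulVec, Matrix.one_mulVec, Matrix.smul_mulVec,
    Matrix.smul_mulVec, mat_liftRight, prodVec_smul_right, prodVec_add_right, prodVec_smul_right]

/-- The product of the pending rotations. -/
noncomputable def frameOp (F : List (SignedPauli (Fin n ⊕ Fin m))) :
    Matrix (Fin n ⊕ Fin m → Fin 2) (Fin n ⊕ Fin m → Fin 2) ℂ :=
  F.foldr (fun R U => R.rot * U) 1

theorem frameOp_append (F : List (SignedPauli (Fin n ⊕ Fin m)))
    (R : SignedPauli (Fin n ⊕ Fin m)) : frameOp (F ++ [R]) = frameOp F * R.rot := by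
  induction F with
  | nil => simp [frameOp]
  | cons R' F ih =>
    simp only [frameOp, List.cons_append, List.foldr_cons] at ih ⊢
    rw [ih, mul_assoc]

theorem mat_mul_frameOp (F : List (SignedPauli (Fin n ⊕ Fin m)))
    (M : SignedPauli (Fin n ⊕ Fin m)) : M.mat * frameOp F = frameOp F * (pullBack F M).mat := by
  induction F generalizing M with
  | nil => simp [frameOp, pullBack]
  | cons R F ih =>
    have : frameOp (R :: F) = R.rot * frameOp F := rfl
    rw [this, ← mul_assoc, SignedPauli.mat_mul_rot, mul_assoc, ih, mul_assoc]
    rfl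

theorem proj_mul_frameOp (F : List (SignedPauli (Fin n ⊕ Fin m)))
    (M : SignedPauli (Fin n ⊕ Fin m)) (s : ℤˣ) :
    M.proj s * frameOp F = frameOp F * (pullBack F M).proj s := by
  simp only [SignedPauli.proj, Matrix.smul_mul, Matrix.mul_smul, add_mul, mul_add, one_mul,
    mul_one, mat_mul_frameOp]

theorem normSq_frameOp (F : List (SignedPauli (Fin n ⊕ Fin m))) (v : SVec n m) :
    normSq (frameOp F *ᵥ v) = normSq v := by
  induction F with
  | nil => simp [frameOp]
  | cons R F ih =>
    have : frameOp (R :: F) = R.rot * frameOp F := rfl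
    rw [this, ← Matrix.mulVec_mulVec, normSq_mulVec R.rot_conjTranspose_mul, ih]

namespace SignedPauli

variable {ι : Type*} [Fintype ι] [DecidableEq ι]

theorem proj_mulVec (M : SignedPauli ι) (s : ℤˣ) (v : (ι → Fin 2) → ℂ) :
    M.proj s *ᵥ v = (1 / 2 : ℂ) • (v + ((s : ℤ) : ℂ) • (M.mat *ᵥ v)) := by
  rw [proj, Matrix.smul_mulVec, Matrix.add_mulVec, Matrix.one_mulVec, Matrix.smul_mulVec]

theorem proj_congr {M M' : SignedPauli ι} {v : (ι → Fin 2) → ℂ} (h : M.mat *ᵥ v = M'.mat *ᵥ v)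
    (s : ℤˣ) : M.proj s *ᵥ v = M'.proj s *ᵥ v := by
  rw [proj_mulVec, proj_mulVec, h]

theorem scale_mulVec_proj (M : SignedPauli ι) (s : ℤˣ) (v : (ι → Fin 2) → ℂ) :
    (scale s M).mat *ᵥ (M.proj s *ᵥ v) = M.proj s *ᵥ v := by
  have hs : ((s : ℤ) : ℂ) * ((s : ℤ) : ℂ) = 1 := by
    rcases Int.units_eq_one_or s with rfl | rfl <;> simp
  rw [proj_mulVec, mat_scale, Matrix.smul_mulVec, Matrix.mulVec_smul, Matrix.mulVec_add,
    Matrix.mulVec_smul, Matrix.mulVec_mulVec, mat_mul_self, Matrix.one_mulVec, smul_comm,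
    smul_add, smul_smul, hs, one_smul, add_comm]

/-- If `v` is stabilized by an operator anticommuting with `M`, then the projection of `v` is
proportional to a rotation of `v`. -/
theorem rot_mulVec_of_anti {M g : SignedPauli ι} (h : anti M.2 g.2 = true)
    {v : (ι → Fin 2) → ℂ} (hv : g.mat *ᵥ v = v) (s : ℤˣ) :
    (scale s (hmul M g)).rot *ᵥ v = (Real.sqrt 2 : ℂ) • (M.proj s *ᵥ v) := by
  have h1 : (hmul M g).mat = Complex.I • (M.mat * g.mat) := by
    rw [mat_mul, h, smul_smul]; simp
  rw [rot, proj_mulVec, mat_scale, h1, Matrix.smul_mulVec, Matrix.sub_mulVec, Matrix.one_mulVec,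
    Matrix.smul_mulVec, Matrix.smul_mulVec, Matrix.smul_mulVec, ← Matrix.mulVec_mulVec, hv,
    smul_smul (Real.sqrt 2 : ℂ)]
  have h2 : (1 / (Real.sqrt 2 : ℂ)) = (Real.sqrt 2 : ℂ) * (1 / 2) := by
    field_simp [sqrt_two_ne]
    rw [pow_two, sqrt_two_sq]
  rw [h2]
  congr 1
  rw [smul_smul, smul_smul]
  have : Complex.I * (((s : ℤ) : ℂ) * Complex.I) = -((s : ℤ) : ℂ) := by
    linear_combination ((s : ℤ) : ℂ) * Complex.I_mul_I
  rw [mul_assoc, this, neg_smul, sub_neg_eq_add]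

end SignedPauli

/-- The rows stabilize the state. -/
def Config.Stab (c : Config n m) (φ : QVec m) : Prop :=
  ∀ g ∈ c.1, g.mat *ᵥ prodVec (ketZero n) φ = prodVec (ketZero n) φ

/-- `G` abstracts the expectation of the remaining program, so that one measurement can be treated
alone. Moving the projection past the pending rotations leaves three cases: a coin when a row
anticommutes, a determined sign, and a real query. -/
theorem expect_simMeas {β : Type} (w : β → ℝ) (M : SignedPauli (Fin n ⊕ Fin m))
    (k : ℤˣ → Config n m → DTree m β) (G : ℤˣ → SVec n m → ℝ)
    (hG : ∀ s (a : ℂ) v, G s (a • v) = ‖a‖ ^ 2 * G s v)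
    (hk : ∀ s (c : Config n m) φ, c.Valid → c.Stab φ →
      (k s c).expect w φ = G s (frameOp c.2 *ᵥ prodVec (ketZero n) φ))
    (c : Config n m) (φ : QVec m) (hc : c.Valid) (hφ : c.Stab φ) :
    (simMeas M k c).expect w φ =
      ∑ s, G s (M.proj s *ᵥ (frameOp c.2 *ᵥ prodVec (ketZero n) φ)) := by
  have hpull : ∀ s, M.proj s *ᵥ (frameOp c.2 *ᵥ prodVec (ketZero n) φ) =
      frameOp c.2 *ᵥ ((pullBack c.2 M).proj s *ᵥ prodVec (ketZero n) φ) := fun s => by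
    rw [Matrix.mulVec_mulVec, proj_mul_frameOp, Matrix.mulVec_mulVec]
  simp only [hpull]
  rw [simMeas]
  split
  · next g hg =>
    obtain ⟨hg1, hg2⟩ := antiRow_some hg
    have hsqrt : ‖(Real.sqrt 2 : ℂ)‖ ^ 2 = 2 := by
      rw [Complex.norm_real, Real.norm_eq_abs, sq_abs, Real.sq_sqrt (by norm_num)]
    -- The appended rotation acts as √2 times the projection on the stabilized state. Homogeneity of
    -- `G` turns this into the factor 2 that cancels the coin probability.
    have key : ∀ b, (k (coinSign b) (c.1, c.2 ++ [.scale (coinSign b)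
        (.hmul (pullBack c.2 M) g)])).expect w φ = 2 * G (coinSign b)
          (frameOp c.2 *ᵥ ((pullBack c.2 M).proj (coinSign b) *ᵥ prodVec (ketZero n) φ)) := by
      intro b
      refine (hk _ (c.1, c.2 ++ [.scale (coinSign b) (.hmul (pullBack c.2 M) g)]) φ (hc.frame _)
        hφ).trans ?_
      rw [frameOp_append, ← Matrix.mulVec_mulVec,
        SignedPauli.rot_mulVec_of_anti (by rw [anti_comm]; exact hg2) (hφ g hg1),
        Matrix.mulVec_smul, hG, hsqrt]
    rw [DTree.expect, Fintype.sum_bool, key, key, sum_units]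
    simp only [coinSign, Bool.false_eq_true, if_true, if_false]
    ring
  · next hM =>
    obtain ⟨h1, h2, h3, h4⟩ := hc.reduce hM
    have hred := h4 _ hφ
    simp only [← SignedPauli.proj_congr hred]
    split_ifs with hI
    -- The operator acts as a scalar sign, so the projection for that sign keeps the state and the
    -- other one annihilates it.
    · have hmat : (reduceBy c.1 (pullBack c.2 M)).mat =
          (((reduceBy c.1 (pullBack c.2 M)).1 : ℤ) : ℂ) • 1 := by
        rw [SignedPauli.mat, hI, tensor_I]
      have hp : ∀ s, (reduceBy c.1 (pullBack c.2 M)).proj s *ᵥ prodVec (ketZero n) φ =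
          if s = (reduceBy c.1 (pullBack c.2 M)).1 then prodVec (ketZero n) φ else 0 := by
        intro s
        rw [SignedPauli.proj_mulVec, hmat, Matrix.smul_mulVec, Matrix.one_mulVec, smul_smul]
        generalize (reduceBy c.1 (pullBack c.2 M)).1 = u
        have e : ∀ v : SVec n m, (1 / 2 : ℂ) • (v + v) = v := fun v => by
          rw [← two_smul ℂ v, smul_smul]; norm_num
        rcases Int.units_eq_one_or s with rfl | rfl <;>
          rcases Int.units_eq_one_or u with rfl | rfl
        · simpa using e _
        · rw [if_neg (by decide)]; simp
        · rw [if_neg (by decide)]; simp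
        · simpa using e _
      have hG0 : ∀ s, G s 0 = 0 := fun s => by
        have := hG s 0 0
        simpa using this
      rw [hk _ c φ hc hφ, Finset.sum_eq_single (reduceBy c.1 (pullBack c.2 M)).1]
      · rw [hp, if_pos rfl]
      · intro s _ hs
        rw [hp, if_neg hs, Matrix.mulVec_zero, hG0]
      · exact fun h => absurd (Finset.mem_univ _) h
    · have hl := liftRight_reduce h2
      rw [DTree.expect]
      refine Finset.sum_congr rfl fun s _ => ?_
      have e : prodVec (ketZero n) (measured ((reduceBy c.1 (pullBack c.2 M)).1,
          (reduceBy c.1 (pullBack c.2 M)).2 ∘ .inr) s φ) =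
            (reduceBy c.1 (pullBack c.2 M)).proj s *ᵥ prodVec (ketZero n) φ := by
        rw [prodVec_measured, hl]
      rw [hk _ (_, c.2) _ (h3 hI s), e]
      -- The measured state is stabilized by the new row since it lies in the eigenspace of the
      -- outcome, and still by the old rows since they commute with the projection.
      intro g hg
      rw [e]
      rcases List.mem_cons.1 hg with rfl | hg
      · exact SignedPauli.scale_mulVec_proj _ _ _
      · rw [SignedPauli.proj_mulVec, Matrix.mulVec_smul, Matrix.mulVec_add, Matrix.mulVec_smul,
          Matrix.mulVec_mulVec, SignedPauli.commute_of_anti_eq_false (h1 g hg),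
          ← Matrix.mulVec_mulVec, hφ g hg]

theorem AProg.expect_sim (w : (Fin n → Fin 2) → ℝ) (A : AProg n m) (c : Config n m) (φ : QVec m)
    (hc : c.Valid) (hφ : c.Stab φ) :
    (A.sim c).expect w φ = A.expect w (frameOp c.2 *ᵥ prodVec (ketZero n) φ) := by
  induction A generalizing c φ with
  | done x =>
    have hk : normSq (ketZero n) = 1 := by
      simp [normSq, ketZero, apply_ite]
    have hp : normSq (prodVec (ketZero n) φ) = normSq (ketZero n) * normSq φ := by
      simp only [normSq, prodVec, Fintype.sum_mul_sum, ← Fintype.sum_prod_type']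
      rw [← (Equiv.sumArrowEquivProdArrow (Fin n) (Fin m) (Fin 2)).symm.sum_comp]
      refine Finset.sum_congr rfl fun p _ => ?_
      simp [Equiv.sumArrowEquivProdArrow, mul_pow]
    rw [sim, DTree.expect, expect, normSq_frameOp, hp, hk, one_mul]
  | rot R A ih =>
    rw [sim, expect, ih (c.1, R :: c.2) φ (hc.frame _) hφ, Matrix.mulVec_mulVec]
    rfl
  | meas M A ih =>
    exact expect_simMeas w M _ (fun s => (A s).expect w) (fun s a v => expect_smul w (A s) a v)
      (fun s c φ hc hφ => ih s c φ hc hφ) c φ hc hφ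

/-- The configuration at the start. -/
def Config.init (n m : ℕ) : Config n m := (List.ofFn (zRow n m), [])

theorem Config.valid_init : (Config.init n m).Valid where
  comm := by
    intro g hg h hh
    obtain ⟨i, rfl⟩ := List.mem_ofFn.1 hg
    obtain ⟨j, rfl⟩ := List.mem_ofFn.1 hh
    rw [anti_zRow]
    simp only [zRow]
    split_ifs <;> rfl
  echelon := by
    refine List.pairwise_ofFn.2 fun i j hij => ?_
    rw [hits_zRow]
    simp [zRow, hij.ne', Pauli.bits]
  ne := by
    intro g hg
    obtain ⟨i, rfl⟩ := List.mem_ofFn.1 hg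
    intro h
    simpa [zRow] using congrFun h (.inl i)
  zmem q := List.mem_ofFn.2 ⟨q, rfl⟩

end Correctness

/-! ## Single-qubit operators -/

section SingleQubit

variable {ι : Type*} [Fintype ι] [DecidableEq ι]

/-- The operator `U` on the qubit `q`. -/
def atQubit (q : ι) (U : Matrix (Fin 2) (Fin 2) ℂ) : Matrix (ι → Fin 2) (ι → Fin 2) ℂ :=
  tensor fun j => if j = q then U else 1

theorem atQubit_apply (q : ι) (U : Matrix (Fin 2) (Fin 2) ℂ) (x y : ι → Fin 2) :
    atQubit q U x y = if ∀ j, j ≠ q → x j = y j then U (x q) (y q) else 0 := by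
  rw [atQubit, tensor]
  split_ifs with h
  · rw [Finset.prod_eq_single q]
    · simp
    · intro j _ hj
      rw [if_neg hj, h j hj, Matrix.one_apply_eq]
    · simp
  · push Not at h
    obtain ⟨j, hj, hxy⟩ := h
    exact Finset.prod_eq_zero (Finset.mem_univ j) (by simp [hj, hxy])

theorem onQubit_eq_atQubit {n : ℕ} (q : Fin n) (U : Matrix (Fin 2) (Fin 2) ℂ) :
    onQubit q U = atQubit q U := by
  ext x y
  rw [atQubit_apply, onQubit]
  by_cases h : ∀ j, j ≠ q → x j = y j
  · rw [if_pos h, if_pos h]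
  · rw [if_neg h, if_neg h]

theorem atQubit_mulVec (q : ι) (U : Matrix (Fin 2) (Fin 2) ℂ) (ψ : (ι → Fin 2) → ℂ)
    (x : ι → Fin 2) : (atQubit q U *ᵥ ψ) x = ∑ b, U (x q) b * ψ (Function.update x q b) := by
  rw [Matrix.mulVec, dotProduct]
  symm
  refine Finset.sum_of_injOn (fun b => Function.update x q b)
    (fun a _ b _ h => by simpa using congrFun h q) (fun _ _ => by simp) (fun y _ hy => ?_)
    (fun b _ => ?_)
  · rw [atQubit_apply, if_neg, zero_mul]
    intro h
    refine hy ⟨y q, by simp, funext fun j => ?_⟩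
    by_cases hj : j = q
    · subst hj; simp
    · simp [hj, h j hj]
  · rw [atQubit_apply, if_pos]
    · simp
    · intro j hj; simp [hj]

theorem atQubit_mul (q : ι) (U V : Matrix (Fin 2) (Fin 2) ℂ) :
    atQubit q U * atQubit q V = atQubit q (U * V) := by
  rw [atQubit, atQubit, tensor_mul, atQubit]
  congr 1
  funext j
  split_ifs <;> simp

theorem atQubit_one (q : ι) : atQubit q (1 : Matrix (Fin 2) (Fin 2) ℂ) = 1 := by
  rw [atQubit, ← tensor_one]
  simp

theorem atQubit_smul (q : ι) (c : ℂ) (U : Matrix (Fin 2) (Fin 2) ℂ) :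
    atQubit q (c • U) = c • atQubit q U := by
  ext x y
  simp [atQubit_apply]

theorem atQubit_sub (q : ι) (U V : Matrix (Fin 2) (Fin 2) ℂ) :
    atQubit q (U - V) = atQubit q U - atQubit q V := by
  ext x y
  simp only [atQubit_apply, Matrix.sub_apply]
  split_ifs <;> simp

/-- The Pauli operator with label `a` on the qubit `q`. -/
def SignedPauli.single (q : ι) (a : Pauli) : SignedPauli ι := (1, fun j => if j = q then a else .I)

theorem SignedPauli.mat_single (q : ι) (a : Pauli) : (single q a).mat = atQubit q a.matrix := by
  have : (fun j => ((single q a).2 j).matrix) = fun j => if j = q then a.matrix else 1 := by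
    funext j
    simp only [single]
    split_ifs
    · rfl
    · exact Pauli.matrix_I
  rw [mat, this, atQubit]
  simp [single]

theorem SignedPauli.rot_single (q : ι) (a : Pauli) : (single q a).rot =
    atQubit q ((1 / (Real.sqrt 2 : ℂ)) • (1 - Complex.I • a.matrix)) := by
  rw [rot, mat_single, atQubit_smul, atQubit_sub, atQubit_smul, atQubit_one]

end SingleQubit

/-! ## Compilation of circuits to adaptive programs -/

section Compile

variable {n m : ℕ}

/-- The bit that belongs to an eigenvalue. -/
def signBit (s : ℤˣ) : Fin 2 := if s = 1 then 0 else 1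

/-- The operator with label `a` on the qubit `q` and label `b` on the qubit `t`. -/
def pairRow (m : ℕ) (q t : Fin n) (a b : Pauli) : SignedPauli (Fin n ⊕ Fin m) :=
  (-1, fun j => if j = .inl q then a else if j = .inl t then b else .I)

/-- The operator with label `Z` on the qubit `q` and label `b` on the ancilla `j`. -/
def gadgetRow (m : ℕ) (q : Fin n) (j : ℕ) (b : Pauli) : SignedPauli (Fin n ⊕ Fin m) :=
  (1, Sum.elim (fun p => if p = q then .Z else .I) (fun p => if p.val = j then b else .I))

/-- The measurement of the qubits in the list in the computational basis. -/
def readout : List (Fin n) → (Fin n → Fin 2) → AProg n m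
  | [], x => .done x
  | q :: l, x => .meas (.single (.inl q) .Z) fun s => readout l (Function.update x q (signBit s))

/-- The adaptive program for a circuit that uses the ancillas starting with the number `j`. -/
def compile : Circuit n → ℕ → AProg n m
  | [], _ => readout (List.finRange n) 0
  | .H q :: l, j => .rot (.single (.inl q) .Z) (.rot (.single (.inl q) .X)
      (.rot (.single (.inl q) .Z) (compile l j)))
  | .S q :: l, j => .rot (.single (.inl q) .Z) (compile l j)
  | .CNOT c t _ :: l, j => .rot (.single (.inl c) .Z) (.rot (.single (.inl t) .X)
      (.rot (pairRow m c t .Z .X) (compile l j)))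
  | .T q :: l, j => .meas (gadgetRow m q j .Y) fun s => .rot (.scale s (gadgetRow m q j .X))
      (if s = 1 then compile l (j + 1) else .rot (.single (.inl q) .Z) (compile l (j + 1)))

theorem depthLe_readout (l : List (Fin n)) (x : Fin n → Fin 2) (d : ℕ) (h : l.length ≤ d) :
    (readout (m := m) l x).DepthLe d := by
  induction l generalizing x d with
  | nil => trivial
  | cons q l ih =>
    simp only [List.length_cons] at h
    exact ⟨d - 1, by omega, fun s => ih _ _ (by omega)⟩

theorem depthLe_compile (C : Circuit n) (j d : ℕ) (h : n + C.length ≤ d) :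
    (compile (m := m) C j).DepthLe d := by
  induction C generalizing j d with
  | nil => exact depthLe_readout _ _ _ (by simpa using h)
  | cons g l ih =>
    simp only [List.length_cons] at h
    cases g with
    | H q => exact ih j d (by omega)
    | S q => exact ih j d (by omega)
    | CNOT c t _ => exact ih j d (by omega)
    | T q =>
      refine ⟨d - 1, by omega, fun s => ?_⟩
      have := ih (j + 1) (d - 1) (by omega)
      change AProg.DepthLe (if s = 1 then _ else _) _
      split_ifs
      · exact this
      · exact this

theorem single_inl_eq (q : Fin n) (a : Pauli) : (SignedPauli.single (.inl q) a :
    SignedPauli (Fin n ⊕ Fin m)) = (1, Sum.elim (SignedPauli.single q a).2 fun _ => .I) := by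
  refine Prod.ext rfl (funext fun j => ?_)
  rcases j with j | j <;> simp [SignedPauli.single]

theorem mat_mulVec_prodVec (s : ℤˣ) (f : Fin n → Pauli) (g : Fin m → Pauli) (χ : QVec n)
    (φ : QVec m) : SignedPauli.mat (ι := Fin n ⊕ Fin m) (s, Sum.elim f g) *ᵥ prodVec χ φ =
      prodVec (SignedPauli.mat (s, f) *ᵥ χ) (SignedPauli.mat (1, g) *ᵥ φ) := by
  simp only [SignedPauli.mat, Matrix.smul_mulVec, tensor_mulVec_prodVec, prodVec_smul_left,
    Units.val_one, Int.cast_one, one_smul]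
  rfl

theorem prodVec_sub_left (χ χ' : QVec n) (φ : QVec m) :
    prodVec (χ - χ') φ = prodVec χ φ - prodVec χ' φ := by
  funext z; simp [prodVec, sub_mul]

theorem rot_mulVec_prodVec (s : ℤˣ) (f : Fin n → Pauli) (χ : QVec n) (φ : QVec m) :
    SignedPauli.rot (ι := Fin n ⊕ Fin m) (s, Sum.elim f fun _ => .I) *ᵥ prodVec χ φ =
      prodVec (SignedPauli.rot (s, f) *ᵥ χ) φ := by
  have : SignedPauli.mat (1, fun _ : Fin m => Pauli.I) = 1 := by
    simp [SignedPauli.mat, tensor_I]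
  simp only [SignedPauli.rot, Matrix.smul_mulVec, Matrix.sub_mulVec, Matrix.one_mulVec,
    mat_mulVec_prodVec, this, prodVec_smul_left, prodVec_sub_left]

theorem rot_single_mulVec (q : Fin n) (a : Pauli) (χ : QVec n) (φ : QVec m) :
    (SignedPauli.single (.inl q) a).rot *ᵥ prodVec χ φ =
      prodVec ((SignedPauli.single q a).rot *ᵥ χ) φ := by
  rw [single_inl_eq, rot_mulVec_prodVec]
  rfl

theorem norm_one_sub_I_div_sqrt_two : ‖(1 - Complex.I) / (Real.sqrt 2 : ℂ)‖ = 1 := by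
  have : ‖(1 - Complex.I)‖ ^ 2 = 2 := by
    rw [← Complex.normSq_eq_norm_sq]; simp [Complex.normSq_apply]; norm_num
  rw [norm_div, Complex.norm_real, Real.norm_eq_abs, abs_of_nonneg (Real.sqrt_nonneg 2),
    ← Real.sqrt_sq (norm_nonneg _), this]
  exact div_self (by positivity)

theorem inv_sqrt_two_pow_three : (Real.sqrt 2 : ℂ)⁻¹ ^ 3 = (1 / 2) * (Real.sqrt 2 : ℂ)⁻¹ := by
  have h := SignedPauli.sqrt_two_sq
  have h0 := SignedPauli.sqrt_two_ne
  field_simp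
  linear_combination -h

theorem rot_S (q : Fin n) : (SignedPauli.single q .Z).rot =
    ((1 - Complex.I) / (Real.sqrt 2 : ℂ)) • (Gate.S q).matrix := by
  rw [SignedPauli.rot_single, Gate.matrix, onQubit_eq_atQubit, ← atQubit_smul]
  congr 1
  ext i j
  fin_cases i <;> fin_cases j <;> simp [Pauli.matrix] <;> field_simp
  linear_combination Complex.I_mul_I

/-- This is the Euler decomposition of H into quarter turns about Z, X and Z, with global phase -i.
-/
theorem rot_H (q : Fin n) : (SignedPauli.single q .Z).rot * ((SignedPauli.single q .X).rot *
    (SignedPauli.single q .Z).rot) = (-Complex.I) • (Gate.H q).matrix := by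
  simp only [SignedPauli.rot_single, Gate.matrix, onQubit_eq_atQubit, ← atQubit_smul, atQubit_mul,
    Matrix.smul_mul, Matrix.mul_smul, smul_smul]
  congr 1
  ext i j
  fin_cases i <;> fin_cases j <;>
    simp [Pauli.matrix, Matrix.mul_apply, Fin.sum_univ_two] <;> ring_nf <;> simp <;> ring_nf <;>
    rw [inv_sqrt_two_pow_three] <;> ring

theorem cnot_mulVec (c t : Fin n) (h : c ≠ t) (ψ : QVec n) (x : Fin n → Fin 2) :
    ((Gate.CNOT c t h).matrix *ᵥ ψ) x = ψ (Function.update x t (x t + x c)) := by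
  have e : ∀ a b : Fin 2, a + b + b = a := by decide
  have key : ∀ y, x = Function.update y t (y t + y c) ↔ Function.update x t (x t + x c) = y := by
    intro y
    constructor
    · rintro rfl
      funext j
      by_cases hj : j = t
      · subst hj; simp [h, e]
      · simp [hj]
    · rintro rfl
      funext j
      by_cases hj : j = t
      · subst hj; simp [h, e]
      · simp [hj]
  simp only [Matrix.mulVec, dotProduct, Gate.matrix, key]
  simp

/-- This expands (1 + Z)/2 + ((1 - Z)/2) X, with Z on the control and X on the target; in this form
CNOT can be compared with a product of Pauli rotations. -/
theorem cnot_eq (c t : Fin n) (h : c ≠ t) : (Gate.CNOT c t h).matrix =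
    (1 / 2 : ℂ) • (1 + (SignedPauli.single c .Z).mat + (SignedPauli.single t .X).mat -
      (SignedPauli.single c .Z).mat * (SignedPauli.single t .X).mat) := by
  refine Matrix.ext_of_mulVec_single fun y => ?_
  generalize (Pi.single y 1 : QVec n) = ψ
  funext x
  rw [cnot_mulVec, Matrix.smul_mulVec, Matrix.sub_mulVec, Matrix.add_mulVec, Matrix.add_mulVec,
    Matrix.one_mulVec, ← Matrix.mulVec_mulVec]
  simp only [SignedPauli.mat_single, Pi.smul_apply, Pi.sub_apply, Pi.add_apply, atQubit_mulVec,
    Fin.sum_univ_two, Pauli.matrix]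
  have hxc : x c = 0 ∨ x c = 1 := by have := x c; omega
  have hxt : x t = 0 ∨ x t = 1 := by have := x t; omega
  have hu : ∀ q a, x q = a → Function.update x q a = x := fun q a ha => by rw [← ha]; simp
  rcases hxc with hc | hc <;> rcases hxt with ht | ht <;>
    simp [hc, ht, hu, h.symm] <;> ring

/-- With A = Z on the control and B = X on the target, A and B are commuting involutions, and
expanding the rotations about -AB, B and A gives (1 - i)(1 + A + B - AB) up to normalization. -/
theorem rot_CNOT (c t : Fin n) (h : c ≠ t) :
    SignedPauli.rot (-1, fun j => if j = c then .Z else if j = t then .X else .I) *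
      ((SignedPauli.single t .X).rot * (SignedPauli.single c .Z).rot) =
    ((1 - Complex.I) / (Real.sqrt 2 : ℂ)) • (Gate.CNOT c t h).matrix := by
  rw [cnot_eq]
  set A := (SignedPauli.single c .Z).mat with hA
  set B := (SignedPauli.single t .X).mat with hB
  have hAA : A * A = 1 := SignedPauli.mat_mul_self _
  have hBB : B * B = 1 := SignedPauli.mat_mul_self _
  have hcomm : B * A = A * B := by
    refine SignedPauli.commute_of_anti_eq_false ?_
    have e' : Pauli.I.phase .Z = 0 ∧ Pauli.X.phase .I = 0 ∧ Pauli.I.phase .I = 0 := by decide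
    have : strPhase (SignedPauli.single t .X).2 (SignedPauli.single c .Z).2 = 0 := by
      refine Finset.sum_eq_zero fun j _ => ?_
      simp only [SignedPauli.single]
      by_cases hj : j = t
      · have : j ≠ c := fun h' => h (h' ▸ hj)
        simp [hj, h.symm, e']
      · split_ifs <;> simp [e']
    rw [anti, this]
    decide
  have hAB : SignedPauli.mat (-1, fun j => if j = c then .Z else if j = t then .X else .I) =
      -(A * B) := by
    rw [hA, hB, SignedPauli.mat_single, SignedPauli.mat_single, atQubit, atQubit, tensor_mul,
      SignedPauli.mat]
    have : (fun j => (if j = c then Pauli.Z else if j = t then Pauli.X else Pauli.I).matrix) =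
        fun j => (if j = c then Pauli.Z.matrix else 1) * if j = t then Pauli.X.matrix else 1 := by
      funext j
      by_cases hj : j = c
      · subst hj; simp [h]
      · by_cases hj' : j = t <;> simp [hj, hj', h.symm, Pauli.matrix_I]
    rw [this]
    simp
  simp only [SignedPauli.rot, ← hA, ← hB, hAB, Matrix.smul_mul, Matrix.mul_smul, smul_smul]
  have h1 : A * B * A = B := by rw [mul_assoc, hcomm, ← mul_assoc, hAA, one_mul]
  have h2 : A * B * B = A := by rw [mul_assoc, hBB, mul_one]
  have h3 : A * B * (A * B) = 1 := by rw [← mul_assoc, h1, hBB]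
  have h4 : (1 - Complex.I • -(A * B)) * ((1 - Complex.I • B) * (1 - Complex.I • A)) =
      (1 - Complex.I) • (1 + A + B - A * B) := by
    have : (1 - Complex.I • B) * (1 - Complex.I • A) =
        1 - Complex.I • A - Complex.I • B - A * B := by
      simp only [sub_mul, mul_sub, one_mul, mul_one, Matrix.smul_mul, Matrix.mul_smul, smul_smul,
        hcomm, Complex.I_mul_I, neg_smul, one_smul]
      abel
    rw [this]
    simp only [smul_neg, sub_neg_eq_add, add_mul, one_mul, mul_sub, mul_one, Matrix.smul_mul,
      Matrix.mul_smul, smul_smul, h1, h2, h3, Complex.I_mul_I, neg_smul, one_smul]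
    module
  rw [h4, smul_smul]
  congr 1
  have := inv_sqrt_two_pow_three
  simp only [div_eq_mul_inv] at this ⊢
  linear_combination (1 - Complex.I) * this

end Compile

section Semantics

variable {n m : ℕ}

/-! ## The T gadget -/

/-- The state of the ancillas when the first `j` of them have been used. -/
noncomputable def ancillas (m j : ℕ) : QVec m := fun y => ∏ a : Fin m,
  (if a.val < j then ![1, 0]
    else ![(Real.cos (Real.pi / 8) : ℂ), (Real.sin (Real.pi / 8) : ℂ)]) (y a)

theorem ancillas_zero (m : ℕ) : ancillas m 0 = magicState m := by
  funext y; simp [ancillas, magicState]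

theorem normSq_ancillas (m j : ℕ) : normSq (ancillas m j) = 1 := by
  have h : ∀ a : Fin m, ∑ b : Fin 2, ‖(if a.val < j then ![1, 0]
    else ![(Real.cos (Real.pi / 8) : ℂ), (Real.sin (Real.pi / 8) : ℂ)]) b‖ ^ 2 = 1 := by
    intro a
    split_ifs
    · simp
    · simp only [Fin.sum_univ_two, Matrix.cons_val_zero, Matrix.cons_val_one,
        Complex.norm_real, Real.norm_eq_abs, sq_abs]
      exact Real.cos_sq_add_sin_sq _
  simp only [normSq, ancillas, norm_prod, ← Finset.prod_pow]
  rw [← Fintype.piFinset_univ, ← Finset.prod_univ_sum (fun _ => Finset.univ)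
    (fun (a : Fin m) (b : Fin 2) => ‖(if a.val < j then ![1, 0]
    else ![(Real.cos (Real.pi / 8) : ℂ), (Real.sin (Real.pi / 8) : ℂ)]) b‖ ^ 2)]
  exact Finset.prod_eq_one fun a _ => h a

/-- The ancilla state with one more used ancilla, which is moreover flipped. -/
theorem ancillas_eq (m : ℕ) (j : Fin m) : ancillas m j =
    (Real.cos (Real.pi / 8) : ℂ) • ancillas m (j + 1) + (Real.sin (Real.pi / 8) : ℂ) •
      (atQubit j Pauli.X.matrix *ᵥ ancillas m (j + 1)) := by
  have key : ∀ (k : ℕ) (y : Fin m → Fin 2), ancillas m k y =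
      (if j.val < k then ![1, 0]
        else ![(Real.cos (Real.pi / 8) : ℂ), (Real.sin (Real.pi / 8) : ℂ)]) (y j) *
      ∏ a ∈ Finset.univ.erase j, (if a.val < k then ![1, 0]
        else ![(Real.cos (Real.pi / 8) : ℂ), (Real.sin (Real.pi / 8) : ℂ)]) (y a) :=
    fun k y => (Finset.mul_prod_erase _ _ (Finset.mem_univ j)).symm
  funext y
  simp only [Pi.add_apply, Pi.smul_apply, atQubit_mulVec, Fin.sum_univ_two, Pauli.matrix]
  have hr : ∀ (k : ℕ) (b : Fin 2), (k = j ∨ k = j + 1) →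
      ∏ a ∈ Finset.univ.erase j, (if a.val < k then ![1, 0]
        else ![(Real.cos (Real.pi / 8) : ℂ), (Real.sin (Real.pi / 8) : ℂ)])
          (Function.update y j b a) =
      ∏ a ∈ Finset.univ.erase j, (if a.val < (j : ℕ) then ![1, 0]
        else ![(Real.cos (Real.pi / 8) : ℂ), (Real.sin (Real.pi / 8) : ℂ)]) (y a) := by
    intro k b hk
    refine Finset.prod_congr rfl fun a ha => ?_
    have ha' := Finset.ne_of_mem_erase ha
    have hv : a.val ≠ j.val := fun h => ha' (Fin.ext h)
    have : a.val < k ↔ a.val < j.val := by omega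
    simp [ha', this]
  have hy : Function.update y j (y j) = y := by simp
  have h0 := key j y
  have h1 := key (j + 1) y
  have h2 := hr (j + 1) (y j) (.inr rfl)
  rw [hy] at h2
  rw [h0, h1, h2, key (j + 1) (Function.update y j 0), key (j + 1) (Function.update y j 1),
    hr (j + 1) 0 (.inr rfl), hr (j + 1) 1 (.inr rfl)]
  have hb : y j = 0 ∨ y j = 1 := by have := y j; omega
  rcases hb with hb | hb <;> simp [hb]

theorem prodVec_add_left (χ χ' : QVec n) (φ : QVec m) :
    prodVec (χ + χ') φ = prodVec χ φ + prodVec χ' φ := by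
  funext z; simp [prodVec, add_mul]

theorem gadgetRow_mulVec (q : Fin n) (j : Fin m) (b : Pauli) (χ : QVec n) (φ : QVec m) :
    (gadgetRow m q j b).mat *ᵥ prodVec χ φ =
      prodVec (atQubit q Pauli.Z.matrix *ᵥ χ) (atQubit j b.matrix *ᵥ φ) := by
  have h : (gadgetRow m q j b) = (1, Sum.elim (SignedPauli.single q .Z).2
      (SignedPauli.single j b).2) := by
    simp only [gadgetRow, SignedPauli.single, Fin.ext_iff]
  rw [h, mat_mulVec_prodVec, ← SignedPauli.mat_single, ← SignedPauli.mat_single]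
  rfl

/-- The ancilla `j` has already been reset to |0⟩ in this state, and Y|0⟩ = i X|0⟩. -/
theorem atQubit_Y_mulVec (j : Fin m) : atQubit j Pauli.Y.matrix *ᵥ ancillas m (j + 1) =
    Complex.I • (atQubit j Pauli.X.matrix *ᵥ ancillas m (j + 1)) := by
  have h1 : ∀ y, y j = 1 → ancillas m (j + 1) y = 0 := fun y hy =>
    Finset.prod_eq_zero (Finset.mem_univ j) (by simp [hy])
  funext y
  simp only [Pi.smul_apply, atQubit_mulVec, Fin.sum_univ_two, Pauli.matrix]
  have hb : y j = 0 ∨ y j = 1 := by have := y j; omega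
  rcases hb with hb | hb <;> simp [hb, h1]

/-- The measurement entangles qubit and ancilla, and the rotation disentangles them: the ancilla
ends in |0⟩ and the qubit undergoes exp(-iπsZ/8). The scalar 1/√2 for both signs shows that the
outcome is unbiased. -/
theorem gadget_mulVec (q : Fin n) (j : Fin m) (s : ℤˣ) (χ : QVec n) :
    (SignedPauli.scale s (gadgetRow m q j .X)).rot *ᵥ ((gadgetRow m q j .Y).proj s *ᵥ
      prodVec χ (ancillas m j)) = (1 / (Real.sqrt 2 : ℂ)) • prodVec
        ((Real.cos (Real.pi / 8) : ℂ) • χ - (((s : ℤ) : ℂ) * Complex.I *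
          (Real.sin (Real.pi / 8) : ℂ)) • (atQubit q Pauli.Z.matrix *ᵥ χ)) (ancillas m (j + 1)) := by
  have hXX : Pauli.X.matrix * Pauli.X.matrix = 1 := by
    simp [Pauli.matrix, Matrix.one_fin_two]
  have hZZ : Pauli.Z.matrix * Pauli.Z.matrix = 1 := by
    simp [Pauli.matrix, Matrix.one_fin_two]
  have hYX : Pauli.Y.matrix * Pauli.X.matrix = (-1 : ℂ) • (Pauli.X.matrix * Pauli.Y.matrix) := by
    simp [Pauli.matrix]
  set φ := ancillas m (j + 1) with hφ
  set η := atQubit j Pauli.X.matrix *ᵥ φ with hη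
  set P := atQubit q Pauli.Z.matrix with hP
  have hPP : P *ᵥ (P *ᵥ χ) = χ := by
    rw [Matrix.mulVec_mulVec, hP, atQubit_mul, hZZ, atQubit_one, Matrix.one_mulVec]
  have hYφ : atQubit j Pauli.Y.matrix *ᵥ φ = Complex.I • η := atQubit_Y_mulVec j
  have hXη : atQubit j Pauli.X.matrix *ᵥ η = φ := by
    rw [hη, Matrix.mulVec_mulVec, atQubit_mul, hXX, atQubit_one, Matrix.one_mulVec]
  have hYη : atQubit j Pauli.Y.matrix *ᵥ η = -(Complex.I • φ) := by
    rw [hη, Matrix.mulVec_mulVec, atQubit_mul, hYX, atQubit_smul, ← atQubit_mul,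
      Matrix.smul_mulVec, ← Matrix.mulVec_mulVec, hYφ, Matrix.mulVec_smul, hXη]
    simp
  have hs : ((s : ℤ) : ℂ) * ((s : ℤ) : ℂ) = 1 := by
    rcases Int.units_eq_one_or s with rfl | rfl <;> simp
  -- The projected state is split along the ancilla states |0⟩ and |1⟩, represented by `φ` and `η`;
  -- the rotation then merges both parts into the first.
  have hv : (gadgetRow m q j .Y).proj s *ᵥ prodVec χ (ancillas m j) = (1 / 2 : ℂ) •
      (prodVec ((Real.cos (Real.pi / 8) : ℂ) • χ - (((s : ℤ) : ℂ) * Complex.I *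
          (Real.sin (Real.pi / 8) : ℂ)) • (P *ᵥ χ)) φ +
        prodVec ((Real.sin (Real.pi / 8) : ℂ) • χ + (((s : ℤ) : ℂ) * Complex.I *
          (Real.cos (Real.pi / 8) : ℂ)) • (P *ᵥ χ)) η) := by
    rw [SignedPauli.proj_mulVec, ancillas_eq, prodVec_add_right, prodVec_smul_right,
      prodVec_smul_right, Matrix.mulVec_add, Matrix.mulVec_smul, Matrix.mulVec_smul,
      gadgetRow_mulVec, gadgetRow_mulVec, hYφ, hYη, prodVec_smul_right, ← neg_smul,
      prodVec_smul_right, prodVec_sub_left, prodVec_add_left]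
    simp only [prodVec_smul_left]
    module
  have hPv : ∀ a b : ℂ, P *ᵥ (a • χ + b • (P *ᵥ χ)) = a • (P *ᵥ χ) + b • χ := fun a b => by
    rw [Matrix.mulVec_add, Matrix.mulVec_smul, Matrix.mulVec_smul, hPP]
  have hPv' : ∀ a b : ℂ, P *ᵥ (a • χ - b • (P *ᵥ χ)) = a • (P *ᵥ χ) - b • χ := fun a b => by
    rw [Matrix.mulVec_sub, Matrix.mulVec_smul, Matrix.mulVec_smul, hPP]
  rw [hv, SignedPauli.rot, SignedPauli.mat_scale, Matrix.smul_mulVec, Matrix.sub_mulVec,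
    Matrix.one_mulVec, Matrix.smul_mulVec, Matrix.smul_mulVec, Matrix.mulVec_smul,
    Matrix.mulVec_add, gadgetRow_mulVec, gadgetRow_mulVec, hXη, ← hη, hPv, hPv']
  congr 1
  simp only [prodVec_add_left, prodVec_sub_left, prodVec_smul_left]
  have hI := Complex.I_mul_I
  generalize (Real.cos (Real.pi / 8) : ℂ) = C
  generalize (Real.sin (Real.pi / 8) : ℂ) = S
  rcases Int.units_eq_one_or s with rfl | rfl <;>
    simp only [Units.val_one, Units.val_neg, Int.cast_neg, Int.cast_one, neg_mul, one_mul,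
      smul_add, smul_sub, smul_smul] <;>
    match_scalars <;>
    first
      | ring1
      | linear_combination (-1 / 2) * C * hI
      | linear_combination (1 / 2) * S * hI

/-! ## The compiled program samples the outcomes of the circuit -/

theorem exp_pi_div_eight : (Real.cos (Real.pi / 8) : ℂ) + (Real.sin (Real.pi / 8) : ℂ) * Complex.I =
    Complex.exp (Complex.I * (Real.pi : ℂ) / 8) := by
  rw [show Complex.I * (Real.pi : ℂ) / 8 = ((Real.pi / 8 : ℝ) : ℂ) * Complex.I by push_cast; ring,
    Complex.exp_mul_I, Complex.ofReal_cos, Complex.ofReal_sin]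

theorem exp_neg_pi_div_eight : (Real.cos (Real.pi / 8) : ℂ) -
    (Real.sin (Real.pi / 8) : ℂ) * Complex.I = Complex.exp (-(Complex.I * (Real.pi : ℂ) / 8)) := by
  rw [show -(Complex.I * (Real.pi : ℂ) / 8) = ((-(Real.pi / 8) : ℝ) : ℂ) * Complex.I by
    push_cast; ring, Complex.exp_mul_I, ← Complex.ofReal_cos, ← Complex.ofReal_sin, Real.cos_neg,
    Real.sin_neg]
  push_cast
  ring

theorem exp_neg_pi_div_four : (1 - Complex.I) / (Real.sqrt 2 : ℂ) =
    Complex.exp (-(Complex.I * (Real.pi : ℂ) / 4)) := by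
  rw [show -(Complex.I * (Real.pi : ℂ) / 4) = ((-(Real.pi / 4) : ℝ) : ℂ) * Complex.I by
    push_cast; ring, Complex.exp_mul_I, ← Complex.ofReal_cos, ← Complex.ofReal_sin, Real.cos_neg,
    Real.sin_neg, Real.cos_pi_div_four, Real.sin_pi_div_four]
  have h := SignedPauli.sqrt_two_sq
  have h0 := SignedPauli.sqrt_two_ne
  push_cast
  field_simp
  linear_combination (Complex.I - 1) * h

theorem rot_T (q : Fin n) (χ : QVec n) :
    (Real.cos (Real.pi / 8) : ℂ) • χ - (Complex.I * (Real.sin (Real.pi / 8) : ℂ)) •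
        (atQubit q Pauli.Z.matrix *ᵥ χ) =
      Complex.exp (-(Complex.I * (Real.pi : ℂ) / 8)) • ((Gate.T q).matrix *ᵥ χ) := by
  have h : Complex.exp (-(Complex.I * (Real.pi : ℂ) / 8)) •
      !![1, 0; 0, Complex.exp (Complex.I * (Real.pi : ℂ) / 4)] =
      (Real.cos (Real.pi / 8) : ℂ) • (1 : Matrix (Fin 2) (Fin 2) ℂ) -
        (Complex.I * (Real.sin (Real.pi / 8) : ℂ)) • Pauli.Z.matrix := by
    have e : Complex.exp (-(Complex.I * (Real.pi : ℂ) / 8)) *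
        Complex.exp (Complex.I * (Real.pi : ℂ) / 4) = Complex.exp (Complex.I * Real.pi / 8) := by
      rw [← Complex.exp_add]; congr 1; ring
    have h1 := exp_pi_div_eight
    have h2 := exp_neg_pi_div_eight
    generalize (Real.cos (Real.pi / 8) : ℂ) = C at *
    generalize (Real.sin (Real.pi / 8) : ℂ) = S at *
    ext i j
    fin_cases i <;> fin_cases j <;> simp [Pauli.matrix]
    · rw [← h2]; ring
    · rw [e, ← h1]; ring
  have h' : ∀ (a : ℂ) (A : Matrix (Fin 2) (Fin 2) ℂ),
      a • (atQubit q A *ᵥ χ) = atQubit q (a • A) *ᵥ χ := fun a A => by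
    rw [atQubit_smul, Matrix.smul_mulVec]
  rw [Gate.matrix, onQubit_eq_atQubit, h', h', h, atQubit_sub, Matrix.sub_mulVec]
  congr 1
  rw [atQubit_smul, atQubit_one, Matrix.smul_mulVec, Matrix.one_mulVec]

/-- For the outcome -1 the gadget has applied exp(iπZ/8) instead of exp(-iπZ/8); the rotation
exp(-iπZ/4) makes up the difference. -/
theorem rot_T_neg (q : Fin n) (χ : QVec n) :
    (SignedPauli.single q .Z).rot *ᵥ ((Real.cos (Real.pi / 8) : ℂ) • χ +
        (Complex.I * (Real.sin (Real.pi / 8) : ℂ)) • (atQubit q Pauli.Z.matrix *ᵥ χ)) =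
      Complex.exp (-(Complex.I * (Real.pi : ℂ) / 8)) • ((Gate.T q).matrix *ᵥ χ) := by
  have h1 := exp_pi_div_eight
  have h2 := exp_neg_pi_div_eight
  have h3 : (1 - Complex.I) / (Real.sqrt 2 : ℂ) * Complex.exp (Complex.I * (Real.pi : ℂ) / 8) =
      Complex.exp (-(Complex.I * (Real.pi : ℂ) / 8)) := by
    rw [exp_neg_pi_div_four, ← Complex.exp_add]; congr 1; ring
  have h4 : (1 + Complex.I) / (Real.sqrt 2 : ℂ) * Complex.exp (-(Complex.I * (Real.pi : ℂ) / 8)) =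
      Complex.exp (Complex.I * (Real.pi : ℂ) / 8) := by
    have hne := Complex.exp_ne_zero (Complex.I * (Real.pi : ℂ) / 8)
    have h5 : (1 + Complex.I) / (Real.sqrt 2 : ℂ) * ((1 - Complex.I) / (Real.sqrt 2 : ℂ)) = 1 := by
      rw [div_mul_div_comm, SignedPauli.sqrt_two_sq]
      linear_combination (-1 / 2 : ℂ) * Complex.I_mul_I
    rw [← h3, ← mul_assoc, h5, one_mul]
  rw [← rot_T]
  have hZZ : Pauli.Z.matrix * Pauli.Z.matrix = 1 := by
    simp [Pauli.matrix, Matrix.one_fin_two]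
  rw [SignedPauli.rot, SignedPauli.mat_single, Matrix.smul_mulVec, Matrix.sub_mulVec,
    Matrix.one_mulVec, Matrix.smul_mulVec, Matrix.mulVec_add, Matrix.mulVec_smul,
    Matrix.mulVec_smul, Matrix.mulVec_mulVec, atQubit_mul, hZZ, atQubit_one, Matrix.one_mulVec]
  rw [← h1, ← h2] at h3 h4
  generalize (Real.cos (Real.pi / 8) : ℂ) = C at *
  generalize (Real.sin (Real.pi / 8) : ℂ) = S at *
  rw [div_eq_mul_inv] at h3 h4
  generalize (Real.sqrt 2 : ℂ) = R at *
  have hI := Complex.I_mul_I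
  match_scalars
  -- `h3` and `h4` are the identities on the eigenspaces of Z for 1 and -1; the coefficients of `χ`
  -- and of Z applied to `χ` are their half sum and half difference.
  · linear_combination (1 / 2) * h3 + (1 / 2) * h4
  · linear_combination (1 / 2) * h3 - (1 / 2) * h4

/-- The hypothesis says that the qubits no longer in the list have collapsed to the bits recorded in
`x`. It is vacuous when all qubits are still to be read, and at the end it makes the recorded string
the only one in the support. -/
theorem expect_readout (w : (Fin n → Fin 2) → ℝ) (l : List (Fin n)) (x : Fin n → Fin 2)
    (Θ : SVec n m) (h : ∀ z, Θ z ≠ 0 → ∀ q, q ∉ l → z (.inl q) = x q) :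
    (readout l x).expect w Θ = ∑ z, w (z ∘ .inl) * ‖Θ z‖ ^ 2 := by
  induction l generalizing x Θ with
  | nil =>
    rw [readout, AProg.expect, normSq, Finset.mul_sum]
    refine Finset.sum_congr rfl fun z _ => ?_
    by_cases hz : Θ z = 0
    · simp [hz]
    · rw [show z ∘ .inl = x from funext fun q => h z hz q (by simp)]
  | cons q l ih =>
    have hproj : ∀ s z, ((SignedPauli.single (Sum.inl q) Pauli.Z : SignedPauli (Fin n ⊕ Fin m)).proj
        s *ᵥ Θ) z = if z (.inl q) = signBit s then Θ z else 0 := by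
      intro s z
      rw [SignedPauli.proj_mulVec, SignedPauli.mat_single]
      simp only [Pi.smul_apply, Pi.add_apply, atQubit_mulVec, Fin.sum_univ_two, Pauli.matrix]
      have hu : ∀ b, z (.inl q) = b → Function.update z (.inl q) b = z := fun b hb => by
        rw [← hb]; simp
      have hb : z (.inl q) = 0 ∨ z (.inl q) = 1 := by have := z (.inl q); omega
      have hs : signBit 1 = 0 ∧ signBit (-1) = 1 := by decide
      rcases Int.units_eq_one_or s with rfl | rfl <;> rcases hb with hb | hb <;>
        simp [hb, hu, hs] <;> ring
    have hs : ∀ s, (readout l (Function.update x q (signBit s))).expect w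
        ((SignedPauli.single (Sum.inl q) Pauli.Z : SignedPauli (Fin n ⊕ Fin m)).proj s *ᵥ Θ) =
        ∑ z, if z (.inl q) = signBit s then w (z ∘ .inl) * ‖Θ z‖ ^ 2 else 0 := by
      intro s
      rw [ih]
      · refine Finset.sum_congr rfl fun z _ => ?_
        rw [hproj]
        split_ifs <;> simp
      · intro z hz p hp
        rw [hproj] at hz
        split_ifs at hz with hzq
        · by_cases hpq : p = q
          · subst hpq; simpa using hzq
          · simpa [hpq] using h z hz p (by simp [hpq, hp])
        · exact absurd rfl hz
    rw [readout, AProg.expect]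
    simp only [hs]
    rw [Finset.sum_comm]
    refine Finset.sum_congr rfl fun z _ => ?_
    have hb : z (.inl q) = 0 ∨ z (.inl q) = 1 := by have := z (.inl q); omega
    have hs : signBit 1 = 0 ∧ signBit (-1) = 1 := by decide
    rw [sum_units, hs.1, hs.2]
    rcases hb with hb | hb <;> simp [hb]

theorem expect_prodVec_smul (w : (Fin n → Fin 2) → ℝ) (A : AProg n m) {c : ℂ} (hc : ‖c‖ = 1)
    (χ : QVec n) (φ : QVec m) :
    A.expect w (prodVec (c • χ) φ) = A.expect w (prodVec χ φ) := by
  rw [prodVec_smul_left, AProg.expect_smul, hc, one_pow, one_mul]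

theorem pairRow_eq (c t : Fin n) : pairRow m c t .Z .X =
    (-1, Sum.elim (fun j => if j = c then .Z else if j = t then .X else .I) fun _ => .I) := by
  refine Prod.ext rfl (funext fun j => ?_)
  rcases j with j | j <;> simp [pairRow]

/-- The induction runs over an arbitrary state of the circuit qubits in product with ancillas of
which the first `j` are used up; each T gate restores this product form with `j + 1`. -/
theorem expect_compile (w : (Fin n → Fin 2) → ℝ) (C : Circuit n) (j : ℕ) (hj : j + C.tCount ≤ m)
    (χ : QVec n) : (compile (m := m) C j).expect w (prodVec χ (ancillas m j)) =
      ∑ x, w x * ‖C.foldl (fun ψ g => g.matrix *ᵥ ψ) χ x‖ ^ 2 := by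
  induction C generalizing j χ with
  | nil =>
    rw [compile, expect_readout _ _ _ _ (fun z _ q hq => by simp at hq),
      ← (Equiv.sumArrowEquivProdArrow (Fin n) (Fin m) (Fin 2)).symm.sum_comp,
      Fintype.sum_prod_type]
    refine Finset.sum_congr rfl fun x _ => ?_
    have : ∀ y, w ((Equiv.sumArrowEquivProdArrow (Fin n) (Fin m) (Fin 2)).symm (x, y) ∘ .inl) *
        ‖prodVec χ (ancillas m j) ((Equiv.sumArrowEquivProdArrow (Fin n) (Fin m) (Fin 2)).symm
          (x, y))‖ ^ 2 = w x * ‖χ x‖ ^ 2 * ‖ancillas m j y‖ ^ 2 := fun y => by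
      simp [Equiv.sumArrowEquivProdArrow, prodVec, mul_pow, mul_assoc]
    simp only [this]
    rw [← Finset.mul_sum]
    have h1 := normSq_ancillas m j
    rw [normSq] at h1
    rw [h1, mul_one]
    rfl
  | cons g l ih =>
    rw [List.foldl_cons]
    cases g with
    | H q =>
      have hl : j + Circuit.tCount l ≤ m := by simpa [Circuit.tCount, Gate.isT] using hj
      rw [compile, AProg.expect, AProg.expect, AProg.expect, rot_single_mulVec, rot_single_mulVec,
        rot_single_mulVec, ← ih j hl, Matrix.mulVec_mulVec, Matrix.mulVec_mulVec, mul_assoc, rot_H,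
        Matrix.smul_mulVec, expect_prodVec_smul _ _ (by simp)]
    | S q =>
      have hl : j + Circuit.tCount l ≤ m := by simpa [Circuit.tCount, Gate.isT] using hj
      rw [compile, AProg.expect, rot_single_mulVec, ← ih j hl, rot_S,
        Matrix.smul_mulVec, expect_prodVec_smul _ _ norm_one_sub_I_div_sqrt_two]
    | CNOT c t h =>
      have hl : j + Circuit.tCount l ≤ m := by simpa [Circuit.tCount, Gate.isT] using hj
      rw [compile, AProg.expect, AProg.expect, AProg.expect, rot_single_mulVec, rot_single_mulVec,
        pairRow_eq, rot_mulVec_prodVec, ← ih j hl, Matrix.mulVec_mulVec, Matrix.mulVec_mulVec,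
        mul_assoc, rot_CNOT c t h, Matrix.smul_mulVec, expect_prodVec_smul _ _ norm_one_sub_I_div_sqrt_two]
    | T q =>
      have hl : j + (Circuit.tCount l + 1) ≤ m := by
        simpa [Circuit.tCount, Gate.isT, List.countP_cons] using hj
      obtain ⟨j, rfl⟩ : ∃ j' : Fin m, j = j' := ⟨⟨j, by omega⟩, rfl⟩
      have hc : ‖(1 / (Real.sqrt 2 : ℂ))‖ ^ 2 = 1 / 2 := by
        rw [norm_div, Complex.norm_real, Real.norm_eq_abs, div_pow, sq_abs,
          Real.sq_sqrt (by norm_num)]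
        simp
      have hexp : ‖Complex.exp (-(Complex.I * (Real.pi : ℂ) / 8))‖ = 1 := by
        rw [show -(Complex.I * (Real.pi : ℂ) / 8) = ((-(Real.pi / 8) : ℝ) : ℂ) * Complex.I by
          push_cast; ring, Complex.norm_exp_ofReal_mul_I]
      rw [← ih (j + 1) (by omega), compile, AProg.expect, sum_units]
      have h1 : ((-1 : ℤˣ) = 1) = False := by simp
      simp only [AProg.expect, h1, if_true, if_false]
      -- Both outcomes carry weight 1/2 and, after the correction, lead to the same state up to a
      -- phase, so the two halves add up to the value for the T gate.
      rw [gadget_mulVec, gadget_mulVec, Matrix.mulVec_smul, AProg.expect_smul, AProg.expect_smul,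
        hc, rot_single_mulVec]
      simp only [Units.val_one, Units.val_neg, Int.cast_one, Int.cast_neg, one_mul, neg_mul,
        neg_smul, sub_neg_eq_add]
      rw [rot_T, rot_T_neg, expect_prodVec_smul _ _ hexp]
      ring

end Semantics

/-! ## The simulation for given coin flips and eigenvalues -/

/-- The state of the simulation: the configuration, the unused coin flips and eigenvalues, and the
operators measured so far (the latest first). -/
abbrev RunState (n m : ℕ) : Type := Config n m × List Bool × List ℤˣ × List (PauliOp m)

section Run

variable {n m : ℕ}

/-- The simulation of a measurement. -/
def stepMeas (M : SignedPauli (Fin n ⊕ Fin m)) (st : RunState n m) : ℤˣ × RunState n m :=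
  match antiRow st.1.1 (pullBack st.1.2 M) with
  | some g =>
    (coinSign (st.2.1.headD false), (st.1.1, st.1.2 ++ [.scale (coinSign (st.2.1.headD false))
      (.hmul (pullBack st.1.2 M) g)]), st.2.1.tail, st.2.2)
  | none =>
    if (reduceBy st.1.1 (pullBack st.1.2 M)).2 = fun _ => .I then
      ((reduceBy st.1.1 (pullBack st.1.2 M)).1, st)
    else
      (st.2.2.1.headD 1, (.scale (st.2.2.1.headD 1) (reduceBy st.1.1 (pullBack st.1.2 M)) :: st.1.1,
        st.1.2), st.2.1, st.2.2.1.tail, ((reduceBy st.1.1 (pullBack st.1.2 M)).1,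
          (reduceBy st.1.1 (pullBack st.1.2 M)).2 ∘ .inr) :: st.2.2.2)

/-- The simulation of a rotation. -/
def stepRot (R : SignedPauli (Fin n ⊕ Fin m)) (st : RunState n m) : RunState n m :=
  ((st.1.1, R :: st.1.2), st.2)

/-- The simulation of an adaptive program. -/
def AProg.run : AProg n m → RunState n m → (Fin n → Fin 2) × RunState n m
  | .done x, st => (x, st)
  | .rot R k, st => run k (stepRot R st)
  | .meas M k, st => run (k (stepMeas M st).1) (stepMeas M st).2

/-- Following a branch of the tree is expressed as state passing, which can be programmed as a fold
over the gates. Operators are recorded by prepending, hence the reversal. -/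
theorem AProg.run_eq (A : AProg n m) (st : RunState n m) :
    (A.run st).1 = ((A.sim st.1).path st.2.1 st.2.2.1).2 ∧
      (A.run st).2.2.2.2 = ((A.sim st.1).path st.2.1 st.2.2.1).1.reverse ++ st.2.2.2 := by
  induction A generalizing st with
  | done x => simp [run, sim, DTree.path]
  | rot R A ih => exact ih (stepRot R st)
  | meas M A ih =>
    obtain ⟨h1, h2⟩ := ih (stepMeas M st).1 (stepMeas M st).2
    have key : ((sim (A (stepMeas M st).1) (stepMeas M st).2.1).path (stepMeas M st).2.2.1
          (stepMeas M st).2.2.2.1).2 = (((meas M A).sim st.1).path st.2.1 st.2.2.1).2 ∧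
        ((sim (A (stepMeas M st).1) (stepMeas M st).2.1).path (stepMeas M st).2.2.1
          (stepMeas M st).2.2.2.1).1.reverse ++ (stepMeas M st).2.2.2.2 =
        (((meas M A).sim st.1).path st.2.1 st.2.2.1).1.reverse ++ st.2.2.2 := by
      rcases hg : antiRow st.1.1 (pullBack st.1.2 M) with _ | g
      · simp only [sim, simMeas, stepMeas, hg]
        split_ifs with hI
        · exact ⟨rfl, rfl⟩
        · simp [DTree.path]
      · simp only [sim, simMeas, stepMeas, hg]
        exact ⟨rfl, rfl⟩
    rw [run, h1, h2]
    exact key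

/-- The simulation of the final measurement of the qubits in the list. -/
def stepReadout (q : Fin n) (s : (Fin n → Fin 2) × RunState n m) :
    (Fin n → Fin 2) × RunState n m :=
  (Function.update s.1 q (signBit (stepMeas (.single (.inl q) .Z) s.2).1),
    (stepMeas (.single (.inl q) .Z) s.2).2)

theorem run_readout (l : List (Fin n)) (x : Fin n → Fin 2) (st : RunState n m) :
    (readout l x).run st = l.foldl (fun s q => stepReadout q s) (x, st) := by
  induction l generalizing x st with
  | nil => rfl
  | cons q l ih => exact ih _ _

/-- The simulation of a gate, where the first component counts the ancillas used so far. -/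
def stepGate : Gate n → ℕ × RunState n m → ℕ × RunState n m
  | .H q, (j, st) => (j, stepRot (.single (.inl q) .Z) (stepRot (.single (.inl q) .X)
      (stepRot (.single (.inl q) .Z) st)))
  | .S q, (j, st) => (j, stepRot (.single (.inl q) .Z) st)
  | .CNOT c t _, (j, st) => (j, stepRot (pairRow m c t .Z .X) (stepRot (.single (.inl t) .X)
      (stepRot (.single (.inl c) .Z) st)))
  | .T q, (j, st) => (j + 1,
      if (stepMeas (gadgetRow m q j .Y) st).1 = 1 then
        stepRot (.scale (stepMeas (gadgetRow m q j .Y) st).1 (gadgetRow m q j .X))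
          (stepMeas (gadgetRow m q j .Y) st).2
      else stepRot (.single (.inl q) .Z)
        (stepRot (.scale (stepMeas (gadgetRow m q j .Y) st).1 (gadgetRow m q j .X))
          (stepMeas (gadgetRow m q j .Y) st).2))

theorem run_compile (C : Circuit n) (j : ℕ) (st : RunState n m) :
    (compile C j).run st = (List.finRange n).foldl (fun s q => stepReadout q s)
      (0, (C.foldl (fun s g => stepGate g s) (j, st)).2) := by
  induction C generalizing j st with
  | nil => exact run_readout _ _ _
  | cons g l ih =>
    rw [List.foldl_cons]
    cases g with
    | H q => exact ih _ _
    | S q => exact ih _ _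
    | CNOT c t h => exact ih _ _
    | T q =>
      simp only [compile, AProg.run, stepGate]
      split_ifs
      · exact ih _ _
      · exact ih _ _

/-- The state of the simulation of the circuit at the start. -/
def RunState.init (n m : ℕ) (r : List Bool) (σ : List ℤˣ) : RunState n m :=
  (Config.init n m, r, σ, [])

/-- The simulation of a circuit. -/
def simulate (C : Circuit n) (m : ℕ) (r : List Bool) (σ : List ℤˣ) :
    (Fin n → Fin 2) × RunState n m :=
  (List.finRange n).foldl (fun s q => stepReadout q s)
    (0, (C.foldl (fun s g => stepGate g s) (0, RunState.init n m r σ)).2)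

/-- The measurement tree for a circuit. -/
def Circuit.tree (C : Circuit n) : DTree C.tCount (Fin n → Fin 2) :=
  (compile C 0).sim (Config.init n C.tCount)

theorem Circuit.path_tree (C : Circuit n) (r : List Bool) (σ : List ℤˣ) :
    C.tree.path r σ = ((simulate C C.tCount r σ).2.2.2.2.reverse, (simulate C C.tCount r σ).1) := by
  obtain ⟨h1, h2⟩ := (compile (m := C.tCount) C 0).run_eq (RunState.init n C.tCount r σ)
  rw [simulate, ← run_compile, h1, h2]
  simp [tree, RunState.init]

theorem Circuit.fits_tree (C : Circuit n) : C.tree.Fits (n + C.length) C.tCount :=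
  (compile C 0).fits_sim _ Config.valid_init _ _ (depthLe_compile _ _ _ le_rfl)
    (by simp [Config.init])

theorem Config.stab_init (φ : QVec m) : (Config.init n m).Stab φ := by
  intro g hg
  obtain ⟨q, rfl⟩ := List.mem_ofFn.1 hg
  have h : zRow n m q = SignedPauli.single (.inl q) .Z := rfl
  rw [h, SignedPauli.mat_single]
  funext z
  have hb : z (.inl q) = 0 ∨ z (.inl q) = 1 := by have := z (.inl q); omega
  rw [atQubit_mulVec, Fin.sum_univ_two]
  rcases hb with hb | hb
  · have : Function.update z (.inl q) 0 = z := by rw [← hb]; simp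
    simp [Pauli.matrix, hb, this]
  · have hz : z ∘ .inl ≠ (0 : Fin n → Fin 2) := fun h => by
      have := congrFun h q
      simp [hb] at this
    have : Function.update z (.inl q) 1 = z := by rw [← hb]; simp
    simp [Pauli.matrix, hb, this, prodVec, ketZero, hz]

theorem Circuit.expect_tree (C : Circuit n) (w : (Fin n → Fin 2) → ℝ) :
    C.tree.expect w (magicState C.tCount) = ∑ x, w x * C.prob x := by
  rw [tree, AProg.expect_sim _ _ _ _ Config.valid_init (Config.stab_init _),
    show frameOp (Config.init n C.tCount).2 = 1 from rfl, Matrix.one_mulVec, ← ancillas_zero,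
    expect_compile _ _ _ (by simp)]
  rfl

theorem Circuit.pairwiseCommuting_tree (C : Circuit n) {α : Type*} (f : (Fin n → Fin 2) → α)
    (r : List Bool) : (C.tree.toPBC f r).PairwiseCommuting := by
  refine DTree.pairwiseCommuting_toPBC _ _ _ fun σ P hP Q hQ => ?_
  rw [PauliOp.matrix_eq_mat, PauliOp.matrix_eq_mat]
  exact SignedPauli.commute_of_anti_eq_false
    (((compile C 0).path_sim_comm _ Config.valid_init r σ).2 P hP Q hQ)

theorem Circuit.randomizedOutcomeProb_tree (C : Circuit n) {α : Type*}
    (f : (Fin n → Fin 2) → α) {k : ℕ} (hk : k = n + C.length) (a : α) :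
    randomizedOutcomeProb (fun r : Fin k → Bool => C.tree.toPBC f (List.ofFn r)) a =
      C.outcomeProb f a := by
  subst hk
  rw [DTree.randomizedOutcomeProb_toPBC _ _ _ C.fits_tree, C.expect_tree, outcomeProb]
  refine Finset.sum_congr rfl fun x _ => ?_
  split_ifs <;> simp

/-! ### The size of the state -/

/-- The number of entries of the lists in the state. -/
def RunState.weight (st : RunState n m) : ℕ :=
  st.1.1.length + st.1.2.length + st.2.1.length + st.2.2.1.length + st.2.2.2.length

theorem weight_stepRot (R : SignedPauli (Fin n ⊕ Fin m)) (st : RunState n m) :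
    (stepRot R st).weight = st.weight + 1 := by
  simp only [RunState.weight, stepRot, List.length_cons]
  omega

theorem weight_stepMeas (M : SignedPauli (Fin n ⊕ Fin m)) (st : RunState n m) :
    (stepMeas M st).2.weight ≤ st.weight + 2 := by
  rcases hg : antiRow st.1.1 (pullBack st.1.2 M) with _ | g
  · simp only [stepMeas, hg]
    split_ifs
    · exact Nat.le_add_right _ _
    · simp only [RunState.weight, List.length_tail, List.length_cons]
      omega
  · simp only [stepMeas, hg, RunState.weight, List.length_append, List.length_tail,
      List.length_singleton]
    omega

/-- The worst case is T: one measurement adds at most two entries and two rotations add one each.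
The weight thus grows linearly with the number of gates, which is the size invariant of the
simulation loop. -/
theorem weight_stepGate (g : Gate n) (s : ℕ × RunState n m) :
    (stepGate g s).2.weight ≤ s.2.weight + 4 := by
  obtain ⟨j, st⟩ := s
  cases g with
  | T q =>
    have := weight_stepMeas (gadgetRow m q j .Y) st
    simp only [stepGate]
    split_ifs <;> simp only [weight_stepRot] <;> omega
  | _ => simp only [stepGate, weight_stepRot]; omega

theorem stepGate_fst_le (g : Gate n) (s : ℕ × RunState n m) : (stepGate g s).1 ≤ s.1 + 1 := by
  obtain ⟨j, st⟩ := s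
  cases g <;> simp [stepGate]

end Run

/-! ## Programs for the simulation -/

instance : Encoded (ZMod 4) := inferInstanceAs (Encoded (Fin 4))

instance {α : Type*} [Encoded α] : Encoded (Option α) where
  enc o := o.elim .nil fun x => .cons .nil (enc x)
  enc_injective a b h := by
    cases a <;> cases b <;> simp_all [enc_injective.eq_iff]

instance {α : Type*} [Encoded α] (n m : ℕ) : Encoded (Fin n ⊕ Fin m → α) where
  enc f := enc (f ∘ Sum.inl, f ∘ Sum.inr)
  enc_injective f g h := by
    obtain ⟨h1, h2⟩ := Prod.mk.inj (enc_injective h)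
    funext j
    rcases j with j | j
    · exact congrFun h1 j
    · exact congrFun h2 j

theorem exists_size_enc_le (F : Type*) [Encoded F] [Finite F] : ∃ B, ∀ x : F, (enc x).size ≤ B := by
  obtain ⟨B, hB⟩ := (Set.finite_range fun x : F => (enc x).size).bddAbove
  exact ⟨B, fun x => hB ⟨x, rfl⟩⟩

theorem size_enc_tuple_le {F : Type*} [Encoded F] {B n : ℕ} (hB : ∀ x : F, (enc x).size ≤ B)
    (f : Fin n → F) : (enc f).size ≤ n * (B + 1) + 1 := by
  have := size_listCode_le (l := List.ofFn f) (B := B) fun g _ => hB g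
  rwa [List.length_ofFn] at this

theorem size_enc_pauli_le (p : Pauli) : (enc p).size ≤ 7 := by
  cases p <;> simp [enc, Pauli.bits, natCode, Data.size]

theorem size_enc_sign_le (s : ℤˣ) : (enc s).size ≤ 3 := by
  rcases Int.units_eq_one_or s with rfl | rfl <;> decide

theorem size_enc_bool_le (b : Bool) : (enc b).size ≤ 3 := by
  cases b <;> simp [enc, natCode, Data.size]

theorem size_enc_fin_le {n : ℕ} (k : Fin n) : (enc k).size ≤ 2 * n + 1 := by
  have := k.isLt
  have e : (enc k).size = 2 * k.val + 1 := size_natCode _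
  omega

theorem size_enc_prod {α β : Type*} [Encoded α] [Encoded β] (x : α × β) :
    (enc x).size = (enc x.1).size + (enc x.2).size + 1 := rfl

theorem size_enc_signedPauli_le {n m : ℕ} (M : SignedPauli (Fin n ⊕ Fin m)) :
    (enc M).size ≤ 8 * (n + m) + 7 := by
  have h1 := size_enc_sign_le M.1
  have h2 := size_enc_tuple_le size_enc_pauli_le (M.2 ∘ Sum.inl)
  have h3 := size_enc_tuple_le size_enc_pauli_le (M.2 ∘ Sum.inr)
  have e : (enc M).size = (enc M.1).size + ((enc (M.2 ∘ Sum.inl)).size +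
    (enc (M.2 ∘ Sum.inr)).size + 1) + 1 := rfl
  omega

theorem size_enc_pauliOp_le {m : ℕ} (P : PauliOp m) : (enc P).size ≤ 8 * m + 5 := by
  have h1 := size_enc_sign_le P.1
  have h2 := size_enc_tuple_le size_enc_pauli_le P.2
  rw [size_enc_prod]
  omega

theorem size_enc_runState_le {n m : ℕ} (st : RunState n m) :
    (enc st).size ≤ st.weight * (8 * (n + m) + 8) + 9 := by
  have h1 := size_listCode_le (l := st.1.1) fun g _ => size_enc_signedPauli_le g
  have h2 := size_listCode_le (l := st.1.2) fun g _ => size_enc_signedPauli_le g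
  have h3 := size_listCode_le (l := st.2.1) (B := 8 * (n + m) + 7) fun g _ =>
    (size_enc_bool_le g).trans (by omega)
  have h4 := size_listCode_le (l := st.2.2.1) (B := 8 * (n + m) + 7) fun g _ =>
    (size_enc_sign_le g).trans (by omega)
  have h5 := size_listCode_le (l := st.2.2.2) (B := 8 * (n + m) + 7) fun g _ =>
    (size_enc_pauliOp_le g).trans (by omega)
  have e : (enc st).size = ((listCode st.1.1).size + (listCode st.1.2).size + 1) +
    ((listCode st.2.1).size + ((listCode st.2.2.1).size + (listCode st.2.2.2).size + 1) + 1) + 1 :=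
    rfl
  have hc : 8 * (n + m) + 7 + 1 = 8 * (n + m) + 8 := rfl
  rw [hc] at h1 h2 h3 h4 h5
  rw [e, RunState.weight, add_mul, add_mul, add_mul, add_mul]
  omega

theorem size_enc_gate_le {n : ℕ} (g : Gate n) : (enc g).size ≤ 4 * n + 14 := by
  cases g with
  | CNOT c t h =>
    have h1 := size_enc_fin_le c
    have h2 := size_enc_fin_le t
    have e : (enc (Gate.CNOT c t h)).size = 7 + ((enc c).size + ((enc t).size + 1 + 1) + 1) + 1 :=
      rfl
    omega
  | H q =>
    have h1 := size_enc_fin_le q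
    have e : (enc (Gate.H q)).size = 1 + ((enc q).size + 1 + 1) + 1 := rfl
    omega
  | S q =>
    have h1 := size_enc_fin_le q
    have e : (enc (Gate.S q)).size = 3 + ((enc q).size + 1 + 1) + 1 := rfl
    omega
  | T q =>
    have h1 := size_enc_fin_le q
    have e : (enc (Gate.T q)).size = 5 + ((enc q).size + 1 + 1) + 1 := rfl
    omega

/-! ### Polynomial-time arithmetic of Pauli operators -/

namespace Comp

variable {ι : Type*} {N : ι → ℕ} {a : ι → Data}

theorem bdd_of_natCode {x : ι → ℕ} (h : Comp N a (fun i => natCode (x i))) : PolyBdd N x :=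
  h.size_right.mono fun i => by rw [size_natCode]; omega

theorem refl₂ {x : ι → Data} (ha : PolyBdd N fun i => (a i).size)
    (hx : PolyBdd N fun i => (x i).size) :
    Comp N (fun i => .cons (a i) (x i)) (fun i => .cons (a i) (x i)) :=
  refl ((ha.add hx).add (.const 1))

theorem bdd_cons {x y : ι → Data} (hx : PolyBdd N fun i => (x i).size)
    (hy : PolyBdd N fun i => (y i).size) : PolyBdd N fun i => (Data.cons (x i) (y i)).size :=
  (hx.add hy).add (.const 1)

theorem iteBool {β : ι → Type*} [∀ i, Encoded (β i)] {x y : ∀ i, β i} {b : ι → Bool}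
    (hb : Comp N a (fun i => enc (b i))) (hx : Comp N a (fun i => enc (x i)))
    (hy : Comp N a (fun i => enc (y i))) :
    Comp N a (fun i => enc (if b i then x i else y i)) :=
  iteEnc (hb.of_eq fun i => by rw [Bool.decide_eq_true]) hx hy

section Tuples

variable {K : ι → ℕ}

theorem bdd_enc_fin (hK : Comp N a (fun i => natCode (K i))) :
    PolyBdd (fun p : Σ i, Fin (K i) => N p.1) (fun p => (enc p.2).size) :=
  ((((PolyBdd.const 2).mul hK.bdd_of_natCode).add (.const 1)).comap Sigma.fst).mono
    fun p => size_enc_fin_le p.2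

/-- The entry of a tuple at the last component of the input. -/
theorem tuple_apply_snd {γ : ι → Type*} [∀ i, Encoded (γ i)] {f : ∀ i, Fin (K i) → γ i}
    (hK : Comp N a (fun i => natCode (K i))) (hf : Comp N a (fun i => enc (f i))) :
    Comp (fun p : Σ i, Fin (K i) => N p.1) (fun p => .cons (a p.1) (enc p.2))
      (fun p => enc (f p.1 p.2)) :=
  tuple_apply (ι := Σ i, Fin (K i)) (K := fun p => K p.1) (γ := fun p => γ p.1)
    (f := fun p => f p.1) (k := fun p => p.2) (hf.lift Sigma.fst (bdd_enc_fin hK))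
    (refl₂ (hK.size_left.comap Sigma.fst) (bdd_enc_fin hK)).snd

/-- A fold of a tuple of elements of a finite type with a result in a finite type. -/
theorem finFoldr {F G : Type*} [Encoded F] [Finite F] [Encoded G] [Finite G]
    (op : G → F → F) {y : ∀ i, Fin (K i) → G} {x : ι → F}
    (hK : Comp N a (fun i => natCode (K i)))
    (hy : Comp (fun p : Σ i, Fin (K i) => N p.1) (fun p => .cons (a p.1) (enc p.2))
      (fun p => enc (y p.1 p.2))) (hx : Comp N a (fun i => enc (x i))) :
    Comp N a (fun i => enc ((List.finRange (K i)).foldr (fun j s => op (y i j) s) (x i))) := by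
  obtain ⟨B, hB⟩ := exists_size_enc_le F
  refine listFoldr' (γ := fun i => Fin (K i)) (β := fun _ => F) (finRange hK) hx ?_
  have hr := refl₂ (N := fun p : Σ i, Fin (K i) × F => N p.1) (a := fun p => a p.1)
    (x := fun p => .cons (enc p.2.1) (enc p.2.2)) (hK.size_left.comap Sigma.fst)
    (bdd_cons ((bdd_enc_fin hK).comap (fun p : Σ i, Fin (K i) × F => ⟨p.1, p.2.1⟩))
      ((PolyBdd.const B).mono fun p => hB _))
  exact ofFinite₂ op ((hr.fst.cons hr.snd.fst).trans
    (hy.comap (fun p : Σ i, Fin (K i) × F => ⟨p.1, p.2.1⟩))) hr.snd.snd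

theorem constTuple {γ : Type*} [Encoded γ] (hK : Comp N a (fun i => natCode (K i))) (c : γ) :
    Comp N a (fun i => enc (fun _ : Fin (K i) => c)) :=
  tuple (γ := fun _ => γ) hK
    (const (refl₂ (hK.size_left.comap Sigma.fst) (bdd_enc_fin hK)).size_left _)

/-- The string with at most two entries different from the identity. -/
theorem pairTuple {q t : ι → ℕ} (hK : Comp N a (fun i => natCode (K i)))
    (hq : Comp N a (fun i => natCode (q i))) (ht : Comp N a (fun i => natCode (t i)))
    (A B : Pauli) : Comp N a (fun i => enc (fun j : Fin (K i) =>
      if j.val = q i then A else if j.val = t i then B else .I)) := by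
  refine tuple (γ := fun _ => Pauli) hK ?_
  have hb := bdd_enc_fin hK
  have hr := refl₂ (hK.size_left.comap Sigma.fst) hb
  have hc := fun x : Data => const hr.size_left x
  exact iteEnc (natEq hr.snd (hq.lift Sigma.fst hb)) (hc (enc A))
    (iteEnc (natEq hr.snd (ht.lift Sigma.fst hb)) (hc (enc B)) (hc (enc Pauli.I)))

end Tuples

section Paulis

variable {n m : ι → ℕ}

theorem strPhase {f g : ∀ i, Fin (n i) ⊕ Fin (m i) → Pauli}
    (hn : Comp N a (fun i => natCode (n i))) (hm : Comp N a (fun i => natCode (m i)))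
    (hf : Comp N a (fun i => enc (f i))) (hg : Comp N a (fun i => enc (g i))) :
    Comp N a (fun i => enc (PauliBased.strPhase (f i) (g i))) := by
  have key : ∀ {K : ι → ℕ} {f g : ∀ i, Fin (K i) → Pauli}, Comp N a (fun i => natCode (K i)) →
      Comp N a (fun i => enc (f i)) → Comp N a (fun i => enc (g i)) →
      Comp N a (fun i => enc (∑ j, (f i j).phase (g i j))) := by
    intro K f g hK hf hg
    refine (finFoldr (F := ZMod 4) (G := Pauli × Pauli) (fun y s => y.1.phase y.2 + s)
      (y := fun i j => (f i j, g i j)) (x := fun _ => 0) hK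
      ((tuple_apply_snd hK hf).prodMk (tuple_apply_snd hK hg)) (const hK.size_left _)).of_eq
      fun i => ?_
    rw [Fin.sum_univ_def, List.sum_eq_foldr, List.foldr_map]
  refine (ofFinite₂ (fun x y : ZMod 4 => x + y)
    (key (f := fun i => f i ∘ Sum.inl) (g := fun i => g i ∘ Sum.inl) hn hf.fst hg.fst)
    (key (f := fun i => f i ∘ Sum.inr) (g := fun i => g i ∘ Sum.inr) hm hf.snd hg.snd)).of_eq
    fun i => ?_
  rw [PauliBased.strPhase, Fintype.sum_sum_type]
  rfl

theorem anti {f g : ∀ i, Fin (n i) ⊕ Fin (m i) → Pauli}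
    (hn : Comp N a (fun i => natCode (n i))) (hm : Comp N a (fun i => natCode (m i)))
    (hf : Comp N a (fun i => enc (f i))) (hg : Comp N a (fun i => enc (g i))) :
    Comp N a (fun i => enc (PauliBased.anti (f i) (g i))) :=
  ofFinite oddPhase (strPhase hn hm hf hg)

theorem strMul {f g : ∀ i, Fin (n i) ⊕ Fin (m i) → Pauli}
    (hn : Comp N a (fun i => natCode (n i))) (hm : Comp N a (fun i => natCode (m i)))
    (hf : Comp N a (fun i => enc (f i))) (hg : Comp N a (fun i => enc (g i))) :
    Comp N a (fun i => enc (PauliBased.strMul (f i) (g i))) := by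
  have key : ∀ {K : ι → ℕ} {f g : ∀ i, Fin (K i) → Pauli}, Comp N a (fun i => natCode (K i)) →
      Comp N a (fun i => enc (f i)) → Comp N a (fun i => enc (g i)) →
      Comp N a (fun i => enc (fun j => (f i j).mul (g i j))) := fun hK hf hg =>
    tuple (γ := fun _ => Pauli) hK
      (ofFinite₂ Pauli.mul (tuple_apply_snd hK hf) (tuple_apply_snd hK hg))
  exact (key (f := fun i => f i ∘ Sum.inl) (g := fun i => g i ∘ Sum.inl) hn hf.fst hg.fst).cons
    (key (f := fun i => f i ∘ Sum.inr) (g := fun i => g i ∘ Sum.inr) hm hf.snd hg.snd)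

theorem hmul {P Q : ∀ i, SignedPauli (Fin (n i) ⊕ Fin (m i))}
    (hn : Comp N a (fun i => natCode (n i))) (hm : Comp N a (fun i => natCode (m i)))
    (hP : Comp N a (fun i => enc (P i))) (hQ : Comp N a (fun i => enc (Q i))) :
    Comp N a (fun i => enc (SignedPauli.hmul (P i) (Q i))) :=
  prodMk (ofFinite₂ (fun (u : ℤˣ) (k : ZMod 4) => u * phaseSign k)
    (ofFinite₂ (fun u v : ℤˣ => u * v) hP.prodFst hQ.prodFst)
    (strPhase hn hm hP.prodSnd hQ.prodSnd)) (strMul hn hm hP.prodSnd hQ.prodSnd)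

theorem scale {s : ι → ℤˣ} {P : ∀ i, SignedPauli (Fin (n i) ⊕ Fin (m i))}
    (hs : Comp N a (fun i => enc (s i))) (hP : Comp N a (fun i => enc (P i))) :
    Comp N a (fun i => enc (SignedPauli.scale (s i) (P i))) :=
  prodMk (ofFinite₂ (fun u v : ℤˣ => u * v) hs hP.prodFst) hP.prodSnd

theorem pull {R M : ∀ i, SignedPauli (Fin (n i) ⊕ Fin (m i))}
    (hn : Comp N a (fun i => natCode (n i))) (hm : Comp N a (fun i => natCode (m i)))
    (hR : Comp N a (fun i => enc (R i))) (hM : Comp N a (fun i => enc (M i))) :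
    Comp N a (fun i => enc (SignedPauli.pull (R i) (M i))) :=
  iteBool (anti hn hm hM.prodSnd hR.prodSnd) (hmul hn hm hR hM) hM

theorem hits {f g : ∀ i, Fin (n i) ⊕ Fin (m i) → Pauli}
    (hn : Comp N a (fun i => natCode (n i))) (hm : Comp N a (fun i => natCode (m i)))
    (hf : Comp N a (fun i => enc (f i))) (hg : Comp N a (fun i => enc (g i))) :
    Comp N a (fun i => enc (PauliBased.hits (f i) (g i))) := by
  have key : ∀ {K : ι → ℕ} {f g : ∀ i, Fin (K i) → Pauli} {r : ι → Bool},
      Comp N a (fun i => natCode (K i)) →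
      Comp N a (fun i => enc (f i)) → Comp N a (fun i => enc (g i)) →
      Comp N a (fun i => enc (r i)) →
      Comp N a (fun i => enc (leadTest (f i) (g i) (r i))) := fun {K f g r} hK hf hg hr =>
    finFoldr (F := Bool) (G := Pauli × Pauli)
      (fun y s => if y.1 = .I then s else pivotTest y.1 y.2)
      (y := fun i j => (f i j, g i j)) (x := r) hK
      ((tuple_apply_snd hK hf).prodMk (tuple_apply_snd hK hg)) hr
  exact key (f := fun i => f i ∘ Sum.inl) (g := fun i => g i ∘ Sum.inl) hn hf.fst hg.fst
    (key (f := fun i => f i ∘ Sum.inr) (g := fun i => g i ∘ Sum.inr) (r := fun _ => false) hm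
      hf.snd hg.snd (const hm.size_left _))

theorem eqId {f : ∀ i, Fin (n i) ⊕ Fin (m i) → Pauli}
    (hn : Comp N a (fun i => natCode (n i))) (hm : Comp N a (fun i => natCode (m i)))
    (hf : Comp N a (fun i => enc (f i))) :
    Comp N a (fun i => enc (decide (f i = fun _ => .I))) := by
  have key : ∀ {K : ι → ℕ} {f : ∀ i, Fin (K i) → Pauli}, Comp N a (fun i => natCode (K i)) →
      Comp N a (fun i => enc (f i)) →
      Comp N a (fun i => enc (decide (∀ j, f i j = .I))) := by
    intro K f hK hf
    refine (finFoldr (F := Bool) (G := Pauli) (fun y s => decide (y = .I) && s)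
      (x := fun _ => true) hK (tuple_apply_snd hK hf) (const hK.size_left _)).of_eq fun i => ?_
    congr 1
    have : ∀ l : List (Fin (K i)), l.foldr (fun j s => decide (f i j = .I) && s) true =
        decide (∀ j ∈ l, f i j = .I) := by
      intro l
      induction l with
      | nil => simp
      | cons j l ih => simp [ih]
    rw [this]
    simp
  refine (ofFinite₂ (fun b c => b && c) (key (f := fun i => f i ∘ Sum.inl) hn hf.fst)
    (key (f := fun i => f i ∘ Sum.inr) hm hf.snd)).of_eq fun i => ?_
  congr 1
  rw [← Bool.decide_and]
  congr 1
  simp [funext_iff]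

end Paulis

end Comp

/-! ### Polynomial-time elimination and single simulation steps -/

namespace Comp

variable {ι : Type*} {N : ι → ℕ} {a : ι → Data} {n m : ι → ℕ}

theorem bdd_signedPauli (hn : Comp N a (fun i => natCode (n i)))
    (hm : Comp N a (fun i => natCode (m i))) :
    PolyBdd N (fun i => 8 * (n i + m i) + 7) :=
  ((PolyBdd.const 8).mul (hn.bdd_of_natCode.add hm.bdd_of_natCode)).add (.const 7)

section Folds

variable {rows : ∀ i, List (SignedPauli (Fin (n i) ⊕ Fin (m i)))}
  {M : ∀ i, SignedPauli (Fin (n i) ⊕ Fin (m i))}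

theorem pullBack (hn : Comp N a (fun i => natCode (n i))) (hm : Comp N a (fun i => natCode (m i)))
    (hF : Comp N a (fun i => enc (rows i))) (hM : Comp N a (fun i => enc (M i))) :
    Comp N a (fun i => enc (PauliBased.pullBack (rows i) (M i))) := by
  refine listFoldl' (f := fun i R M => SignedPauli.pull R M) hF hM ?_
  have hB := (bdd_signedPauli hn hm).comap
    (Sigma.fst : (Σ i, SignedPauli (Fin (n i) ⊕ Fin (m i)) × SignedPauli (Fin (n i) ⊕ Fin (m i))) → ι)
  have he := bdd_cons (hB.mono fun p => size_enc_signedPauli_le p.2.1)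
    (hB.mono fun p => size_enc_signedPauli_le p.2.2)
  have hr := refl₂ (hn.size_left.comap Sigma.fst) he
  exact pull (hn.lift Sigma.fst he) (hm.lift Sigma.fst he) hr.snd.fst hr.snd.snd

theorem reduceBy (hn : Comp N a (fun i => natCode (n i))) (hm : Comp N a (fun i => natCode (m i)))
    (hF : Comp N a (fun i => enc (rows i))) (hM : Comp N a (fun i => enc (M i))) :
    Comp N a (fun i => enc (PauliBased.reduceBy (rows i) (M i))) := by
  refine listFoldr' (f := fun i g M => if PauliBased.hits g.2 M.2 then SignedPauli.hmul g M else M)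
    hF hM ?_
  have hB := (bdd_signedPauli hn hm).comap
    (Sigma.fst : (Σ i, SignedPauli (Fin (n i) ⊕ Fin (m i)) × SignedPauli (Fin (n i) ⊕ Fin (m i))) → ι)
  have he := bdd_cons (hB.mono fun p => size_enc_signedPauli_le p.2.1)
    (hB.mono fun p => size_enc_signedPauli_le p.2.2)
  have hr := refl₂ (hn.size_left.comap Sigma.fst) he
  have hn' := hn.lift Sigma.fst he
  have hm' := hm.lift Sigma.fst he
  exact iteBool (hits hn' hm' hr.snd.fst.prodSnd hr.snd.snd.prodSnd)
    (hmul hn' hm' hr.snd.fst hr.snd.snd) hr.snd.snd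

theorem antiRow (hn : Comp N a (fun i => natCode (n i))) (hm : Comp N a (fun i => natCode (m i)))
    (hF : Comp N a (fun i => enc (rows i))) (hM : Comp N a (fun i => enc (M i))) :
    Comp N a (fun i => enc (PauliBased.antiRow (rows i) (M i))) := by
  refine listFoldr' (β := fun i => Option (SignedPauli (Fin (n i) ⊕ Fin (m i))))
    (f := fun i g o => if PauliBased.anti g.2 (M i).2 then some g else o)
    (x := fun _ => none) hF (nil hF.size_left) ?_
  have hB := (bdd_signedPauli hn hm).comap (Sigma.fst : (Σ i, SignedPauli (Fin (n i) ⊕ Fin (m i)) ×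
    Option (SignedPauli (Fin (n i) ⊕ Fin (m i)))) → ι)
  have he := bdd_cons (hB.mono fun p => size_enc_signedPauli_le p.2.1)
    (y := fun p => enc p.2.2) ((hB.add (.const 2)).mono fun p => by
      rcases p with ⟨i, g, _ | g⟩
      · change 1 ≤ _
        omega
      · have h1 := size_enc_signedPauli_le g
        change 1 + (enc g).size + 1 ≤ _
        dsimp only
        omega)
  have hr := refl₂ (hn.size_left.comap Sigma.fst) he
  exact iteBool (anti (hn.lift Sigma.fst he) (hm.lift Sigma.fst he) hr.snd.fst.prodSnd
    (hM.lift Sigma.fst he).prodSnd) ((nil hr.size_left).cons hr.snd.fst) hr.snd.snd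

end Folds

section Steps

variable {M : ∀ i, SignedPauli (Fin (n i) ⊕ Fin (m i))} {st : ∀ i, RunState (n i) (m i)}

theorem stepRot (hM : Comp N a (fun i => enc (M i))) (hst : Comp N a (fun i => enc (st i))) :
    Comp N a (fun i => enc (PauliBased.stepRot (M i) (st i))) :=
  prodMk (prodMk hst.prodFst.prodFst (listCons hM hst.prodFst.prodSnd)) hst.prodSnd

theorem stepMeas (hn : Comp N a (fun i => natCode (n i))) (hm : Comp N a (fun i => natCode (m i)))
    (hM : Comp N a (fun i => enc (M i))) (hst : Comp N a (fun i => enc (st i))) :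
    Comp N a (fun i => enc (PauliBased.stepMeas (M i) (st i))) := by
  have hrows := hst.prodFst.prodFst
  have hframe := hst.prodFst.prodSnd
  have hcoins := hst.prodSnd.prodFst
  have hsigns := hst.prodSnd.prodSnd.prodFst
  have hops := hst.prodSnd.prodSnd.prodSnd
  have hK := pullBack hn hm hframe hM
  have ho := antiRow hn hm hrows hK
  have hL := reduceBy hn hm hrows hK
  -- The default value only makes the extraction total; when no row anticommutes, the result
  -- computed from it is discarded by the final case distinction.
  have hg : Comp N a (fun i => enc ((PauliBased.antiRow (st i).1.1
      (PauliBased.pullBack (st i).1.2 (M i))).getD (PauliBased.pullBack (st i).1.2 (M i)))) :=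
    (ho.cond ho.snd hK).of_eq fun i => by
      cases PauliBased.antiRow (st i).1.1 (PauliBased.pullBack (st i).1.2 (M i)) <;> rfl
  have hs := ofFinite coinSign (headD hcoins (const hn.size_left (enc false)))
  have hu := headD hsigns (const hn.size_left (enc (1 : ℤˣ)))
  have hsome := prodMk hs (prodMk (prodMk hrows (append hframe
    (listCons (l := fun _ => []) (scale hs (hmul hn hm hK hg))
      (nil hn.size_left)))) (prodMk (listTail hcoins)
      hst.prodSnd.prodSnd))
  have hnone := iteEnc (eqId hn hm hL.prodSnd) (prodMk hL.prodFst hst)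
    (prodMk hu (prodMk (prodMk (listCons (scale hu hL) hrows) hframe) (prodMk hcoins
      (prodMk (listTail hsigns) (listCons (x := fun i => ((PauliBased.reduceBy (st i).1.1
        (PauliBased.pullBack (st i).1.2 (M i))).1, (PauliBased.reduceBy (st i).1.1
        (PauliBased.pullBack (st i).1.2 (M i))).2 ∘ Sum.inr))
        (prodMk hL.prodFst hL.prodSnd.snd) hops)))))
  refine (ho.cond hsome hnone).of_eq fun i => ?_
  rw [PauliBased.stepMeas]
  cases PauliBased.antiRow (st i).1.1 (PauliBased.pullBack (st i).1.2 (M i)) <;> rfl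

/-- A string with at most two entries different from the identity, both on the first qubits. -/
theorem pairRow {q t : ι → ℕ} (hn : Comp N a (fun i => natCode (n i)))
    (hm : Comp N a (fun i => natCode (m i))) (hq : Comp N a (fun i => natCode (q i)))
    (ht : Comp N a (fun i => natCode (t i))) (s : ℤˣ) (A B : Pauli) :
    Comp N a (fun i => enc ((s, Sum.elim (fun j : Fin (n i) => if j.val = q i then A else
      if j.val = t i then B else .I) fun _ : Fin (m i) => .I) :
        SignedPauli (Fin (n i) ⊕ Fin (m i)))) :=
  prodMk (const hn.size_left (enc s)) (Comp.cons (pairTuple hn hq ht A B) (constTuple hm _))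

/-- A single label is the two-label string with both positions equal, so no separate construction is
needed. -/
theorem single {q : ∀ i, Fin (n i)} (hn : Comp N a (fun i => natCode (n i)))
    (hm : Comp N a (fun i => natCode (m i))) (hq : Comp N a (fun i => enc (q i))) (A : Pauli) :
    Comp N a (fun i => enc (SignedPauli.single (.inl (q i)) A :
      SignedPauli (Fin (n i) ⊕ Fin (m i)))) :=
  (pairRow hn hm (q := fun i => (q i).val) (t := fun i => (q i).val) hq hq 1 A A).of_eq fun i => by
    congr 2
    funext j
    rcases j with j | j <;> simp +contextual [Fin.ext_iff]

theorem gadgetRow {q : ∀ i, Fin (n i)} {j : ι → ℕ} (hn : Comp N a (fun i => natCode (n i)))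
    (hm : Comp N a (fun i => natCode (m i))) (hq : Comp N a (fun i => enc (q i)))
    (hj : Comp N a (fun i => natCode (j i))) (A : Pauli) :
    Comp N a (fun i => enc (PauliBased.gadgetRow (m i) (q i) (j i) A)) := by
  have h1 := pairTuple hn (q := fun i => (q i).val) (t := fun i => (q i).val) hq hq .Z .Z
  have h2 := pairTuple hm hj hj A A
  have := prodMk (x := fun _ => (1 : ℤˣ)) (y := fun i => (Sum.elim (fun l : Fin (n i) =>
    if l.val = (q i).val then Pauli.Z else if l.val = (q i).val then .Z else .I)
      (fun l : Fin (m i) => if l.val = j i then A else if l.val = j i then A else .I)))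
    (const hn.size_left _) (Comp.cons h1 h2)
  refine this.of_eq fun i => ?_
  congr 2
  funext l
  rcases l with l | l <;> simp +contextual [Fin.ext_iff]

theorem stepReadout {q : ∀ i, Fin (n i)} {s : ∀ i, (Fin (n i) → Fin 2) × RunState (n i) (m i)}
    (hn : Comp N a (fun i => natCode (n i))) (hm : Comp N a (fun i => natCode (m i)))
    (hq : Comp N a (fun i => enc (q i))) (hs : Comp N a (fun i => enc (s i))) :
    Comp N a (fun i => enc (PauliBased.stepReadout (q i) (s i))) := by
  have h := stepMeas hn hm (single hn hm hq .Z) hs.prodSnd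
  refine prodMk ?_ h.prodSnd
  have hb := bdd_enc_fin hn
  have hr := refl₂ (hn.size_left.comap Sigma.fst) hb
  refine (tuple (γ := fun _ => Fin 2) (f := fun i j => if j.val = (q i).val then signBit
    (PauliBased.stepMeas (.single (.inl (q i)) .Z) (s i).2).1 else (s i).1 j) hn (iteEnc
    (natEq (x := fun p : Σ i, Fin (n i) => p.2.val) (y := fun p => (q p.1).val)
      hr.snd (hq.lift Sigma.fst hb))
    (ofFinite signBit (h.prodFst.lift Sigma.fst hb)) (tuple_apply_snd hn hs.prodFst))).of_eq
    fun i => ?_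
  congr 1
  funext j
  simp [Function.update_apply, Fin.ext_iff]

end Steps
end Comp

/-! ### Gates as a tag with qubit numbers -/

section Gates

variable {n m : ℕ}

/-- The kind of a gate. -/
def Gate.kind : Gate n → Fin 4
  | .H _ => 0
  | .S _ => 1
  | .T _ => 2
  | .CNOT _ _ _ => 3

/-- The first qubit on which a gate acts. -/
def Gate.qubit : Gate n → Fin n
  | .H q => q
  | .S q => q
  | .T q => q
  | .CNOT c _ _ => c

/-- The number of the second qubit on which a gate acts, and zero if there is none. -/
def Gate.target : Gate n → ℕ
  | .CNOT _ t _ => t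
  | _ => 0

/-- The simulation of a gate with the given data. -/
def stepKind (q : Fin n) (t : ℕ) (s : ℕ × RunState n m) : Fin 4 → ℕ × RunState n m :=
  ![(s.1, stepRot (.single (.inl q) .Z) (stepRot (.single (.inl q) .X)
      (stepRot (.single (.inl q) .Z) s.2))),
    (s.1, stepRot (.single (.inl q) .Z) s.2),
    (s.1 + 1, if decide ((stepMeas (gadgetRow m q s.1 .Y) s.2).1 = 1) then
        stepRot (.scale (stepMeas (gadgetRow m q s.1 .Y) s.2).1 (gadgetRow m q s.1 .X))
          (stepMeas (gadgetRow m q s.1 .Y) s.2).2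
      else stepRot (.single (.inl q) .Z)
        (stepRot (.scale (stepMeas (gadgetRow m q s.1 .Y) s.2).1 (gadgetRow m q s.1 .X))
          (stepMeas (gadgetRow m q s.1 .Y) s.2).2)),
    (s.1, stepRot (-1, Sum.elim (fun j : Fin n => if j.val = q.val then .Z else
        if j.val = t then .X else .I) fun _ => .I) (stepRot (1, Sum.elim (fun j : Fin n =>
        if j.val = t then .X else if j.val = t then .X else .I) fun _ => .I)
      (stepRot (.single (.inl q) .Z) s.2)))]

theorem stepGate_eq (g : Gate n) (s : ℕ × RunState n m) :
    stepGate g s = stepKind g.qubit g.target s g.kind := by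
  obtain ⟨j, st⟩ := s
  cases g with
  | CNOT c t h =>
    have h1 : pairRow m c t .Z .X = (-1, Sum.elim (fun j : Fin n => if j.val = c.val then .Z else
        if j.val = t.val then .X else .I) fun _ => .I) := by
      rw [pairRow_eq]
      simp only [Fin.ext_iff]
    have h2 : SignedPauli.single (.inl t) .X = ((1, Sum.elim (fun j : Fin n =>
        if j.val = t.val then .X else if j.val = t.val then .X else .I) fun _ => .I) :
          SignedPauli (Fin n ⊕ Fin m)) := by
      refine Prod.ext rfl (funext fun l => ?_)
      rcases l with l | l <;> simp +contextual [SignedPauli.single, Fin.ext_iff]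
    rw [stepGate, h1, h2]
    rfl
  | T q =>
    by_cases h : (stepMeas (gadgetRow m q j .Y) st).1 = 1 <;>
      simp [stepGate, stepKind, Gate.kind, Gate.qubit, h]
  | _ => rfl

end Gates

/-! ### Polynomial-time simulation of the whole circuit -/

namespace Comp

variable {ι : Type*} {N : ι → ℕ} {a : ι → Data} {n m : ι → ℕ}

theorem stepKind {q : ∀ i, Fin (n i)} {t : ι → ℕ} {s : ∀ i, ℕ × RunState (n i) (m i)}
    (hn : Comp N a (fun i => natCode (n i))) (hm : Comp N a (fun i => natCode (m i)))
    (hq : Comp N a (fun i => enc (q i))) (ht : Comp N a (fun i => natCode (t i)))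
    (hs : Comp N a (fun i => enc (s i))) (v : Fin 4) :
    Comp N a (fun i => enc (PauliBased.stepKind (q i) (t i) (s i) v)) := by
  have hZ := single hn hm hq .Z
  have hX := single hn hm hq .X
  have hst := hs.prodSnd
  have hj := hs.prodFst
  have hM := stepMeas hn hm (gadgetRow hn hm hq hj .Y) hst
  have hR := stepRot (scale hM.prodFst (gadgetRow hn hm hq hj .X)) hM.prodSnd
  have h0 := hj.prodMk (stepRot hZ (stepRot hX (stepRot hZ hst)))
  have h1 := hj.prodMk (stepRot hZ hst)
  have h2 := Comp.cons ((nil hn.size_left).cons hj) (iteBool (ofFinite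
    (fun u : ℤˣ => decide (u = 1)) hM.prodFst) hR (stepRot hZ hR))
  have h3 := hj.prodMk (stepRot (pairRow hn hm (q := fun i => (q i).val) hq ht (-1) .Z .X)
    (stepRot (pairRow hn hm ht ht 1 .X .X) (stepRot hZ hst)))
  fin_cases v
  · exact h0
  · exact h1
  · exact h2
  · exact h3

theorem stepGate {g : ∀ i, Gate (n i)} {s : ∀ i, ℕ × RunState (n i) (m i)}
    (hn : Comp N a (fun i => natCode (n i))) (hm : Comp N a (fun i => natCode (m i)))
    (hg : Comp N a (fun i => enc (g i))) (hs : Comp N a (fun i => enc (s i))) :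
    Comp N a (fun i => enc (PauliBased.stepGate (g i) (s i))) := by
  have hk : Comp N a (fun i => enc (g i).kind) := hg.fst.of_eq fun i => by
    cases g i <;> rfl
  have hq : Comp N a (fun i => enc (g i).qubit) := hg.snd.fst.of_eq fun i => by
    cases g i <;> rfl
  have ht : Comp N a (fun i => natCode (g i).target) := hg.snd.snd.fst.of_eq fun i => by
    cases g i <;> rfl
  exact (finCases (g := fun v i => enc (PauliBased.stepKind (g i).qubit (g i).target (s i) v)) hk
    (stepKind hn hm hq ht hs)).of_eq fun i => by rw [stepGate_eq]

theorem bdd_gate (hn : Comp N a (fun i => natCode (n i))) :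
    PolyBdd N (fun i => 4 * n i + 14) :=
  ((PolyBdd.const 4).mul hn.bdd_of_natCode).add (.const 14)

/-- The number of physical qubits is not part of the input of the classical algorithms, so they
count the T gates themselves. -/
theorem tCount {C : ∀ i, Circuit (n i)} (hn : Comp N a (fun i => natCode (n i)))
    (hC : Comp N a (fun i => enc (C i))) : Comp N a (fun i => natCode (C i).tCount) := by
  have hl : PolyBdd N (fun i => (C i).length) :=
    hC.size_right.mono fun i => length_le_size_listCode _
  have h := listFoldr (β := fun _ => ℕ) (x := fun _ => 0)
    (f := fun i (g : Gate (n i)) s => if g.isT then s + 1 else s) (fun i k s => s ≤ k)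
    (fun i => le_rfl) (fun i k g s _ _ hs => by split_ifs <;> omega) hC (nil hC.size_left) ?_
  · refine h.of_eq fun i => ?_
    have : ∀ l : List (Gate (n i)), l.foldr (fun g s => if g.isT then s + 1 else s) 0 =
        l.countP Gate.isT := by
      intro l
      induction l with
      | nil => rfl
      | cons g l ih => rw [List.foldr_cons, ih, List.countP_cons]; split_ifs <;> rfl
    rw [this]
    rfl
  · let S := {p : Σ i, ℕ × Gate (n i) × ℕ //
        p.2.1 < (C p.1).length ∧ p.2.2.1 ∈ C p.1 ∧ p.2.2.2 ≤ p.2.1}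
    have he := bdd_cons (ι := S) (N := fun p => N p.1.1)
      (x := fun p => enc p.1.2.2.1) (y := fun p => enc p.1.2.2.2)
      (((bdd_gate hn).comap fun p : S => p.1.1).mono fun p => size_enc_gate_le p.1.2.2.1)
      (((((PolyBdd.const 2).mul hl).add (.const 1)).comap fun p : S => p.1.1).mono fun p => by
        change (natCode _).size ≤ _
        have h1 := p.2.1
        have h2 := p.2.2.2
        rw [size_natCode]
        omega)
    have hr := refl₂ (hn.size_left.comap fun p : S => p.1.1) he
    have hk : Comp (fun p : S => N p.1.1)
        (fun p => .cons (a p.1.1) (.cons (enc p.1.2.2.1) (enc p.1.2.2.2)))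
        (fun p => enc p.1.2.2.1.kind) := hr.snd.fst.fst.of_eq fun p => by
      cases p.1.2.2.1 <;> rfl
    have hT := (ofFinite (fun v : Fin 4 => decide (v = 2)) hk).of_eq
      (c := fun p => enc p.1.2.2.1.isT) fun p => by
        cases p.1.2.2.1 <;> simp [Gate.kind, Gate.isT]
    exact iteBool (β := fun _ => ℕ) hT ((nil hr.size_left).cons hr.snd.snd) hr.snd.snd

/-- There are two folds, over the gates and over the qubits to be read out. In both, the invariant
bounds the weight of the state by its initial value plus a constant per round, so every code met on
the way is polynomially small. -/
theorem simulate {C : ∀ i, Circuit (n i)} {r : ι → List Bool} {σ : ι → List ℤˣ}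
    (hn : Comp N a (fun i => natCode (n i))) (hm : Comp N a (fun i => natCode (m i)))
    (hC : Comp N a (fun i => enc (C i))) (hr : Comp N a (fun i => enc (r i)))
    (hσ : Comp N a (fun i => enc (σ i))) :
    Comp N a (fun i => enc (PauliBased.simulate (C i) (m i) (r i) (σ i))) := by
  have hlen : PolyBdd N (fun i => (C i).length) :=
    hC.size_right.mono fun i => length_le_size_listCode _
  have hnB := hn.bdd_of_natCode
  have hmB := hm.bdd_of_natCode
  have hinit : Comp N a (fun i => enc (RunState.init (n i) (m i) (r i) (σ i))) := by
    refine prodMk (prodMk (y := fun _ => []) (listOfFn hn ?_) (nil hn.size_left)) (prodMk hr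
      (prodMk (y := fun _ => []) hσ (nil hn.size_left)))
    have hb := bdd_enc_fin hn
    exact single (hn.lift Sigma.fst hb) (hm.lift Sigma.fst hb) (q := fun p => p.2)
      (refl₂ (hn.size_left.comap Sigma.fst) hb).snd .Z
  have hw : PolyBdd N (fun i => (RunState.init (n i) (m i) (r i) (σ i)).weight) := by
    refine ((hnB.add (hr.size_right.add hσ.size_right))).mono fun i => ?_
    have h1 := length_le_size_listCode (r i)
    have h2 := length_le_size_listCode (σ i)
    change _ ≤ n i + ((listCode (r i)).size + (listCode (σ i)).size)
    simp only [RunState.weight, RunState.init, Config.init, List.length_ofFn, List.length_nil]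
    omega
  have hBst : ∀ {W : ι → ℕ}, PolyBdd N W →
      PolyBdd N (fun i => W i * (8 * (n i + m i) + 8) + 9) := fun hW =>
    (hW.mul (((PolyBdd.const 8).mul (hnB.add hmB)).add (.const 8))).add (.const 9)
  have hst_le : ∀ {i} {W : ℕ} (st : RunState (n i) (m i)), st.weight ≤ W →
      (enc st).size ≤ W * (8 * (n i + m i) + 8) + 9 := fun st h =>
    (size_enc_runState_le st).trans (by gcongr)
  let W : ι → ℕ := fun i => (RunState.init (n i) (m i) (r i) (σ i)).weight + 4 * (C i).length
  have hW : PolyBdd N W := hw.add ((PolyBdd.const 4).mul hlen)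
  have hgates : Comp N a (fun i => enc ((C i).foldl (fun s g => PauliBased.stepGate g s)
      (0, RunState.init (n i) (m i) (r i) (σ i)))) := by
    refine listFoldl (β := fun i => ℕ × RunState (n i) (m i))
      (f := fun i g s => PauliBased.stepGate g s)
      (fun i k s => s.1 ≤ k ∧ s.2.weight ≤
        (RunState.init (n i) (m i) (r i) (σ i)).weight + 4 * k)
      (fun i => ⟨le_rfl, Nat.le_add_right _ _⟩) (fun i k g s _ _ hs => ?_) hC
      (prodMk (x := fun _ => (0 : ℕ)) (nil hn.size_left) hinit) ?_
    · have h1 := stepGate_fst_le g s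
      have h2 := weight_stepGate g s
      omega
    · let S := {p : Σ i, ℕ × Gate (n i) × ℕ × RunState (n i) (m i) //
          p.2.1 < (C p.1).length ∧ p.2.2.1 ∈ C p.1 ∧ p.2.2.2.1 ≤ p.2.1 ∧ p.2.2.2.2.weight ≤
            (RunState.init (n p.1) (m p.1) (r p.1) (σ p.1)).weight + 4 * p.2.1}
      have he := bdd_cons (ι := S) (N := fun p => N p.1.1)
        (x := fun p => enc p.1.2.2.1) (y := fun p => enc p.1.2.2.2)
        (((bdd_gate hn).comap fun p : S => p.1.1).mono fun p => size_enc_gate_le p.1.2.2.1)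
        ((((((PolyBdd.const 2).mul hlen).add (.const 1)).add (hBst hW)).add
          (.const 1)).comap (fun p : S => p.1.1) |>.mono fun p => by
            have h1 := p.2.1
            have h2 := p.2.2.2.1
            have h3 := hst_le (W := W p.1.1) p.1.2.2.2.2 (by
              have := p.2.2.2.2
              simp only [W]
              omega)
            rw [size_enc_prod]
            change (natCode _).size + _ + 1 ≤ _
            rw [size_natCode]
            omega)
      have hr := refl₂ (hn.size_left.comap fun p : S => p.1.1) he
      exact stepGate (hn.lift (fun p : S => p.1.1) he) (hm.lift (fun p : S => p.1.1) he)
        (g := fun p => p.1.2.2.1) (s := fun p => p.1.2.2.2) hr.snd.fst hr.snd.snd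
  have hend : ∀ i, ((C i).foldl (fun s g => PauliBased.stepGate g s)
      (0, RunState.init (n i) (m i) (r i) (σ i))).2.weight ≤ W i := by
    intro i
    have : ∀ (l : List (Gate (n i))) (s : ℕ × RunState (n i) (m i)),
        (l.foldl (fun s g => PauliBased.stepGate g s) s).2.weight ≤ s.2.weight + 4 * l.length := by
      intro l
      induction l with
      | nil => intro s; simp
      | cons g l ih =>
        intro s
        have h1 := ih (PauliBased.stepGate g s)
        have h2 := weight_stepGate g s
        rw [List.foldl_cons, List.length_cons]
        omega
    exact this _ _
  -- Each of the `n` readout measurements adds at most two to the weight reached after the gates.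
  let W' : ι → ℕ := fun i => W i + 2 * n i
  have hW' : PolyBdd N W' := hW.add ((PolyBdd.const 2).mul hnB)
  refine listFoldl (β := fun i => (Fin (n i) → Fin 2) × RunState (n i) (m i))
    (f := fun i q s => PauliBased.stepReadout q s)
    (fun i k s => s.2.weight ≤ W i + 2 * k) hend (fun i k q s _ _ hs => ?_) (finRange hn)
    (prodMk (constTuple hn 0) hgates.prodSnd) ?_
  · have := weight_stepMeas (.single (.inl q) .Z) s.2
    change (PauliBased.stepMeas _ _).2.weight ≤ _
    omega
  · let S := {p : Σ i, ℕ × Fin (n i) × (Fin (n i) → Fin 2) ×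
          RunState (n i) (m i) // p.2.1 < (List.finRange (n p.1)).length ∧
          p.2.2.1 ∈ List.finRange (n p.1) ∧ p.2.2.2.2.weight ≤ W p.1 + 2 * p.2.1}
    have he := bdd_cons (ι := S) (N := fun p => N p.1.1)
      (x := fun p => enc p.1.2.2.1) (y := fun p => enc p.1.2.2.2)
      ((bdd_enc_fin hn).comap fun p : S => ⟨p.1.1, p.1.2.2.1⟩)
      ((((hnB.mul (.const 6)).add (.const 1)).add (hBst hW')).add
        (.const 1) |>.comap (fun p : S => p.1.1) |>.mono fun p => by
          have h1 := p.2.1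
          have h2 := size_enc_tuple_le (fun x : Fin 2 => size_enc_fin_le x) p.1.2.2.2.1
          have h3 := hst_le (W := W' p.1.1) p.1.2.2.2.2 (by
            have := p.2.2.2
            rw [List.length_finRange] at h1
            simp only [W']
            omega)
          rw [size_enc_prod]
          omega)
    have hr := refl₂ (hn.size_left.comap fun p : S => p.1.1) he
    exact stepReadout (hn.lift (fun p : S => p.1.1) he) (hm.lift (fun p : S => p.1.1) he)
      (q := fun p => p.1.2.2.1) (s := fun p => p.1.2.2.2) hr.snd.fst hr.snd.snd

end Comp

/-! ### The two classical algorithms -/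

namespace Comp

variable {ι : Type*} {N : ι → ℕ} {a : ι → Data} {n m : ι → ℕ}

/-- The program that finds the next operator to be measured. -/
theorem next_tree {C : ∀ i, Circuit (n i)} {r : ι → List Bool} {σ : ι → List ℤˣ}
    (hn : Comp N a (fun i => natCode (n i))) (hC : Comp N a (fun i => enc (C i)))
    (hr : Comp N a (fun i => enc (r i))) (hσ : Comp N a (fun i => enc (σ i))) :
    Comp N a (fun i => enc ((C i).tree.next (r i) (σ i))) := by
  have hm := tCount hn hC
  have hid := prodMk (x := fun _ => (1 : ℤˣ)) (const hn.size_left _) (constTuple hm Pauli.I)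
  -- The recorded operators are the latest first, so after reversal the entry at index `(σ
  -- i).length` is the next one to measure; the identity is returned if the branch has ended.
  refine (headD (listDrop (reverse (simulate hn hm hC hr hσ).prodSnd.prodSnd.prodSnd.prodSnd)
    (length hσ)) hid).of_eq fun i => ?_
  rw [DTree.next, Circuit.path_tree, List.getD_eq_getElem?_getD, List.headD_eq_head?_getD,
    List.head?_drop]
  rfl

/-- The program that finds the outcome. -/
theorem path_tree_snd {C : ∀ i, Circuit (n i)} {r : ι → List Bool} {σ : ι → List ℤˣ}
    (hn : Comp N a (fun i => natCode (n i))) (hC : Comp N a (fun i => enc (C i)))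
    (hr : Comp N a (fun i => enc (r i))) (hσ : Comp N a (fun i => enc (σ i))) :
    Comp N a (fun i => enc ((C i).tree.path (r i) (σ i)).2) :=
  (simulate hn (tCount hn hC) hC hr hσ).prodFst.of_eq fun i => by rw [Circuit.path_tree]

end Comp

/-- A circuit together with coin flips and some eigenvalues. -/
noncomputable abbrev RunInput : Type :=
  Σ (n : ℕ) (C : Circuit n), (Fin ((Polynomial.X : Polynomial ℕ).eval (n + C.length)) → Bool) ×
    Σ t : Fin (C.tCount + 1), (Fin t → ℤˣ)

namespace RunInput

/-- The parameter of the running times. -/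
noncomputable def param (i : RunInput) : ℕ := i.1 + i.2.1.length

/-- The input of the classical algorithms. -/
noncomputable def code (i : RunInput) : Data := enc (i.1, i.2.1, i.2.2.1, i.2.2.2.2)

/-- The input is polynomially small: there are n + |C| coins, and at most as many eigenvalues as T
gates, hence at most |C|. -/
theorem comp_code : Comp param code code := by
  refine Comp.refl ?_
  have hN : PolyBdd param (fun i => i.1) := PolyBdd.param.mono fun i => Nat.le_add_right _ _
  have hC : PolyBdd param (fun i => i.2.1.length) := PolyBdd.param.mono fun i => Nat.le_add_left _ _
  have h1 : PolyBdd param (fun i => (enc i.1).size) :=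
    (((PolyBdd.const 2).mul hN).add (.const 1)).mono fun i => (size_natCode _).le
  have h2 : PolyBdd param (fun i => (enc i.2.1).size) :=
    PolyBdd.listCode hC (((PolyBdd.const 4).mul hN).add (.const 14)) (fun i => le_rfl)
      fun i g _ => size_enc_gate_le g
  have h3 : PolyBdd param (fun i => (enc i.2.2.1).size) :=
    ((PolyBdd.param.mul (.const 4)).add (.const 1)).mono fun i =>
      (size_enc_tuple_le size_enc_bool_le i.2.2.1).trans (by simp [param])
  have h4 : PolyBdd param (fun i => (enc i.2.2.2.2).size) :=
    ((PolyBdd.param.mul (.const 4)).add (.const 1)).mono fun i => by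
      have h := size_enc_tuple_le size_enc_sign_le i.2.2.2.2
      have h' := i.2.2.2.1.isLt
      have h'' : i.2.1.tCount ≤ i.2.1.length := List.countP_le_length
      simp only [param]
      omega
  exact Comp.bdd_cons h1 (Comp.bdd_cons h2 (Comp.bdd_cons h3 h4))

theorem comp_next : Comp param code (fun i =>
    enc (i.2.1.tree.next (List.ofFn i.2.2.1) (List.ofFn i.2.2.2.2))) :=
  comp_code.fst.next_tree comp_code.snd.fst comp_code.snd.snd.fst comp_code.snd.snd.snd

theorem comp_output {α : Type*} [Encoded α]
    (post : (n : ℕ) → Circuit n → (Fin n → Fin 2) → α)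
    (hpost : ∃ (p : Prog) (q : Polynomial ℕ), ∀ (n : ℕ) (C : Circuit n) (x : Fin n → Fin 2),
      p.RunsIn (enc (n, C, x)) (enc (post n C x)) (q.eval (n + C.length))) :
    Comp param code (fun i => enc (post i.1 i.2.1
      (i.2.1.tree.path (List.ofFn i.2.2.1) (List.ofFn i.2.2.2.2)).2)) := by
  obtain ⟨p, q, h⟩ := hpost
  have hx := comp_code.fst.path_tree_snd comp_code.snd.fst comp_code.snd.snd.fst
    comp_code.snd.snd.snd
  exact (comp_code.fst.cons (comp_code.snd.fst.cons hx)).trans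
    ⟨p, _, ⟨q, fun _ => le_rfl⟩, fun i => h i.1 i.2.1 _⟩

end RunInput

theorem Prog.RunsIn.mono {p : Prog} {x y : Data} {T T' : ℕ} (h : p.RunsIn x y T) (hT : T ≤ T') :
    p.RunsIn x y T' :=
  let ⟨t, ht, h⟩ := h
  ⟨t, ht.trans hT, h⟩

theorem Comp.exists_polynomial {ι : Type*} {N : ι → ℕ} {a b : ι → Data} (h : Comp N a b) :
    ∃ (p : Prog) (q : Polynomial ℕ), ∀ i, p.RunsIn (a i) (b i) (q.eval (N i)) :=
  let ⟨p, _, ⟨q, hq⟩, h⟩ := h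
  ⟨p, q, fun i => (h i).mono (hq i)⟩

end PauliBased

open PauliBased PauliBased.Encoded
theorem theorem2 {α : Type*} [Encoded α]
    (post : (n : ℕ) → Circuit n → (Fin n → Fin 2) → α)
    (hpost : ∃ (p : Prog) (q : Polynomial ℕ), ∀ (n : ℕ) (C : Circuit n) (x : Fin n → Fin 2),
      p.RunsIn (enc (n, C, x)) (enc (post n C x)) (q.eval (n + C.length))) :
    ∃ (coins : Polynomial ℕ)
      (Q : (n : ℕ) → (C : Circuit n) → (Fin (coins.eval (n + C.length)) → Bool) →
        PBC C.tCount α)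
      (choosePauli computeOutput : Prog) (time : Polynomial ℕ),
      ∀ (n : ℕ) (C : Circuit n),
        (∀ a : α, randomizedOutcomeProb (Q n C) a = C.outcomeProb (post n C) a) ∧
        (∀ r, (Q n C r).PairwiseCommuting) ∧
        (∀ r (t : Fin C.tCount) (σ : Fin t → ℤˣ),
          choosePauli.RunsIn (enc (n, C, r, σ)) (enc ((Q n C r).pauli t σ))
            (time.eval (n + C.length))) ∧
        (∀ r (σ : Fin C.tCount → ℤˣ),
          computeOutput.RunsIn (enc (n, C, r, σ)) (enc ((Q n C r).output σ))
            (time.eval (n + C.length))) := by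
  obtain ⟨p, q, hp⟩ := RunInput.comp_next.exists_polynomial
  obtain ⟨p', q', hp'⟩ := (RunInput.comp_output post hpost).exists_polynomial
  -- The polynomial X provides n + |C| coins: one for each gate and each final readout is enough, by
  -- `Circuit.fits_tree`.
  refine ⟨.X, fun n C r => C.tree.toPBC (post n C) (List.ofFn r), p, p', q + q', fun n C =>
    ⟨fun a => C.randomizedOutcomeProb_tree (post n C) Polynomial.eval_X a,
      fun r => C.pairwiseCommuting_tree (post n C) _, fun r t σ => ?_, fun r σ => ?_⟩⟩
  -- `RunInput` allows eigenvalue records of every length up to and including the number of T gates: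
  -- proper prefixes are used here, the full record for the outcome.
  · exact (hp ⟨n, C, r, t.castSucc, σ⟩).mono (by simp [RunInput.param])
  · exact (hp' ⟨n, C, r, Fin.last _, σ⟩).mono (by simp [RunInput.param])
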